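/- **Setting.** Let $U\subset\mathbb R^4$ be open with coordinates $(x^0,x^1,x^2,x^3)=(t,r,\theta,\phi)$, and let $\mathcal A$ be the space of formal power series in $\hbar$ whose coefficients are real smooth functions on $U$, with the Moyal product $$F*G=\sum_{p\ge 0}\frac{\hbar^p}{p!}\,\big(\partial_\theta\partial_{\phi'}-\partial_\phi\partial_{\theta'}\big)^pF(x)\,G(x')\Big|_{x'=x}.$$ For $X=(X^1,\dots,X^6)\in\mathcal A^6$ and a diagonal sign matrix $\eta$ put $E_i=\partial_iX$, and (summing over repeated indices) $$g_{ij}=\sum_\alpha\eta_{\alpha\alpha}E_i^\alpha*E_j^\alpha,\qquad \Upsilon_{ijl}=\tfrac12\sum_\alpha\eta_{\alpha\alpha}\big(\partial_iE_j^\alpha*E_l^\alpha-E_l^\alpha*\partial_iE_j^\alpha\big),$$ $$\Gamma_{ijl}=\tfrac12(\partial_ig_{jl}+\partial_jg_{li}-\partial_lg_{ji})+\Upsilon_{ijl},\qquad \Gamma_{ij}^k=\Gamma_{ijl}*g^{lk},$$ where $(g^{ij})$ is the two-sided $*$-inverse of $(g_{ij})$. Let $$R^l_{kij}=-\partial_j\Gamma^l_{ik}-\Gamma^p_{ik}*\Gamma^l_{jp}+\partial_i\Gamma^l_{jk}+\Gamma^p_{jk}*\Gamma^l_{ip},\quad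 R_{ij}=R^p_{ipj},\quad R^i_j=g^{ik}*R_{kj},$$ $$R=g^{ji}*R_{ij},\qquad \Theta^l_p=g^{ik}*R^l_{kpi}.$$ For a positive function $h(r)$ and a function $q(r)$, the (generalized) Kasner embedding is $X=(\sqrt h\sin t,\sqrt h\cos t,f(r),r\sin\theta\cos\phi,r\sin\theta\sin\phi,r\cos\theta)$ with $\eta=\mathrm{diag}(-1,-1,1,1,1,1)$ and $f$ smooth with $(f')^2+1=h^{-1}(1+q)$; the (generalized) Fronsdal embedding is $X=(\sqrt h\sinh t,\sqrt h\cosh t,f(r),r\sin\theta\cos\phi,r\sin\theta\sin\phi,r\cos\theta)$ with $\eta=\mathrm{diag}(-1,1,1,1,1,1)$ and $f$ smooth with $(f')^2+1=h^{-1}(1-q)$. Consider the following two cases, where $m\in\mathbb R$, and $U$ is any open set on which $r>0$, $h(r)>0$, $\sin\theta\ne0$. * *Schwarzschild:* $h=1-\frac{2m}r$, $q=\frac{m^2}{r^4}$; put $\Lambda=0$. * *Schwarzschild–de Sitter:* $h=1-\frac{r^2}{l^2}-\frac{2m}r$, $q=\big(\frac m{r^2}-\frac r{l^2}\big)^2$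 with real $l\ne0$; put $\Lambda=\frac3{l^2}$. **Theorem.** In each case, for every Kasner or Fronsdal embedding over $U$: 1. The deformed metric is the same for both kinds of embedding, namely $g_{0i}=g_{i0}=0$ for $i\neq0$ and $$g_{00}=-h,\quad g_{11}=h^{-1}+(\sin^2\theta-\cos^2\theta)\sinh^2\hbar,\quad g_{12}=g_{21}=2r\sin\theta\cos\theta\sinh^2\hbar,$$ $$g_{13}=-g_{31}=-2r\sin\theta\cos\theta\sinh\hbar\cosh\hbar,\quad g_{22}=r^2[1-(\sin^2\theta-\cos^2\theta)\sinh^2\hbar],$$ $$g_{23}=-g_{32}=r^2(\sin^2\theta-\cos^2\theta)\sinh\hbar\cosh\hbar,\quad g_{33}=r^2[\sin^2\theta+(\sin^2\theta-\cos^2\theta)\sinh^2\hbar].$$ The torsions $\Upsilon_{ijl}$ of any two such embeddings also coincide. The matrix $(g_{ij})$ has a two-sided $*$-inverse over $\mathcal A$. 2. $R^i_j+\Theta^i_j-\delta^i_jR+2\Lambda\delta^i_j=O(\hbar^2)$; that is, $R^i_j+\Theta^i_j-\delta^i_jR=O(\hbar^2)$ in the Schwarzschild case, and $R^i_j+\Theta^i_j-\delta^i_jR+\frac6{l^2}\delta^i_j=O(\hbar^2)$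 in the Schwarzschild–de Sitter case. 3. The coefficients of $\hbar^0$ and $\hbar^2$ in $R^i_j$ and $\Theta^i_j$ agree, and those of $\hbar^1$ are opposite. More precisely, $R^i_j=\Theta^i_j=0$ if exactly one of $i,j$ is $0$; $R^i_j=-\Theta^i_j=\hbar\rho^i_j+O(\hbar^3)$ if exactly one of $i,j$ is $3$; and $R^i_j=\Theta^i_j=\Lambda\delta^i_j+\hbar^2\rho^i_j+O(\hbar^4)$ otherwise, with $\rho^i_j$ given below. 4. $R^i_j+\Theta^i_j-\delta^i_jR+2\Lambda\delta^i_j=2T^i_j$, where $T^i_j=\hbar^2\tau^i_j+O(\hbar^4)$ with $\tau^i_j$ given below, and $T^i_j=0$ exactly if exactly one of $i,j$ is $0$ or exactly one of $i,j$ is $3$. Components of $\rho$ and $\tau$ that are not listed are $0$. In the Schwarzschild case, $$\begin{aligned} \rho^0_0&=-\tfrac{m[2m+3r+3(m+r)\cos2\theta]}{r^4},&\rho^1_1&=\tfrac{m[-14m+3r+(-11m+r)\cos2\theta]}{r^4},\\ \rho^2_1&=\tfrac{2m\cos^2\theta\cot\theta}{r^4},&\rho^3_1&=\tfrac{2m\cot\theta}{r^4},\\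 \rho^1_2&=\tfrac{5m(-2m+r)\sin2\theta}{r^3},&\rho^2_2&=\tfrac{m[4(m+r)+(6m+5r)\cos2\theta]}{r^4},\\ \rho^3_2&=\tfrac{4m}{r^3},&\rho^1_3&=\tfrac{m(2m-r)\sin2\theta}{r^3},\\ \rho^2_3&=\tfrac{4m\cos^2\theta}{r^3},&\rho^3_3&=\tfrac{m[-8m+8r+(-6m+9r)\cos2\theta]}{r^4}; \end{aligned}$$ $$\begin{aligned} \tau^0_0&=\tfrac{m[8m-9r+(4m-9r)\cos2\theta]}{r^4},&\tau^1_1&=\tfrac{-m[4m+3r+(4m+5r)\cos2\theta]}{r^4},\\ \tau^2_1&=\tfrac{2m\cos^2\theta\cot\theta}{r^4},&\tau^1_2&=\tfrac{5m(-2m+r)\sin2\theta}{r^3},\\ \tau^2_2&=\tfrac{m[14m-2r+(13m-r)\cos2\theta]}{r^4},&\tau^3_3&=\tfrac{m[2(m+r)+(m+3r)\cos2\theta]}{r^4}. \end{aligned}$$ In the Schwarzschild–de Sitter case, $$\begin{aligned} l^4r^4\rho^0_0&=l^2(10m-3r)r^3+10r^6-l^4m(2m+3r)-3\{-2l^2mr^3-2r^6+l^4m(m+r)\}\cos2\theta,\\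 l^4r^4\rho^1_1&=l^2(16m-9r)r^3+16r^6+l^4m(-14m+3r)+\{2l^2(5m-2r)r^3+10r^6+l^4m(-11m+r)\}\cos2\theta,\\ l^4r^4\rho^2_2&=l^2(22m-r)r^3+10r^6+4l^4m(m+r)+\{6r^6+l^2r^3(15m+4r)+l^4m(6m+5r)\}\cos2\theta,\\ l^4r^4\rho^3_3&=-8l^4m(m-r)+l^2(28m-5r)r^3+16r^6+3\{7l^2mr^3+4r^6+l^4m(-2m+3r)\}\cos2\theta, \end{aligned}$$ $$\rho^2_1=\tfrac{2(l^2m-4r^3)\cos^2\theta\cot\theta}{l^2r^4},\quad \rho^3_1=\tfrac{2(l^2m-4r^3)\cot\theta}{l^2r^4},\quad \rho^1_2=-\tfrac{[l^2(2m-r)+r^3](5l^2m+4r^3)\sin2\theta}{l^4r^3},$$ $$\rho^3_2=\tfrac8{l^2}+\tfrac{4m}{r^3},\quad \rho^1_3=\tfrac{(l^2m-4r^3)[l^2(2m-r)+r^3]\sin2\theta}{l^4r^3},\quad \rho^2_3=4\big(\tfrac2{l^2}+\tfrac m{r^3}\big)\cos^2\theta,$$ $$\begin{aligned} l^4r^4\tau^0_0&=-\big[2l^2(14m-3r)r^3+16r^6+l^4m(-8m+9r)+\{20l^2mr^3+11r^6+l^4m(-4m+9r)\}\cos2\theta\big],\\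 l^4r^4\tau^1_1&=-\big[22l^2mr^3+10r^6+l^4m(4m+3r)+\{7r^6+4l^2r^3(4m+r)+l^4m(4m+5r)\}\cos2\theta\big],\\ l^4r^4\tau^2_2&=-\big[2\{4l^2(2m-r)r^3+8r^6+l^4m(-7m+r)\}+\{l^2(11m-4r)r^3+11r^6+l^4m(-13m+r)\}\cos2\theta\big],\\ l^4r^4\tau^3_3&=2\{-5r^6+l^4m(m+r)+l^2r^3(-5m+2r)\}+\{-5l^2mr^3-5r^6+l^4m(m+3r)\}\cos2\theta, \end{aligned}$$ $$\tau^2_1=\rho^2_1,\qquad \tau^1_2=\rho^1_2.$$ -/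

import Mathlib

open scoped ContDiff Nat

namespace Moyal

/-! ### The Moyal algebra on an open region of `ℝⁿ` -/

/-- Real functions of the coordinates `x = (x 0, …, x (n-1))`. -/
abbrev Fn (n : ℕ) : Type := (Fin n → ℝ) → ℝ

/-- Formal power series in the deformation parameter `ħ` whose coefficients are functions.
Such a series represents an element of the Moyal algebra of an open region `U` when its
coefficients are smooth on `U` (`Smooth`); two series represent the same element when their
coefficients agree on `U` (`Same`).  All operations below are local, so they only depend on
the values on `U`. -/
abbrev Formal (n : ℕ) : Type := PowerSeries (Fn n)

/-- All coefficients are smooth on `U`. -/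
def Smooth {n : ℕ} (U : Set (Fin n → ℝ)) (F : Formal n) : Prop :=
  ∀ k, ContDiffOn ℝ ∞ (PowerSeries.coeff k F) U

/-- Equality of formal power series over `U`. -/
def Same {n : ℕ} (U : Set (Fin n → ℝ)) (F G : Formal n) : Prop :=
  ∀ k, ∀ x ∈ U, PowerSeries.coeff k F x = PowerSeries.coeff k G x

/-- `F = G + O(ħ ^ N)` over `U`. -/
def SameMod {n : ℕ} (N : ℕ) (U : Set (Fin n → ℝ)) (F G : Formal n) : Prop :=
  ∀ k < N, ∀ x ∈ U, PowerSeries.coeff k F x = PowerSeries.coeff k G x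

/-- The partial derivative `∂f/∂xⁱ`. -/
noncomputable def pd {n : ℕ} (i : Fin n) (f : Fn n) : Fn n :=
  fun x => fderiv ℝ f x (Pi.single i 1)

/-- The value on the diagonal `x' = x` of
`(∑ i j, θ i j (∂/∂xⁱ) (∂/∂x'ʲ)) ^ p` applied to `f(x) g(x')`. -/
noncomputable def bidiff {n : ℕ} (θ : Matrix (Fin n) (Fin n) ℝ) : ℕ → Fn n → Fn n → Fn n
  | 0, f, g => f * g
  | p + 1, f, g => ∑ i, ∑ j, θ i j • bidiff θ p (pd i f) (pd j g)

/-- The coefficient of `ħ ^ p` in the Moyal product of two functions. -/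
noncomputable def mu {n : ℕ} (θ : Matrix (Fin n) (Fin n) ℝ) (p : ℕ) (f g : Fn n) : Fn n :=
  (p ! : ℝ)⁻¹ • bidiff θ p f g

/-- The Moyal product `F ∗ G = ∑ p a b, μ_p(F_a, G_b) ħ ^ (p + a + b)`. -/
noncomputable def moyal {n : ℕ} (θ : Matrix (Fin n) (Fin n) ℝ) (F G : Formal n) : Formal n :=
  PowerSeries.mk fun k => ∑ q ∈ Finset.HasAntidiagonal.antidiagonal k,
    ∑ s ∈ Finset.HasAntidiagonal.antidiagonal q.2,
    mu θ q.1 (PowerSeries.coeff s.1 F) (PowerSeries.coeff s.2 G)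

/-- The partial derivation `∂ᵢ` of the Moyal algebra. -/
noncomputable def D {n : ℕ} (i : Fin n) (F : Formal n) : Formal n :=
  PowerSeries.mk fun k => pd i (PowerSeries.coeff k F)

/-- The Kronecker delta with values in the Moyal algebra. -/
noncomputable def delta {n : ℕ} (i j : Fin n) : Formal n := if i = j then 1 else 0

/-! ### Embedded noncommutative spaces

`X : Fin d → Formal n` is the embedding and `η : Fin d → ℝ` the diagonal of the constant
pseudo-Euclidean metric of the ambient space. -/

section Geometry

variable {n d : ℕ} (θ : Matrix (Fin n) (Fin n) ℝ) (η : Fin d → ℝ) (X : Fin d → Formal n)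

/-- The tangent vectors `Eᵢ = ∂ᵢ X`. -/
noncomputable def E (i : Fin n) (α : Fin d) : Formal n := D i (X α)

/-- The metric `g i j = ∑ α, η α Eᵢ^α ∗ Eⱼ^α`. -/
noncomputable def metric (i j : Fin n) : Formal n :=
  ∑ α, η α • moyal θ (E X i α) (E X j α)

/-- `gi` is the two-sided inverse over `U` of the matrix `g` for the Moyal product. -/
def IsInverse (U : Set (Fin n → ℝ)) (g gi : Fin n → Fin n → Formal n) : Prop :=
  (∀ i j, Smooth U (gi i j)) ∧
  (∀ i k, Same U (∑ j, moyal θ (g i j) (gi j k)) (delta i k)) ∧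
  (∀ i k, Same U (∑ j, moyal θ (gi i j) (g j k)) (delta i k))

/-- `cΓ i j l = ½ (∂ᵢ g j l + ∂ⱼ g l i - ∂ₗ g j i)`. -/
noncomputable def classicalGamma (i j l : Fin n) : Formal n :=
  (1 / 2 : ℝ) • (D i (metric θ η X j l) + D j (metric θ η X l i) - D l (metric θ η X j i))

/-- The noncommutative torsion
`Υ i j l = ½ ∑ α, η α (∂ᵢEⱼ^α ∗ Eₗ^α - Eₗ^α ∗ ∂ᵢEⱼ^α)`. -/
noncomputable def torsion (i j l : Fin n) : Formal n :=
  (1 / 2 : ℝ) • ∑ α, η α •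
    (moyal θ (D i (E X j α)) (E X l α) - moyal θ (E X l α) (D i (E X j α)))

variable (gi : Fin n → Fin n → Formal n)

/-- The coefficients `Γ i j k = (cΓ i j l + Υ i j l) ∗ g^{l k}` (upper index `k`) of the
canonical connection on the left tangent bundle, `∇ᵢ Eⱼ = Γ_{ij}^k ∗ E_k`.
Here and below `gi i j = g^{ij}` is the inverse metric. -/
noncomputable def gamma (i j k : Fin n) : Formal n :=
  ∑ l, moyal θ (classicalGamma θ η X i j l + torsion θ η X i j l) (gi l k)

/-- The Riemann curvature `R^l_{kij}`, i.e. `[∇ᵢ, ∇ⱼ] E_k = R^l_{kij} ∗ E_l`. -/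
noncomputable def riemann (l k i j : Fin n) : Formal n :=
  - D j (gamma θ η X gi i k l)
    - ∑ p, moyal θ (gamma θ η X gi i k p) (gamma θ η X gi j p l)
    + D i (gamma θ η X gi j k l)
    + ∑ p, moyal θ (gamma θ η X gi j k p) (gamma θ η X gi i p l)

/-- The Ricci curvature `R_{ij} = R^p_{ipj}`. -/
noncomputable def ricci (i j : Fin n) : Formal n := ∑ p, riemann θ η X gi p i p j

/-- `R^i_j = g^{ik} ∗ R_{kj}`. -/
noncomputable def ricciUp (i j : Fin n) : Formal n := ∑ k, moyal θ (gi i k) (ricci θ η X gi k j)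

/-- The scalar curvature `R = g^{ji} ∗ R_{ij}`. -/
noncomputable def scalar : Formal n := ∑ i, ∑ j, moyal θ (gi j i) (ricci θ η X gi i j)

/-- The second contraction `Θ^l_p = g^{ik} ∗ R^l_{kpi}`. -/
noncomputable def theta (l p : Fin n) : Formal n :=
  ∑ i, ∑ k, moyal θ (gi i k) (riemann θ η X gi l k p i)

end Geometry

/-! ### Static spherically symmetric spacetimes

Coordinates `x 0 = t`, `x 1 = r`, `x 2 = θ`, `x 3 = φ`; the Moyal product deforms the pair
`(θ, φ)`. -/

/-- The constant skew matrix of the Moyal product. -/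
def angular : Matrix (Fin 4) (Fin 4) ℝ :=
  !![0, 0, 0, 0; 0, 0, 0, 0; 0, 0, 0, 1; 0, 0, -1, 0]

/-- Kasner's embedding with lapse `h` (`h r = -g_{tt}`) and radial function `f`. -/
noncomputable def kasner (h f : ℝ → ℝ) (α : Fin 6) : Formal 4 :=
  PowerSeries.C ((![fun x => √(h (x 1)) * Real.sin (x 0),
    fun x => √(h (x 1)) * Real.cos (x 0),
    fun x => f (x 1),
    fun x => x 1 * Real.sin (x 2) * Real.cos (x 3),
    fun x => x 1 * Real.sin (x 2) * Real.sin (x 3),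
    fun x => x 1 * Real.cos (x 2)] : Fin 6 → Fn 4) α)

/-- Fronsdal's embedding with lapse `h` and radial function `f`. -/
noncomputable def fronsdal (h f : ℝ → ℝ) (α : Fin 6) : Formal 4 :=
  PowerSeries.C ((![fun x => √(h (x 1)) * Real.sinh (x 0),
    fun x => √(h (x 1)) * Real.cosh (x 0),
    fun x => f (x 1),
    fun x => x 1 * Real.sin (x 2) * Real.cos (x 3),
    fun x => x 1 * Real.sin (x 2) * Real.sin (x 3),
    fun x => x 1 * Real.cos (x 2)] : Fin 6 → Fn 4) α)

/-- `(η, X)` is Kasner's or Fronsdal's embedding over `U` with lapse `h`, where the radial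
function `f` is smooth and satisfies `f'² + 1 = h⁻¹ (1 + q)`, respectively
`f'² + 1 = h⁻¹ (1 - q)`. -/
def IsEmbedding (h q : ℝ → ℝ) (U : Set (Fin 4 → ℝ)) (η : Fin 6 → ℝ) (X : Fin 6 → Formal 4) :
    Prop :=
  ∃ f : ℝ → ℝ, ContDiffOn ℝ ∞ f ((fun x : Fin 4 → ℝ => x 1) '' U) ∧
    ((η = ![-1, -1, 1, 1, 1, 1] ∧ X = kasner h f ∧
        ∀ x ∈ U, (deriv f (x 1)) ^ 2 + 1 = (h (x 1))⁻¹ * (1 + q (x 1))) ∨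
      (η = ![-1, 1, 1, 1, 1, 1] ∧ X = fronsdal h f ∧
        ∀ x ∈ U, (deriv f (x 1)) ^ 2 + 1 = (h (x 1))⁻¹ * (1 - q (x 1))))

/-- The power series `sinh ħ`. -/
noncomputable def sinhSeries : PowerSeries ℝ :=
  PowerSeries.mk fun k => if Odd k then (k ! : ℝ)⁻¹ else 0

/-- The power series `cosh ħ`. -/
noncomputable def coshSeries : PowerSeries ℝ :=
  PowerSeries.mk fun k => if Even k then (k ! : ℝ)⁻¹ else 0

/-- The product of a scalar power series in `ħ` with a function. -/
noncomputable def scale (S : PowerSeries ℝ) (f : Fn 4) : Formal 4 :=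
  PowerSeries.mk fun k => PowerSeries.coeff k S • f

/-- The deformed metric with lapse `h`, in closed form. -/
noncomputable def deformedMetric (h : ℝ → ℝ) (i j : Fin 4) : Formal 4 :=
  let ss := sinhSeries * sinhSeries
  let sc := sinhSeries * coshSeries
  let a : Fn 4 := fun x => Real.sin (x 2) ^ 2 - Real.cos (x 2) ^ 2
  let b : Fn 4 := fun x => 2 * x 1 * Real.sin (x 2) * Real.cos (x 2)
  let r2 : Fn 4 := fun x => x 1 ^ 2
  let s2 : Fn 4 := fun x => Real.sin (x 2) ^ 2
  (![![PowerSeries.C (fun x => - h (x 1)), 0, 0, 0],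
     ![0, PowerSeries.C (fun x => (h (x 1))⁻¹) + scale ss a, scale ss b, - scale sc b],
     ![0, scale ss b, PowerSeries.C r2 - scale ss (r2 * a), scale sc (r2 * a)],
     ![0, scale sc b, - scale sc (r2 * a), PowerSeries.C (r2 * s2) + scale ss (r2 * a)]] :
    Fin 4 → Fin 4 → Formal 4) i j

/-- Exactly one of the two indices is the angle `φ`. -/
def OnePhi (i j : Fin 4) : Prop := Xor (i = 3) (j = 3)

/-- Exactly one of the two indices is the time `t`. -/
def OneTime (i j : Fin 4) : Prop := Xor (i = 0) (j = 0)

/-- The lapse of the Schwarzschild metric. -/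
noncomputable def schwarzschildLapse (m r : ℝ) : ℝ := 1 - 2 * m / r

/-- The lapse of the Schwarzschild–de Sitter metric. -/
noncomputable def deSitterLapse (m l r : ℝ) : ℝ := 1 - r ^ 2 / l ^ 2 - 2 * m / r

open Real in
/-- Schwarzschild: the leading quantum coefficient of `R^i_j` (row `i` is the upper index);
it stands at order `ħ` when exactly one index is `φ` and at order `ħ²` otherwise. -/
noncomputable def schwarzschildRicci (m : ℝ) (i j : Fin 4) : Fn 4 := fun x =>
  let r := x 1
  let th := x 2
  (![![-(m * (2 * m + 3 * r + 3 * (m + r) * cos (2 * th))) / r ^ 4, 0, 0, 0],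
     ![0,
       m * (-14 * m + 3 * r + (-11 * m + r) * cos (2 * th)) / r ^ 4,
       5 * m * (-2 * m + r) * sin (2 * th) / r ^ 3,
       m * (2 * m - r) * sin (2 * th) / r ^ 3],
     ![0,
       2 * m * cos th ^ 2 * cot th / r ^ 4,
       m * (4 * (m + r) + (6 * m + 5 * r) * cos (2 * th)) / r ^ 4,
       4 * m * cos th ^ 2 / r ^ 3],
     ![0,
       2 * m * cot th / r ^ 4,
       4 * m / r ^ 3,
       m * (-8 * m + 8 * r + (-6 * m + 9 * r) * cos (2 * th)) / r ^ 4]] :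
    Fin 4 → Fin 4 → ℝ) i j

open Real in
/-- Schwarzschild: the coefficient of `ħ²` in the tensor `T^i_j` (row `i` is the upper
index). -/
noncomputable def schwarzschildT (m : ℝ) (i j : Fin 4) : Fn 4 := fun x =>
  let r := x 1
  let th := x 2
  (![![m * (8 * m - 9 * r + (4 * m - 9 * r) * cos (2 * th)) / r ^ 4, 0, 0, 0],
     ![0,
       -m * (4 * m + 3 * r + (4 * m + 5 * r) * cos (2 * th)) / r ^ 4,
       5 * m * (-2 * m + r) * sin (2 * th) / r ^ 3,
       0],
     ![0,
       2 * m * cos th ^ 2 * cot th / r ^ 4,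
       m * (14 * m - 2 * r + (13 * m - r) * cos (2 * th)) / r ^ 4,
       0],
     ![0, 0, 0,
       m * (2 * (m + r) + (m + 3 * r) * cos (2 * th)) / r ^ 4]] :
    Fin 4 → Fin 4 → ℝ) i j

open Real in
/-- Schwarzschild–de Sitter: the leading quantum coefficient of `R^i_j` (row `i` is the upper
index); it stands at order `ħ` when exactly one index is `φ` and at order `ħ²` otherwise. -/
noncomputable def deSitterRicci (m l : ℝ) (i j : Fin 4) : Fn 4 := fun x =>
  let r := x 1
  let th := x 2
  (![![(l ^ 2 * (10 * m - 3 * r) * r ^ 3 + 10 * r ^ 6 - l ^ 4 * m * (2 * m + 3 * r)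
          - 3 * (-2 * l ^ 2 * m * r ^ 3 - 2 * r ^ 6 + l ^ 4 * m * (m + r)) * cos (2 * th))
          / (l ^ 4 * r ^ 4), 0, 0, 0],
     ![0,
       (l ^ 2 * (16 * m - 9 * r) * r ^ 3 + 16 * r ^ 6 + l ^ 4 * m * (-14 * m + 3 * r)
          + (2 * l ^ 2 * (5 * m - 2 * r) * r ^ 3 + 10 * r ^ 6 + l ^ 4 * m * (-11 * m + r))
            * cos (2 * th)) / (l ^ 4 * r ^ 4),
       -(l ^ 2 * (2 * m - r) + r ^ 3) * (5 * l ^ 2 * m + 4 * r ^ 3) * sin (2 * th)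
          / (l ^ 4 * r ^ 3),
       (l ^ 2 * m - 4 * r ^ 3) * (l ^ 2 * (2 * m - r) + r ^ 3) * sin (2 * th)
          / (l ^ 4 * r ^ 3)],
     ![0,
       2 * (l ^ 2 * m - 4 * r ^ 3) * cos th ^ 2 * cot th / (l ^ 2 * r ^ 4),
       (l ^ 2 * (22 * m - r) * r ^ 3 + 10 * r ^ 6 + 4 * l ^ 4 * m * (m + r)
          + (6 * r ^ 6 + l ^ 2 * r ^ 3 * (15 * m + 4 * r) + l ^ 4 * m * (6 * m + 5 * r))
            * cos (2 * th)) / (l ^ 4 * r ^ 4),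
       4 * (2 / l ^ 2 + m / r ^ 3) * cos th ^ 2],
     ![0,
       2 * (l ^ 2 * m - 4 * r ^ 3) * cot th / (l ^ 2 * r ^ 4),
       8 / l ^ 2 + 4 * m / r ^ 3,
       (-8 * l ^ 4 * m * (m - r) + l ^ 2 * (28 * m - 5 * r) * r ^ 3 + 16 * r ^ 6
          + 3 * (7 * l ^ 2 * m * r ^ 3 + 4 * r ^ 6 + l ^ 4 * m * (-2 * m + 3 * r))
            * cos (2 * th)) / (l ^ 4 * r ^ 4)]] :
    Fin 4 → Fin 4 → ℝ) i j

open Real in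
/-- Schwarzschild–de Sitter: the coefficient of `ħ²` in the tensor `T^i_j` (row `i` is the
upper index). -/
noncomputable def deSitterT (m l : ℝ) (i j : Fin 4) : Fn 4 := fun x =>
  let r := x 1
  let th := x 2
  (![![-(2 * l ^ 2 * (14 * m - 3 * r) * r ^ 3 + 16 * r ^ 6 + l ^ 4 * m * (-8 * m + 9 * r)
          + (20 * l ^ 2 * m * r ^ 3 + 11 * r ^ 6 + l ^ 4 * m * (-4 * m + 9 * r))
            * cos (2 * th)) / (l ^ 4 * r ^ 4), 0, 0, 0],
     ![0,
       -(22 * l ^ 2 * m * r ^ 3 + 10 * r ^ 6 + l ^ 4 * m * (4 * m + 3 * r)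
          + (7 * r ^ 6 + 4 * l ^ 2 * r ^ 3 * (4 * m + r) + l ^ 4 * m * (4 * m + 5 * r))
            * cos (2 * th)) / (l ^ 4 * r ^ 4),
       -(l ^ 2 * (2 * m - r) + r ^ 3) * (5 * l ^ 2 * m + 4 * r ^ 3) * sin (2 * th)
          / (l ^ 4 * r ^ 3),
       0],
     ![0,
       2 * (l ^ 2 * m - 4 * r ^ 3) * cos th ^ 2 * cot th / (l ^ 2 * r ^ 4),
       -(2 * (4 * l ^ 2 * (2 * m - r) * r ^ 3 + 8 * r ^ 6 + l ^ 4 * m * (-7 * m + r))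
          + (l ^ 2 * (11 * m - 4 * r) * r ^ 3 + 11 * r ^ 6 + l ^ 4 * m * (-13 * m + r))
            * cos (2 * th)) / (l ^ 4 * r ^ 4),
       0],
     ![0, 0, 0,
       (2 * (-5 * r ^ 6 + l ^ 4 * m * (m + r) + l ^ 2 * r ^ 3 * (-5 * m + 2 * r))
          + (-5 * l ^ 2 * m * r ^ 3 - 5 * r ^ 6 + l ^ 4 * m * (m + 3 * r))
            * cos (2 * th)) / (l ^ 4 * r ^ 4)]] :
    Fin 4 → Fin 4 → ℝ) i j

/-- The expansions in `ħ` of the two curvatures: components with exactly one time index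
vanish; components with exactly one index `φ` satisfy `R^i_j = -Θ^i_j = ħ ρ^i_j + O(ħ³)`; the
others satisfy `R^i_j = Θ^i_j = c δ^i_j + ħ² ρ^i_j + O(ħ⁴)`. -/
def HasExpansion (U : Set (Fin 4 → ℝ)) (c : ℝ) (ρ : Fin 4 → Fin 4 → Fn 4)
    (R T : Fin 4 → Fin 4 → Formal 4) : Prop :=
  (∀ i j, OneTime i j → Same U (R i j) 0 ∧ Same U (T i j) 0) ∧
  (∀ i j, OnePhi i j → Same U (R i j) (- T i j) ∧
    SameMod 3 U (R i j) (PowerSeries.monomial 1 (ρ i j))) ∧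
  (∀ i j, ¬ OnePhi i j → Same U (R i j) (T i j) ∧
    SameMod 4 U (R i j) (c • delta i j + PowerSeries.monomial 2 (ρ i j)))

end Moyal

open Moyal

/-! The Moyal product differentiates only in `θ` and `φ`. In both embeddings three of the six
components depend on `t` and `r` alone, so their products are the ordinary ones. The other three
describe the round sphere of radius `r`. For these the Moyal series can be summed: adding the `cos
φ` and `sin φ` components turns the `φ`-dependence into a constant phase, and the bidifferential
operators of orders `p ≥ 1` reduce to quarter-period shifts with a factor `2 ^ p / 2`. The sum over
`p` gives `sinh² ħ` and `sinh ħ cosh ħ` (`bidiff_wave`, `star_sphere`). The relation `q = h'² / 4`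
makes the non-spherical part of the metric the same for both embeddings (`exists_sphereLike`).

Consequently the metric and the connection with lower indices do not depend on `t` and `φ`, and
every further Moyal product is an ordinary product (`moyal_eq_mul`). At a fixed point the geometry
becomes matrix algebra over the commutative ring `ℝ⟦ħ⟧`; noncommutativity survives only in the
asymmetry of `g` and `Γ`. The metric is invertible because its classical part is diagonal and
nondegenerate (`exists_static_inverse`), and the inverse is unique order by order in `ħ`
(`right_inverse_unique`).

Write `Γᵢ` for the matrix with entries `∂ᵢEⱼ ∗ Eₗ` and `Γ'ᵢ` for its transpose with `ħ` replaced by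
`-ħ`. Then `∂ᵢ g = Γᵢ + Γ'ᵢ`, and eliminating the derivatives of `g⁻¹` gives the lowered curvature
`∂ᵢΓⱼ - ∂ⱼΓᵢ + Γᵢ g⁻¹ Γ'ⱼ - Γⱼ g⁻¹ Γ'ᵢ` (`lowRiem_mul`). Two symmetries determine the shape of the
expansions. Reversal of `ħ` combined with transposition takes `R^i_j` to `Θ^i_j` (`thetaAt_bar`).
Reversal of `ħ` combined with the reflection of `φ` preserves the geometry, so each `R^i_j` is even
or odd in `ħ` (`ricciAt_phi`); the reflection of `t` removes the mixed time components
(`ricciAt_time`).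

By parity only the coefficients up to `ħ²` remain to be found. They are computed in `ℝ[ħ]/ħ³` for an
arbitrary lapse, with `r`, `h`, `h'`, `h''` and `cot θ` as independent variables (`jet_ricciAt`),
and then specialised to the two lapses. -/

namespace Moyal

/-! ### Locality of the Moyal product, evaluation at a point -/

/-- Evaluation of the coefficients at a point. -/
noncomputable def ev {n : ℕ} (x : Fin n → ℝ) : Formal n →+* PowerSeries ℝ :=
  PowerSeries.map (Pi.evalRingHom (fun _ => ℝ) x)

@[simp] lemma coeff_ev {n : ℕ} (x : Fin n → ℝ) (F : Formal n) (k : ℕ) :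
    PowerSeries.coeff k (ev x F) = PowerSeries.coeff k F x := by
  simp [ev]

lemma same_iff {n : ℕ} {U : Set (Fin n → ℝ)} {F G : Formal n} :
    Same U F G ↔ ∀ x ∈ U, ev x F = ev x G := by
  refine ⟨fun h x hx => PowerSeries.ext fun k => by simpa using h k x hx, fun h k x hx => ?_⟩
  simpa using congrArg (PowerSeries.coeff k) (h x hx)

@[simp] lemma ev_C {n : ℕ} (x : Fin n → ℝ) (f : Fn n) :
    ev x (PowerSeries.C f) = PowerSeries.C (f x) := by
  simp [ev]

@[simp] lemma ev_smul {n : ℕ} (x : Fin n → ℝ) (a : ℝ) (F : Formal n) :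
    ev x (a • F) = a • ev x F := by
  ext k; simp

lemma ev_delta {n : ℕ} (x : Fin n → ℝ) (i j : Fin n) :
    ev x (delta i j) = if i = j then 1 else 0 := by
  unfold delta; split_ifs <;> simp

lemma coeff_ev_D {n : ℕ} (x : Fin n → ℝ) (i : Fin n) (F : Formal n) (k : ℕ) :
    PowerSeries.coeff k (ev x (D i F)) = pd i (PowerSeries.coeff k F) x := by
  simp [D]

/-- Openness of `U` makes functions that agree on `U` agree near each of its points. All locality
statements below rest on this. -/
lemma pd_congr {n : ℕ} {U : Set (Fin n → ℝ)} (hU : IsOpen U) {f g : Fn n}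
    (h : ∀ x ∈ U, f x = g x) (i : Fin n) : ∀ x ∈ U, pd i f x = pd i g x := fun x hx => by
  have : f =ᶠ[nhds x] g := Filter.eventually_of_mem (hU.mem_nhds hx) h
  rw [pd, pd, this.fderiv_eq]

lemma D_congr {n : ℕ} {U : Set (Fin n → ℝ)} (hU : IsOpen U) {F G : Formal n}
    (h : Same U F G) (i : Fin n) : Same U (D i F) (D i G) := fun k x hx => by
  simpa [D] using pd_congr hU (h k) i x hx

lemma bidiff_congr {n : ℕ} {U : Set (Fin n → ℝ)} (hU : IsOpen U)
    (θ : Matrix (Fin n) (Fin n) ℝ) (p : ℕ) {f f' g g' : Fn n}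
    (hf : ∀ x ∈ U, f x = f' x) (hg : ∀ x ∈ U, g x = g' x) :
    ∀ x ∈ U, bidiff θ p f g x = bidiff θ p f' g' x := by
  induction p generalizing f f' g g' with
  | zero => intro x hx; simp [bidiff, hf x hx, hg x hx]
  | succ p ih =>
    intro x hx
    simp only [bidiff, Finset.sum_apply, Pi.smul_apply]
    refine Finset.sum_congr rfl fun i _ => Finset.sum_congr rfl fun j _ => ?_
    rw [ih (pd_congr hU hf i) (pd_congr hU hg j) x hx]

lemma mu_congr {n : ℕ} {U : Set (Fin n → ℝ)} (hU : IsOpen U)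
    (θ : Matrix (Fin n) (Fin n) ℝ) (p : ℕ) {f f' g g' : Fn n}
    (hf : ∀ x ∈ U, f x = f' x) (hg : ∀ x ∈ U, g x = g' x) :
    ∀ x ∈ U, mu θ p f g x = mu θ p f' g' x := fun x hx => by
  simp only [mu, Pi.smul_apply, bidiff_congr hU θ p hf hg x hx]

lemma coeff_moyal {n : ℕ} (θ : Matrix (Fin n) (Fin n) ℝ) (F G : Formal n) (k : ℕ) :
    PowerSeries.coeff k (moyal θ F G) = ∑ q ∈ Finset.HasAntidiagonal.antidiagonal k,
      ∑ s ∈ Finset.HasAntidiagonal.antidiagonal q.2,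
        mu θ q.1 (PowerSeries.coeff s.1 F) (PowerSeries.coeff s.2 G) := by
  simp [moyal]

lemma moyal_congr {n : ℕ} {U : Set (Fin n → ℝ)} (hU : IsOpen U)
    (θ : Matrix (Fin n) (Fin n) ℝ) {F F' G G' : Formal n}
    (hF : Same U F F') (hG : Same U G G') : Same U (moyal θ F G) (moyal θ F' G') :=
  fun k x hx => by
    simp only [coeff_moyal, Finset.sum_apply]
    refine Finset.sum_congr rfl fun q _ => Finset.sum_congr rfl fun s _ => ?_
    exact mu_congr hU θ _ (hF _) (hG _) x hx

lemma Same.sum {n : ℕ} {U : Set (Fin n → ℝ)} {ι : Type*} {s : Finset ι} {F G : ι → Formal n}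
    (h : ∀ i ∈ s, Same U (F i) (G i)) : Same U (∑ i ∈ s, F i) (∑ i ∈ s, G i) := by
  rw [same_iff]
  intro x hx
  rw [map_sum, map_sum]
  exact Finset.sum_congr rfl fun i hi => same_iff.1 (h i hi) x hx

lemma Same.trans {n : ℕ} {U : Set (Fin n → ℝ)} {F G H : Formal n} (h : Same U F G)
    (h' : Same U G H) : Same U F H := fun k x hx => (h k x hx).trans (h' k x hx)

lemma Same.symm {n : ℕ} {U : Set (Fin n → ℝ)} {F G : Formal n} (h : Same U F G) :
    Same U G F := fun k x hx => (h k x hx).symm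

/-! ### Functions that are invariant along a coordinate -/

/-- `f` does not depend on the `i`-th coordinate. -/
def Inv {n : ℕ} (i : Fin n) (f : Fn n) : Prop := ∀ x (a : ℝ), f (x + Pi.single i a) = f x

/-- No differentiability is assumed: where `f` is differentiable its line derivative along the axis
vanishes, and elsewhere `fderiv` takes its default value `0`. -/
lemma Inv.pd_eq_zero {n : ℕ} {i : Fin n} {f : Fn n} (h : Inv i f) : pd i f = 0 := by
  funext x
  by_cases hd : DifferentiableAt ℝ f x
  · have h1 : HasLineDerivAt ℝ f (fderiv ℝ f x (Pi.single i 1)) x (Pi.single i 1) :=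
      hd.hasFDerivAt.hasLineDerivAt _
    have h2 : HasLineDerivAt ℝ f 0 x (Pi.single i 1) := by
      have : (fun t : ℝ => f (x + t • Pi.single i (1 : ℝ))) = fun _ => f x := by
        funext t
        rw [← h x t, ← Pi.single_smul', smul_eq_mul, mul_one]
      unfold HasLineDerivAt
      rw [this]
      exact hasDerivAt_const _ _
    exact HasDerivAt.unique h1 h2
  · simp [pd, fderiv_zero_of_not_differentiableAt hd]

/-- Differentiation commutes with translations, again without any differentiability assumption. -/
lemma Inv.pd {n : ℕ} {i : Fin n} {f : Fn n} (h : Inv i f) (j : Fin n) : Inv i (pd j f) := by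
  intro x a
  have : (fun y => f (y + Pi.single i a)) = f := funext fun y => h y a
  unfold Moyal.pd
  rw [← fderiv_comp_add_right, this]

lemma bidiff_zero_left {n : ℕ} (θ : Matrix (Fin n) (Fin n) ℝ) (p : ℕ) (g : Fn n) :
    bidiff θ p 0 g = 0 := by
  induction p generalizing g with
  | zero => simp [bidiff]
  | succ p ih =>
    have h0 : ∀ i : Fin n, pd i (0 : Fn n) = 0 := fun i => Inv.pd_eq_zero fun _ _ => rfl
    simp [bidiff, h0, ih]

lemma bidiff_zero_right {n : ℕ} (θ : Matrix (Fin n) (Fin n) ℝ) (p : ℕ) (g : Fn n) :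
    bidiff θ p g 0 = 0 := by
  induction p generalizing g with
  | zero => simp [bidiff]
  | succ p ih =>
    have h0 : ∀ i : Fin n, pd i (0 : Fn n) = 0 := fun i => Inv.pd_eq_zero fun _ _ => rfl
    simp [bidiff, h0, ih]

lemma bidiff_angular_succ (p : ℕ) (f g : Fn 4) :
    bidiff angular (p + 1) f g =
      bidiff angular p (pd 2 f) (pd 3 g) - bidiff angular p (pd 3 f) (pd 2 g) := by
  simp [bidiff, angular, Fin.sum_univ_four, sub_eq_add_neg]

/-- For `p ≥ 1` every term has a `φ`-derivative on one of the two factors. -/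
lemma mu_angular_of_inv {f g : Fn 4} (hf : Inv 3 f) (hg : Inv 3 g) (p : ℕ) :
    mu angular p f g = if p = 0 then f * g else 0 := by
  cases p with
  | zero => simp [mu, bidiff]
  | succ p =>
    simp [mu, bidiff_angular_succ, hf.pd_eq_zero, hg.pd_eq_zero, bidiff_zero_left,
      bidiff_zero_right]

/-- All coefficients are independent of the angle `φ`. -/
def PhiInv (F : Formal 4) : Prop := ∀ k, Inv 3 (PowerSeries.coeff k F)

/-- This makes the whole problem commutative: once the metric is known to be free of `φ`, all later
Moyal products are ordinary ones. -/
lemma moyal_eq_mul {F G : Formal 4} (hF : PhiInv F) (hG : PhiInv G) :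
    moyal angular F G = F * G := by
  ext1 k
  rw [coeff_moyal, PowerSeries.coeff_mul, Finset.sum_eq_single (0, k)]
  · refine Finset.sum_congr rfl fun s _ => ?_
    simp [mu_angular_of_inv (hF _) (hG _)]
  · rintro ⟨p, q⟩ hq hne
    refine Finset.sum_eq_zero fun s _ => ?_
    rw [mu_angular_of_inv (hF _) (hG _), if_neg]
    rintro rfl
    apply hne
    simpa using hq
  · simp

lemma PhiInv.C {f : Fn 4} (hf : Inv 3 f) : PhiInv (PowerSeries.C f) := fun k => by
  rw [PowerSeries.coeff_C]
  split_ifs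
  · exact hf
  · exact fun _ _ => rfl

lemma D_C {n : ℕ} (i : Fin n) (f : Fn n) : D i (PowerSeries.C f) = PowerSeries.C (pd i f) := by
  ext1 k
  simp only [D, PowerSeries.coeff_mk, PowerSeries.coeff_C]
  split_ifs
  · rfl
  · exact Inv.pd_eq_zero fun _ _ => rfl

lemma moyal_C_C (f g : Fn 4) (k : ℕ) :
    PowerSeries.coeff k (moyal angular (PowerSeries.C f) (PowerSeries.C g)) = mu angular k f g := by
  have hz : ∀ p (f : Fn 4), mu angular p f 0 = 0 := fun p f => by
    simp [mu, bidiff_zero_right]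
  have hz' : ∀ p (f : Fn 4), mu angular p 0 f = 0 := fun p f => by
    simp [mu, bidiff_zero_left]
  rw [coeff_moyal, Finset.sum_eq_single (k, 0)]
  · simp
  · rintro ⟨p, q⟩ hq hne
    refine Finset.sum_eq_zero fun s hs => ?_
    rw [PowerSeries.coeff_C, PowerSeries.coeff_C]
    have hq0 : q ≠ 0 := by
      rintro rfl
      exact hne (by simpa using hq)
    rw [Finset.HasAntidiagonal.mem_antidiagonal] at hs
    rcases Nat.eq_zero_or_pos s.1 with h1 | h1
    · have : s.2 ≠ 0 := by omega
      simp [this, hz]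
    · simp [h1.ne', hz']
  · simp

/-! ### Derivatives of the unit sphere functions -/

/-- The `n`-th derivative of the sine. -/
noncomputable def sn (n : ℕ) (x : ℝ) : ℝ := Real.sin (x + n * (Real.pi / 2))

/-- The `n`-th derivative of the cosine. -/
noncomputable def cn (n : ℕ) (x : ℝ) : ℝ := Real.cos (x + n * (Real.pi / 2))

lemma sn_zero (x : ℝ) : sn 0 x = Real.sin x := by simp [sn]
lemma cn_zero (x : ℝ) : cn 0 x = Real.cos x := by simp [cn]

lemma sn_succ (n : ℕ) (x : ℝ) : sn (n + 1) x = cn n x := by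
  rw [sn, cn, ← Real.sin_add_pi_div_two]; push_cast; ring_nf

lemma cn_succ (n : ℕ) (x : ℝ) : cn (n + 1) x = - sn n x := by
  rw [sn, cn, ← Real.cos_add_pi_div_two]; push_cast; ring_nf

lemma hasDerivAt_sn (n : ℕ) (x : ℝ) : HasDerivAt (sn n) (sn (n + 1) x) x := by
  rw [sn_succ]
  exact ((hasDerivAt_id' x).add_const (n * (Real.pi / 2))).sin.congr_deriv (mul_one _)

lemma hasDerivAt_cn (n : ℕ) (x : ℝ) : HasDerivAt (cn n) (cn (n + 1) x) x := by
  rw [cn_succ]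
  exact ((hasDerivAt_id' x).add_const (n * (Real.pi / 2))).cos.congr_deriv (mul_one _)

/-- The `n`-th derivative of the identity function. -/
def rad : ℕ → ℝ → ℝ
  | 0, r => r
  | 1, _ => 1
  | _ + 2, _ => 0

lemma hasDerivAt_rad (n : ℕ) (r : ℝ) : HasDerivAt (rad n) (rad (n + 1) r) r := by
  match n with
  | 0 => exact hasDerivAt_id r
  | 1 => exact hasDerivAt_const r 1
  | n + 2 => exact hasDerivAt_const r 0

/-- The `n`-th derivative of the constant `1`. -/
def tm : ℕ → ℝ
  | 0 => 1
  | _ + 1 => 0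

/-- A product of functions of `r`, `θ` and `φ`. -/
def sep (A B C : ℝ → ℝ) : Fn 4 := fun x => A (x 1) * B (x 2) * C (x 3)

lemma hasFDerivAt_coord {A : ℝ → ℝ} {A' : ℝ} (i : Fin 4) (x : Fin 4 → ℝ)
    (h : HasDerivAt A A' (x i)) :
    HasFDerivAt (fun y : Fin 4 → ℝ => A (y i))
      (A' • (ContinuousLinearMap.proj i : (Fin 4 → ℝ) →L[ℝ] ℝ)) x :=
  h.comp_hasFDerivAt x
    (ContinuousLinearMap.proj i : (Fin 4 → ℝ) →L[ℝ] ℝ).hasFDerivAt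

lemma differentiable_sep {A B C A' B' C' : ℝ → ℝ} (hA : ∀ t, HasDerivAt A (A' t) t)
    (hB : ∀ t, HasDerivAt B (B' t) t) (hC : ∀ t, HasDerivAt C (C' t) t) (x : Fin 4 → ℝ) :
    DifferentiableAt ℝ (sep A B C) x :=
  (((hasFDerivAt_coord 1 x (hA _)).mul (hasFDerivAt_coord 2 x (hB _))).mul
    (hasFDerivAt_coord 3 x (hC _))).differentiableAt

lemma pd_sep {A B C A' B' C' : ℝ → ℝ} (hA : ∀ t, HasDerivAt A (A' t) t)
    (hB : ∀ t, HasDerivAt B (B' t) t) (hC : ∀ t, HasDerivAt C (C' t) t) (i : Fin 4) :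
    pd i (sep A B C) = ![0, sep A' B C, sep A B' C, sep A B C'] i := by
  funext x
  have := ((hasFDerivAt_coord 1 x (hA _)).mul (hasFDerivAt_coord 2 x (hB _))).mul
    (hasFDerivAt_coord 3 x (hC _))
  have h2 : HasFDerivAt (sep A B C) _ x := this
  rw [pd, h2.fderiv]
  fin_cases i <;> simp [sep] <;> ring

/-- The derivative of `r sin θ cos φ` with multi-index `n`. -/
noncomputable def wave (n : Fin 4 → ℕ) : Fn 4 :=
  sep (fun r => tm (n 0) * rad (n 1) r) (sn (n 2)) (cn (n 3))

/-- The derivative of `r sin θ sin φ` with multi-index `n`. -/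
noncomputable def wave' (n : Fin 4 → ℕ) : Fn 4 :=
  sep (fun r => tm (n 0) * rad (n 1) r) (sn (n 2)) (sn (n 3))

/-- The derivative of `r cos θ` with multi-index `n`. -/
noncomputable def height (n : Fin 4 → ℕ) : Fn 4 :=
  sep (fun r => tm (n 0) * rad (n 1) r) (cn (n 2)) (fun _ => tm (n 3))

/-- The multi-index of `∂ᵢ`. -/
abbrev e (i : Fin 4) : Fin 4 → ℕ := Pi.single i 1

lemma hasDerivAt_tm_rad (k n : ℕ) (r : ℝ) :
    HasDerivAt (fun r => tm k * rad n r) (tm k * rad (n + 1) r) r :=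
  (hasDerivAt_rad n r).const_mul _

/-- Differentiation is a shift of the multi-index, so derivatives of the sphere functions become
arithmetic with natural numbers. In the `t` direction `tm` produces the zero. -/
lemma pd_wave (i : Fin 4) (n : Fin 4 → ℕ) : pd i (wave n) = wave (n + e i) := by
  unfold wave
  rw [pd_sep (hasDerivAt_tm_rad _ _) (hasDerivAt_sn _) (hasDerivAt_cn _)]
  fin_cases i <;> simp
  funext x; simp [sep, tm]

lemma pd_wave' (i : Fin 4) (n : Fin 4 → ℕ) : pd i (wave' n) = wave' (n + e i) := by
  unfold wave'
  rw [pd_sep (hasDerivAt_tm_rad _ _) (hasDerivAt_sn _) (hasDerivAt_sn _)]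
  fin_cases i <;> simp
  funext x; simp [sep, tm]

lemma pd_height (i : Fin 4) (n : Fin 4 → ℕ) : pd i (height n) = height (n + e i) := by
  unfold height
  rw [pd_sep (hasDerivAt_tm_rad _ _) (hasDerivAt_cn _) (fun t => hasDerivAt_const t _)]
  fin_cases i <;> simp <;> funext x <;> simp [sep, tm]

/-! ### Moyal products of the sphere functions -/

/-- The radial factor of a product of two sphere functions. -/
def amp (n m : Fin 4 → ℕ) (r : ℝ) : ℝ := tm (n 0) * rad (n 1) r * (tm (m 0) * rad (m 1) r)

/-- The phase difference of two quarter-period shifts. -/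
noncomputable def phase (a b : ℕ) : ℝ := a * (Real.pi / 2) - b * (Real.pi / 2)

/-- Summing the `cos φ` and `sin φ` components leaves only the difference of their phases. One
application of `∂_θ∂_φ' - ∂_φ∂_θ'` then shifts the phase by a quarter period in opposite directions
in its two terms. The two signs compensate, the terms agree, and each step beyond the first
contributes a factor `2`. The radial factor is untouched. -/
lemma bidiff_wave (p : ℕ) (n m : Fin 4 → ℕ) (x : Fin 4 → ℝ) :
    bidiff angular p (wave n) (wave m) x + bidiff angular p (wave' n) (wave' m) x =
      amp n m (x 1) * (if p = 0 then sn (n 2) (x 2) * sn (m 2) (x 2) * Real.cos (phase (n 3) (m 3))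
        else -(2 ^ p / 2) * cn (n 2 + m 2 + p) (2 * x 2) *
          Real.cos (phase (n 3) (m 3) - p * (Real.pi / 2))) := by
  have key : ∀ a b : ℕ, cn a (x 3) * cn b (x 3) + sn a (x 3) * sn b (x 3) =
      Real.cos (phase a b) := fun a b => by
    rw [cn, cn, sn, sn, ← Real.cos_sub, phase]; ring_nf
  induction p generalizing n m with
  | zero =>
    simp only [bidiff, Pi.mul_apply, wave, wave', sep, amp, if_true, ← key]
    ring
  | succ p ih =>
    rw [bidiff_angular_succ, bidiff_angular_succ, pd_wave, pd_wave, pd_wave, pd_wave, pd_wave',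
      pd_wave', pd_wave', pd_wave', Pi.sub_apply, Pi.sub_apply]
    rw [show ∀ a b c d : ℝ, a - b + (c - d) = (a + c) - (b + d) by intros; ring, ih, ih]
    have h2 : ((n + e 2) 2) = n 2 + 1 ∧ ((m + e 2) 2) = m 2 + 1 ∧ ((n + e 2) 3) = n 3 ∧
        ((m + e 2) 3) = m 3 := by simp
    have h3 : ((n + e 3) 3) = n 3 + 1 ∧ ((m + e 3) 3) = m 3 + 1 ∧ ((n + e 3) 2) = n 2 ∧
        ((m + e 3) 2) = m 2 := by simp
    have ha : amp (n + e 2) (m + e 3) (x 1) = amp n m (x 1) ∧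
        amp (n + e 3) (m + e 2) (x 1) = amp n m (x 1) := by simp [amp]
    obtain ⟨a1, a2, a3, a4⟩ := h2
    obtain ⟨b1, b2, b3, b4⟩ := h3
    rw [ha.1, ha.2, a1, a2, a3, a4, b1, b2, b3, b4, if_neg (Nat.succ_ne_zero p)]
    -- The passage from order `0` to order `1` is special: there the addition theorem merges the two
    -- functions of `θ` into one function of `2θ`. Later steps only shift and double it.
    rcases Nat.eq_zero_or_pos p with rfl | hp
    · have c1 : Real.cos (phase (n 3) (m 3 + 1)) = Real.sin (phase (n 3) (m 3)) := by
        rw [← Real.cos_sub_pi_div_two]; simp only [phase]; push_cast; ring_nf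
      have c2 : Real.cos (phase (n 3 + 1) (m 3)) = - Real.sin (phase (n 3) (m 3)) := by
        rw [← Real.cos_add_pi_div_two]; simp only [phase]; push_cast; ring_nf
      have c3 : sn (n 2 + m 2) (2 * x 2) =
          sn (n 2) (x 2) * cn (m 2) (x 2) + cn (n 2) (x 2) * sn (m 2) (x 2) := by
        simp only [sn, cn]
        rw [← Real.sin_add]; push_cast; ring_nf
      simp only [if_true, c1, c2, sn_succ, cn_succ, c3]
      push_cast
      rw [one_mul, Real.cos_sub_pi_div_two]
      ring
    · rw [if_neg hp.ne', if_neg hp.ne',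
        show n 2 + 1 + m 2 + p = n 2 + m 2 + (p + 1) by ring,
        show n 2 + (m 2 + 1) + p = n 2 + m 2 + (p + 1) by ring]
      have c1 : Real.cos (phase (n 3) (m 3 + 1) - p * (Real.pi / 2)) =
          Real.cos (phase (n 3) (m 3) - (p + 1 : ℕ) * (Real.pi / 2)) := by
        simp only [phase]; push_cast; ring_nf
      have c2 : Real.cos (phase (n 3 + 1) (m 3) - p * (Real.pi / 2)) =
          - Real.cos (phase (n 3) (m 3) - (p + 1 : ℕ) * (Real.pi / 2)) := by
        rw [← Real.cos_add_pi]; simp only [phase]; push_cast; ring_nf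
      rw [c1, c2]
      ring

/-! ### The hyperbolic series -/

/-- `PowerSeries.evalNegHom` is the substitution `ħ ↦ -ħ`. -/
lemma sinhSeries_eq : sinhSeries = (1 / 2 : ℝ) • (PowerSeries.exp ℝ -
    PowerSeries.evalNegHom (PowerSeries.exp ℝ)) := by
  ext k
  simp only [sinhSeries, PowerSeries.coeff_mk, PowerSeries.coeff_smul, map_sub,
    PowerSeries.coeff_exp, PowerSeries.evalNegHom, PowerSeries.coeff_rescale]
  rcases Nat.even_or_odd k with h | h
  · simp [h, Nat.not_odd_iff_even.2 h]
  · simp [h]; ring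

lemma coshSeries_eq : coshSeries = (1 / 2 : ℝ) • (PowerSeries.exp ℝ +
    PowerSeries.evalNegHom (PowerSeries.exp ℝ)) := by
  ext k
  simp only [coshSeries, PowerSeries.coeff_mk, PowerSeries.coeff_smul, map_add,
    PowerSeries.coeff_exp, PowerSeries.evalNegHom, PowerSeries.coeff_rescale]
  rcases Nat.even_or_odd k with h | h
  · simp [h]; ring
  · simp [h, Nat.not_even_iff_odd.2 h]

lemma coeff_exp_sq (k : ℕ) : PowerSeries.coeff k (PowerSeries.exp ℝ * PowerSeries.exp ℝ) =
    2 ^ k * (k ! : ℝ)⁻¹ := by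
  have h := PowerSeries.exp_pow_eq_rescale_exp (A := ℝ) 2
  rw [← pow_two, h, PowerSeries.coeff_rescale, PowerSeries.coeff_exp]
  simp

lemma coeff_neg_exp_sq (k : ℕ) : PowerSeries.coeff k
    (PowerSeries.evalNegHom (PowerSeries.exp ℝ) * PowerSeries.evalNegHom (PowerSeries.exp ℝ)) =
    (-1) ^ k * (2 ^ k * (k ! : ℝ)⁻¹) := by
  rw [← map_mul, PowerSeries.evalNegHom, PowerSeries.coeff_rescale, coeff_exp_sq]

/-- From `4 sinh² ħ = e^{2ħ} + e^{-2ħ} - 2`, where the `-2` affects only order `0`. For even `k > 0`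
the value is the factor `2 ^ k / 2` of `bidiff_wave` divided by `k !`. -/
lemma coeff_sinh_sq (k : ℕ) : PowerSeries.coeff k (sinhSeries * sinhSeries) =
    if k = 0 then 0 else if Even k then 2 ^ k / 2 * (k ! : ℝ)⁻¹ else 0 := by
  have h : sinhSeries * sinhSeries = (1 / 4 : ℝ) • (PowerSeries.exp ℝ * PowerSeries.exp ℝ +
      PowerSeries.evalNegHom (PowerSeries.exp ℝ) * PowerSeries.evalNegHom (PowerSeries.exp ℝ)
      - 2) := by
    rw [sinhSeries_eq, smul_mul_smul_comm, show (1 / 2 * (1 / 2) : ℝ) = 1 / 4 by norm_num]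
    congr 1
    linear_combination -2 * PowerSeries.exp_mul_exp_neg_eq_one (A := ℝ)
  have h2 : PowerSeries.coeff k (2 : PowerSeries ℝ) = if k = 0 then 2 else 0 := by
    rw [← map_ofNat PowerSeries.C, PowerSeries.coeff_C]
  rw [h, PowerSeries.coeff_smul, map_sub, map_add, coeff_exp_sq, coeff_neg_exp_sq, h2]
  rcases Nat.even_or_odd k with hk | hk
  · split_ifs with h0
    · subst h0; norm_num
    · simp [hk.neg_one_pow]; ring
  · have : k ≠ 0 := by rintro rfl; simp at hk
    simp [this, hk.neg_one_pow, Nat.not_even_iff_odd.2 hk]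

lemma coeff_sinh_cosh (k : ℕ) : PowerSeries.coeff k (sinhSeries * coshSeries) =
    if Even k then 0 else 2 ^ k / 2 * (k ! : ℝ)⁻¹ := by
  have h : sinhSeries * coshSeries = (1 / 4 : ℝ) • (PowerSeries.exp ℝ * PowerSeries.exp ℝ -
      PowerSeries.evalNegHom (PowerSeries.exp ℝ) * PowerSeries.evalNegHom (PowerSeries.exp ℝ)) := by
    rw [sinhSeries_eq, coshSeries_eq, smul_mul_smul_comm,
      show (1 / 2 * (1 / 2) : ℝ) = 1 / 4 by norm_num]
    congr 1
    ring
  rw [h, PowerSeries.coeff_smul, map_sub, coeff_exp_sq, coeff_neg_exp_sq]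
  rcases Nat.even_or_odd k with hk | hk
  · simp [hk, hk.neg_one_pow]
  · simp [hk.neg_one_pow, Nat.not_even_iff_odd.2 hk]; ring

/-! ### Rules for partial derivatives, and the sphere products in closed form -/

lemma pd_add {n : ℕ} {f g : Fn n} {x : Fin n → ℝ} (hf : DifferentiableAt ℝ f x)
    (hg : DifferentiableAt ℝ g x) (i : Fin n) : pd i (f + g) x = pd i f x + pd i g x := by
  simp [pd, fderiv_add hf hg]

lemma pd_mul {n : ℕ} {f g : Fn n} {x : Fin n → ℝ} (hf : DifferentiableAt ℝ f x)
    (hg : DifferentiableAt ℝ g x) (i : Fin n) :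
    pd i (f * g) x = pd i f x * g x + f x * pd i g x := by
  simp [pd, fderiv_mul hf hg]; ring

lemma pd_smul {n : ℕ} {f : Fn n} {x : Fin n → ℝ} (hf : DifferentiableAt ℝ f x) (c : ℝ)
    (i : Fin n) : pd i (c • f) x = c * pd i f x := by
  simp [pd, fderiv_const_smul hf]

lemma differentiable_wave (n : Fin 4 → ℕ) : Differentiable ℝ (wave n) :=
  differentiable_sep (hasDerivAt_tm_rad _ _) (hasDerivAt_sn _) (hasDerivAt_cn _)

lemma differentiable_wave' (n : Fin 4 → ℕ) : Differentiable ℝ (wave' n) :=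
  differentiable_sep (hasDerivAt_tm_rad _ _) (hasDerivAt_sn _) (hasDerivAt_sn _)

lemma differentiable_height (n : Fin 4 → ℕ) : Differentiable ℝ (height n) :=
  differentiable_sep (hasDerivAt_tm_rad _ _) (hasDerivAt_cn _) (fun t => hasDerivAt_const t _)

/-- The classical part of the product of two derivatives of the sphere. -/
noncomputable def sphA (n m : Fin 4 → ℕ) : Fn 4 :=
  wave n * wave m + wave' n * wave' m + height n * height m

/-- The coefficient of `- sinh² ħ` in the product of two derivatives of the sphere. -/
noncomputable def sphB (n m : Fin 4 → ℕ) : Fn 4 :=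
  sep (amp n m) (fun t => cn (n 2 + m 2) (2 * t)) (fun _ => Real.cos (phase (n 3) (m 3)))

/-- The coefficient of `sinh ħ cosh ħ` in the product of two derivatives of the sphere. -/
noncomputable def sphC (n m : Fin 4 → ℕ) : Fn 4 :=
  sep (amp n m) (fun t => sn (n 2 + m 2) (2 * t)) (fun _ => Real.sin (phase (n 3) (m 3)))

/-- The product of two derivatives of the sphere of radius `r`. -/
noncomputable def sph (n m : Fin 4 → ℕ) : Formal 4 :=
  PowerSeries.C (sphA n m) - scale (sinhSeries * sinhSeries) (sphB n m) +
    scale (sinhSeries * coshSeries) (sphC n m)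

/-- The case `p = 0` of `bidiff_wave`; in this form the independence of `φ` is visible. -/
lemma sphA_apply (n m : Fin 4 → ℕ) (x : Fin 4 → ℝ) : sphA n m x = amp n m (x 1) *
    (sn (n 2) (x 2) * sn (m 2) (x 2) * Real.cos (phase (n 3) (m 3)) +
      cn (n 2) (x 2) * cn (m 2) (x 2) * (tm (n 3) * tm (m 3))) := by
  have := bidiff_wave 0 n m x
  simp only [bidiff, Pi.mul_apply, if_true] at this
  simp only [sphA, Pi.add_apply, Pi.mul_apply, this]
  simp only [height, sep, amp]
  ring

lemma coeff_sph (n m : Fin 4 → ℕ) (k : ℕ) : PowerSeries.coeff k (sph n m) =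
    (if k = 0 then (1 : ℝ) else 0) • sphA n m
      + (-PowerSeries.coeff k (sinhSeries * sinhSeries)) • sphB n m
      + PowerSeries.coeff k (sinhSeries * coshSeries) • sphC n m := by
  rw [sph, map_add, map_sub, PowerSeries.coeff_C, scale, scale, PowerSeries.coeff_mk,
    PowerSeries.coeff_mk]
  split_ifs <;> simp [sub_eq_add_neg]

lemma inv_height (n : Fin 4 → ℕ) : Inv 3 (height n) := fun x a => by
  simp [height, sep]

lemma cn_add (N k : ℕ) (x : ℝ) : cn (N + k) x = Real.cos (x + N * (Real.pi / 2) + k * (Real.pi / 2)) := by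
  rw [cn]; push_cast; ring_nf

/-- The heights do not depend on `φ` and contribute only to order `0`. For the waves, order `k > 0`
carries two shifts by `k` quarter periods, one in `2θ` and one in the phase. For even `k` both
cosines survive and sum to the `sinh²` term; for odd `k` both become sines and sum to the `sinh
cosh` term. -/
lemma star_sphere (n m : Fin 4 → ℕ) :
    moyal angular (PowerSeries.C (wave n)) (PowerSeries.C (wave m)) +
    moyal angular (PowerSeries.C (wave' n)) (PowerSeries.C (wave' m)) +
    moyal angular (PowerSeries.C (height n)) (PowerSeries.C (height m)) = sph n m := by
  ext k x
  rw [map_add, map_add, moyal_C_C, moyal_C_C, moyal_C_C,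
    mu_angular_of_inv (inv_height n) (inv_height m), coeff_sph, coeff_sinh_sq, coeff_sinh_cosh]
  simp only [mu, Pi.add_apply, Pi.smul_apply, smul_eq_mul]
  rw [← mul_add, bidiff_wave]
  rcases Nat.eq_zero_or_pos k with rfl | hk
  · simp [sphA_apply]
    simp only [height, sep, amp]
    ring
  · rw [if_neg hk.ne', if_neg hk.ne', if_neg hk.ne', if_neg hk.ne', cn_add]
    simp only [sphB, sphC, sep, cn, sn]
    -- With `k = 2j` or `k = 2j + 1` each of the two shifts yields `(-1) ^ j`, and these signs
    -- cancel by `h3`.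
    rcases Nat.even_or_odd' k with ⟨j, rfl | rfl⟩
    · have h1 : ∀ y : ℝ, Real.cos (y + (2 * j : ℕ) * (Real.pi / 2)) = (-1) ^ j * Real.cos y := by
        intro y
        rw [← Real.cos_add_nat_mul_pi]; push_cast; ring_nf
      have h2 : ∀ y : ℝ, Real.cos (y - (2 * j : ℕ) * (Real.pi / 2)) = (-1) ^ j * Real.cos y := by
        intro y
        rw [← Real.cos_sub_nat_mul_pi]; push_cast; ring_nf
      have h3 : ((-1 : ℝ) ^ j) * (-1) ^ j = 1 := by rw [← mul_pow]; simp
      rw [h1, h2]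
      simp only [even_two_mul, if_true, Pi.zero_apply]
      linear_combination (-((2 * j) ! : ℝ)⁻¹ * amp n m (x 1) * (2 ^ (2 * j) / 2) *
        Real.cos (2 * x 2 + (n 2 + m 2 : ℕ) * (Real.pi / 2)) *
        Real.cos (phase (n 3) (m 3))) * h3
    · have h1 : ∀ y : ℝ, Real.cos (y + (2 * j + 1 : ℕ) * (Real.pi / 2)) =
          - ((-1) ^ j * Real.sin y) := by
        intro y
        rw [← mul_neg, ← Real.cos_add_pi_div_two, ← Real.cos_add_nat_mul_pi]; push_cast; ring_nf
      have h2 : ∀ y : ℝ, Real.cos (y - (2 * j + 1 : ℕ) * (Real.pi / 2)) =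
          (-1) ^ j * Real.sin y := by
        intro y
        rw [← Real.cos_sub_pi_div_two, ← Real.cos_sub_nat_mul_pi]; push_cast; ring_nf
      have h3 : ((-1 : ℝ) ^ j) * (-1) ^ j = 1 := by rw [← mul_pow]; simp
      have h4 : ¬ Even (2 * j + 1) := by simp
      rw [h1, h2]
      simp only [h4, if_false, Pi.zero_apply]
      linear_combination (((2 * j + 1) ! : ℝ)⁻¹ * amp n m (x 1) * (2 ^ (2 * j + 1) / 2) *
        Real.sin (2 * x 2 + (n 2 + m 2 : ℕ) * (Real.pi / 2)) *
        Real.sin (phase (n 3) (m 3))) * h3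

/-! ### Derivatives of the products of sphere functions -/

lemma hasDerivAt_amp (n m : Fin 4 → ℕ) (r : ℝ) :
    HasDerivAt (amp n m) (amp (n + e 1) m r + amp n (m + e 1) r) r := by
  have := (hasDerivAt_tm_rad (n 0) (n 1) r).mul (hasDerivAt_tm_rad (m 0) (m 1) r)
  exact this.congr_deriv (by simp [amp])

lemma hasDerivAt_cn_two (N : ℕ) (t : ℝ) :
    HasDerivAt (fun t => cn N (2 * t)) (2 * cn (N + 1) (2 * t)) t := by
  have := (hasDerivAt_cn N (2 * t)).comp t ((hasDerivAt_id' t).const_mul 2)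
  exact this.congr_deriv (by ring)

lemma hasDerivAt_sn_two (N : ℕ) (t : ℝ) :
    HasDerivAt (fun t => sn N (2 * t)) (2 * sn (N + 1) (2 * t)) t := by
  have := (hasDerivAt_sn N (2 * t)).comp t ((hasDerivAt_id' t).const_mul 2)
  exact this.congr_deriv (by ring)

lemma differentiable_sphA (n m : Fin 4 → ℕ) : Differentiable ℝ (sphA n m) := by
  have h1 := differentiable_wave n
  have h2 := differentiable_wave m
  have h3 := differentiable_wave' n
  have h4 := differentiable_wave' m
  have h5 := differentiable_height n
  have h6 := differentiable_height m
  exact ((h1.mul h2).add (h3.mul h4)).add (h5.mul h6)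

lemma differentiable_sphB (n m : Fin 4 → ℕ) : Differentiable ℝ (sphB n m) :=
  differentiable_sep (hasDerivAt_amp n m) (hasDerivAt_cn_two _) (fun t => hasDerivAt_const t _)

lemma differentiable_sphC (n m : Fin 4 → ℕ) : Differentiable ℝ (sphC n m) :=
  differentiable_sep (hasDerivAt_amp n m) (hasDerivAt_sn_two _) (fun t => hasDerivAt_const t _)

lemma pd_sphA (n m : Fin 4 → ℕ) (i : Fin 4) :
    pd i (sphA n m) = sphA (n + e i) m + sphA n (m + e i) := by
  funext x
  have h1 := differentiable_wave n x
  have h2 := differentiable_wave m x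
  have h3 := differentiable_wave' n x
  have h4 := differentiable_wave' m x
  have h5 := differentiable_height n x
  have h6 := differentiable_height m x
  rw [sphA, pd_add ((h1.mul h2).add (h3.mul h4)) (h5.mul h6), pd_add (h1.mul h2) (h3.mul h4),
    pd_mul h1 h2, pd_mul h3 h4, pd_mul h5 h6, pd_wave, pd_wave, pd_wave', pd_wave', pd_height,
    pd_height]
  simp only [sphA, Pi.add_apply, Pi.mul_apply]
  ring

lemma phase_succ (a b : ℕ) : phase (a + 1) b = phase a b + Real.pi / 2 ∧
    phase a (b + 1) = phase a b - Real.pi / 2 := by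
  simp only [phase]; push_cast; constructor <;> ring

lemma pd_sphB (n m : Fin 4 → ℕ) (i : Fin 4) :
    pd i (sphB n m) = sphB (n + e i) m + sphB n (m + e i) := by
  rw [sphB, pd_sep (hasDerivAt_amp n m) (hasDerivAt_cn_two _) (fun t => hasDerivAt_const t _)]
  funext x
  fin_cases i <;> simp [sphB, sep, phase_succ, Real.cos_add_pi_div_two, Real.cos_sub_pi_div_two]
  · simp [amp, tm]
  · ring
  · rw [show n 2 + 1 + m 2 = n 2 + m 2 + 1 by ring, show n 2 + (m 2 + 1) = n 2 + m 2 + 1 by ring]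
    simp [amp]; ring
  · simp [amp]

lemma pd_sphC (n m : Fin 4 → ℕ) (i : Fin 4) :
    pd i (sphC n m) = sphC (n + e i) m + sphC n (m + e i) := by
  rw [sphC, pd_sep (hasDerivAt_amp n m) (hasDerivAt_sn_two _) (fun t => hasDerivAt_const t _)]
  funext x
  fin_cases i <;> simp [sphC, sep, phase_succ, Real.sin_add_pi_div_two, Real.sin_sub_pi_div_two]
  · simp [amp, tm]
  · ring
  · rw [show n 2 + 1 + m 2 = n 2 + m 2 + 1 by ring, show n 2 + (m 2 + 1) = n 2 + m 2 + 1 by ring]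
    simp [amp]; ring
  · simp [amp]

/-- The Leibniz rule of the Moyal product, checked on the closed form. Derivatives of the metric and
of the connection are therefore sums of the same closed forms. -/
lemma D_sph (n m : Fin 4 → ℕ) (i : Fin 4) :
    D i (sph n m) = sph (n + e i) m + sph n (m + e i) := by
  ext k x
  rw [D, PowerSeries.coeff_mk, map_add, coeff_sph, coeff_sph, coeff_sph]
  have hA := differentiable_sphA n m x
  have hB := differentiable_sphB n m x
  have hC := differentiable_sphC n m x
  rw [pd_add ((hA.const_smul _).add (hB.const_smul _)) (hC.const_smul _),
    pd_add (hA.const_smul _) (hB.const_smul _), pd_smul hA, pd_smul hB, pd_smul hC, pd_sphA,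
    pd_sphB, pd_sphC]
  simp only [Pi.add_apply, Pi.smul_apply, smul_eq_mul]
  ring

/-! ### The metric and the torsion of the embeddings -/

/-- `h1` and `h2` are the first two derivatives of the smooth function `h` on the positive axis. -/
structure Lapse (h h1 h2 : ℝ → ℝ) : Prop where
  deriv_one : ∀ r, 0 < r → HasDerivAt h (h1 r) r
  deriv_two : ∀ r, 0 < r → HasDerivAt h1 (h2 r) r
  smooth : ContDiffOn ℝ ∞ h (Set.Ioi 0)
  smooth_one : ContDiffOn ℝ ∞ h1 (Set.Ioi 0)

/-- The domain of the static coordinates. -/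
def region (h : ℝ → ℝ) : Set (Fin 4 → ℝ) := {x | 0 < x 1 ∧ 0 < h (x 1) ∧ Real.sin (x 2) ≠ 0}

/-- The part of the metric that does not come from the sphere. -/
noncomputable def lapsePart (h : ℝ → ℝ) (i j : Fin 4) (r : ℝ) : ℝ :=
  if i = j then ![-h r, (h r)⁻¹ - 1, 0, 0] i else 0

/-- `(η, F)` is the sphere in flat space, together with coordinates independent of `φ`. -/
structure SphereLike (h : ℝ → ℝ) (U : Set (Fin 4 → ℝ)) (η : Fin 6 → ℝ) (F : Fin 6 → Fn 4) :
    Prop where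
  inv0 : Inv 3 (F 0)
  inv1 : Inv 3 (F 1)
  inv2 : Inv 3 (F 2)
  sphere3 : F 3 = wave 0
  sphere4 : F 4 = wave' 0
  sphere5 : F 5 = height 0
  sign3 : η 3 = 1
  sign4 : η 4 = 1
  sign5 : η 5 = 1
  lapse_part : ∀ x ∈ U, ∀ i j, η 0 * (pd i (F 0) x * pd j (F 0) x) +
    η 1 * (pd i (F 1) x * pd j (F 1) x) + η 2 * (pd i (F 2) x * pd j (F 2) x) =
      lapsePart h i j (x 1)

lemma pd_two {A B : ℝ → ℝ} {A' B' : ℝ} {x : Fin 4 → ℝ} (hA : HasDerivAt A A' (x 1))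
    (hB : HasDerivAt B B' (x 0)) (i : Fin 4) :
    pd i (fun y => A (y 1) * B (y 0)) x = ![A (x 1) * B', A' * B (x 0), 0, 0] i := by
  have h : HasFDerivAt (fun y : Fin 4 → ℝ => A (y 1) * B (y 0)) _ x :=
    (hasFDerivAt_coord 1 x hA).mul (hasFDerivAt_coord 0 x hB)
  rw [pd, h.fderiv]
  fin_cases i <;> simp
  ring

lemma pd_radial {A : ℝ → ℝ} {A' : ℝ} {x : Fin 4 → ℝ} (hA : HasDerivAt A A' (x 1)) (i : Fin 4) :
    pd i (fun y => A (y 1)) x = if i = 1 then A' else 0 := by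
  rw [pd, (hasFDerivAt_coord 1 x hA).fderiv]
  fin_cases i <;> simp

lemma waves_zero : (fun x : Fin 4 → ℝ => x 1 * Real.sin (x 2) * Real.cos (x 3)) = wave 0 ∧
    (fun x : Fin 4 → ℝ => x 1 * Real.sin (x 2) * Real.sin (x 3)) = wave' 0 ∧
    (fun x : Fin 4 → ℝ => x 1 * Real.cos (x 2)) = height 0 := by
  refine ⟨?_, ?_, ?_⟩ <;> funext x <;>
    simp [wave, wave', height, sep, tm, rad, sn_zero, cn_zero]

/-- The first two components contribute `∓ h'² / (4h)` to `g₁₁` (minus for Kasner, plus for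
Fronsdal), and `f'² = h⁻¹ (1 ± q) - 1`. With `q = h'² / 4` these cancel to `h⁻¹ - 1` in both cases;
the missing `1` comes from the sphere. In the `t` directions `sin² + cos² = 1`, respectively `cosh²
- sinh² = 1`, gives `-h` and kills the mixed entries. -/
lemma exists_sphereLike {h h1 h2 q : ℝ → ℝ} (hh : Lapse h h1 h2)
    (hq : ∀ r, 0 < r → q r = h1 r ^ 2 / 4) {U : Set (Fin 4 → ℝ)} (hU : IsOpen U)
    (hUh : U ⊆ region h) {η : Fin 6 → ℝ} {X : Fin 6 → Formal 4} (hX : IsEmbedding h q U η X) :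
    ∃ F, SphereLike h U η F ∧ X = fun α => PowerSeries.C (F α) := by
  obtain ⟨f, hf, hX⟩ := hX
  have hfd : ∀ x ∈ U, HasDerivAt f (deriv f (x 1)) (x 1) := fun x hx => by
    -- The projection to `r` is an open map, so smoothness of `f` on the image of `U` gives genuine
    -- differentiability at each of its points.
    have ho : IsOpen ((fun x : Fin 4 → ℝ => x 1) '' U) := isOpenMap_eval 1 U hU
    exact ((hf.contDiffAt (ho.mem_nhds ⟨x, hx, rfl⟩)).differentiableAt (by simp)).hasDerivAt
  have hsq : ∀ x ∈ U, HasDerivAt (fun r => √(h r)) (h1 (x 1) / (2 * √(h (x 1)))) (x 1) :=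
    fun x hx => (hh.deriv_one _ (hUh hx).1).sqrt (hUh hx).2.1.ne'
  obtain ⟨w1, w2, w3⟩ := waves_zero
  rcases hX with ⟨rfl, rfl, hfq⟩ | ⟨rfl, rfl, hfq⟩
  · refine ⟨_, ⟨?_, ?_, ?_, w1, w2, w3, rfl, rfl, rfl, ?_⟩, rfl⟩
    · intro x a; simp
    · intro x a; simp
    · intro x a; simp
    · intro x hx i j
      have hp := (hUh hx).2.1
      have hs := Real.sq_sqrt hp.le
      have hs0 := (Real.sqrt_pos.2 hp).ne'
      have hfx := hfq x hx
      rw [hq _ (hUh hx).1] at hfx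
      have hx0 := hp.ne'
      have hsc := Real.sin_sq_add_cos_sq (x 0)
      have h11 : -(h1 (x 1) / (2 * √(h (x 1)))) ^ 2 + deriv f (x 1) ^ 2 = (h (x 1))⁻¹ - 1 := by
        rw [div_pow, mul_pow, hs, eq_sub_of_add_eq hfx]
        field_simp
        ring
      simp only [Matrix.cons_val_zero, Matrix.cons_val_one, Matrix.cons_val]
      rw [pd_two (hsq x hx) (Real.hasDerivAt_sin _), pd_two (hsq x hx) (Real.hasDerivAt_sin _),
        pd_two (hsq x hx) (Real.hasDerivAt_cos _), pd_two (hsq x hx) (Real.hasDerivAt_cos _),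
        pd_radial (hfd x hx), pd_radial (hfd x hx)]
      fin_cases i <;> fin_cases j <;> simp [lapsePart]
      · linear_combination -h (x 1) * hsc - (Real.cos (x 0) ^ 2 + Real.sin (x 0) ^ 2) * hs
      · ring
      · ring
      · linear_combination h11 - (h1 (x 1) / (2 * √(h (x 1)))) ^ 2 * hsc
  · refine ⟨_, ⟨?_, ?_, ?_, w1, w2, w3, rfl, rfl, rfl, ?_⟩, rfl⟩
    · intro x a; simp
    · intro x a; simp
    · intro x a; simp
    · intro x hx i j
      have hp := (hUh hx).2.1
      have hs := Real.sq_sqrt hp.le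
      have hs0 := (Real.sqrt_pos.2 hp).ne'
      have hfx := hfq x hx
      rw [hq _ (hUh hx).1] at hfx
      have hx0 := hp.ne'
      have hsc := Real.cosh_sq (x 0)
      have h11 : (h1 (x 1) / (2 * √(h (x 1)))) ^ 2 + deriv f (x 1) ^ 2 = (h (x 1))⁻¹ - 1 := by
        rw [div_pow, mul_pow, hs, eq_sub_of_add_eq hfx]
        field_simp
        ring
      simp only [Matrix.cons_val_zero, Matrix.cons_val_one, Matrix.cons_val]
      rw [pd_two (hsq x hx) (Real.hasDerivAt_sinh _), pd_two (hsq x hx) (Real.hasDerivAt_sinh _),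
        pd_two (hsq x hx) (Real.hasDerivAt_cosh _), pd_two (hsq x hx) (Real.hasDerivAt_cosh _),
        pd_radial (hfd x hx), pd_radial (hfd x hx)]
      fin_cases i <;> fin_cases j <;> simp [lapsePart]
      · linear_combination -h (x 1) * hsc + (Real.sinh (x 0) ^ 2 - Real.cosh (x 0) ^ 2) * hs
      · ring
      · ring
      · linear_combination h11 + (h1 (x 1) / (2 * √(h (x 1)))) ^ 2 * hsc

section
variable {h : ℝ → ℝ} {U : Set (Fin 4 → ℝ)} {η : Fin 6 → ℝ} {F : Fin 6 → Fn 4}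

/-- The first three products have `φ`-independent factors and are ordinary; the last three are
summed by `star_sphere`. -/
lemma metric_same (hF : SphereLike h U η F) (i j : Fin 4) :
    Same U (metric angular η (fun α => PowerSeries.C (F α)) i j)
      (PowerSeries.C (fun x => lapsePart h i j (x 1)) + sph (e i) (e j)) := by
  rw [same_iff]
  intro x hx
  rw [map_add, ← star_sphere, metric, Fin.sum_univ_six]
  simp only [E, D_C, hF.sphere3, hF.sphere4, hF.sphere5, hF.sign3, hF.sign4, hF.sign5, pd_wave,
    pd_wave', pd_height, one_smul, zero_add]
  rw [moyal_eq_mul (PhiInv.C (hF.inv0.pd _)) (PhiInv.C (hF.inv0.pd _)),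
    moyal_eq_mul (PhiInv.C (hF.inv1.pd _)) (PhiInv.C (hF.inv1.pd _)),
    moyal_eq_mul (PhiInv.C (hF.inv2.pd _)) (PhiInv.C (hF.inv2.pd _))]
  simp only [map_add, ev_smul, map_mul, ev_C, ← hF.lapse_part x hx, PowerSeries.smul_eq_C_mul]
  ring

/-- The first three components drop out, since commutators of `φ`-independent elements vanish. The
right-hand side involves neither `h` nor `f`, so the torsion does not see which embedding is used.
-/
lemma torsion_eq (hF : SphereLike h U η F) (i j l : Fin 4) :
    torsion angular η (fun α => PowerSeries.C (F α)) i j l =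
      (1 / 2 : ℝ) • (sph (e i + e j) (e l) - sph (e l) (e i + e j)) := by
  rw [← star_sphere, ← star_sphere, torsion, Fin.sum_univ_six]
  simp only [E, D_C, hF.sphere3, hF.sphere4, hF.sphere5, hF.sign3, hF.sign4, hF.sign5, pd_wave,
    pd_wave', pd_height, one_smul, zero_add, add_comm (e j) (e i)]
  rw [moyal_eq_mul (PhiInv.C ((hF.inv0.pd _).pd _)) (PhiInv.C (hF.inv0.pd _)),
    moyal_eq_mul (PhiInv.C (hF.inv1.pd _)) (PhiInv.C ((hF.inv1.pd _).pd _)),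
    moyal_eq_mul (PhiInv.C ((hF.inv1.pd _).pd _)) (PhiInv.C (hF.inv1.pd _)),
    moyal_eq_mul (PhiInv.C (hF.inv2.pd _)) (PhiInv.C ((hF.inv2.pd _).pd _)),
    moyal_eq_mul (PhiInv.C ((hF.inv2.pd _).pd _)) (PhiInv.C (hF.inv2.pd _)),
    moyal_eq_mul (PhiInv.C (hF.inv0.pd _)) (PhiInv.C ((hF.inv0.pd _).pd _))]
  congr 1
  rw [mul_comm (PowerSeries.C (pd l (F 0))), mul_comm (PowerSeries.C (pd l (F 1))),
    mul_comm (PowerSeries.C (pd l (F 2)))]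
  simp only [sub_self, smul_zero]
  abel

end

/-! ### Static functions -/

lemma pd_sum {n : ℕ} {ι : Type*} (s : Finset ι) {f : ι → Fn n} {x : Fin n → ℝ}
    (hf : ∀ i ∈ s, DifferentiableAt ℝ (f i) x) (i : Fin n) :
    pd i (∑ a ∈ s, f a) x = ∑ a ∈ s, pd i (f a) x := by
  simp [pd, fderiv_sum hf]

/-- The ring of functions of `r` and `θ` that are smooth on `V`. -/
def staticRing (V : Set (Fin 4 → ℝ)) : Subring (Fn 4) where
  carrier := {f | (∀ x y : Fin 4 → ℝ, x 1 = y 1 → x 2 = y 2 → f x = f y) ∧ ContDiffOn ℝ ∞ f V}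
  mul_mem' := fun ha hb => ⟨fun x y h1 h2 => by
    rw [Pi.mul_apply, Pi.mul_apply, ha.1 x y h1 h2, hb.1 x y h1 h2], ha.2.mul hb.2⟩
  one_mem' := ⟨fun _ _ _ _ => rfl, contDiffOn_const⟩
  add_mem' := fun ha hb => ⟨fun x y h1 h2 => by
    rw [Pi.add_apply, Pi.add_apply, ha.1 x y h1 h2, hb.1 x y h1 h2], ha.2.add hb.2⟩
  zero_mem' := ⟨fun _ _ _ _ => rfl, contDiffOn_const⟩
  neg_mem' := fun ha => ⟨fun x y h1 h2 => by
    rw [Pi.neg_apply, Pi.neg_apply, ha.1 x y h1 h2], ha.2.neg⟩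

lemma staticRing.inv {V : Set (Fin 4 → ℝ)} {f : Fn 4} (hf : f ∈ staticRing V) {i : Fin 4}
    (hi : i = 0 ∨ i = 3) : Inv i f := fun x a => by
  apply hf.1 <;> rcases hi with rfl | rfl <;> simp

lemma staticRing.differentiableAt {V : Set (Fin 4 → ℝ)} (hV : IsOpen V) {f : Fn 4}
    (hf : f ∈ staticRing V) {x : Fin 4 → ℝ} (hx : x ∈ V) : DifferentiableAt ℝ f x :=
  (hf.2.contDiffAt (hV.mem_nhds hx)).differentiableAt (by simp)

lemma staticRing.pd_mem {V : Set (Fin 4 → ℝ)} (hV : IsOpen V) {f : Fn 4}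
    (hf : f ∈ staticRing V) (i : Fin 4) : pd i f ∈ staticRing V := by
  refine ⟨fun x y h1 h2 => ?_, ?_⟩
  -- Points with the same `r` and `θ` differ by a translation that leaves `f` unchanged, and hence
  -- its derivative too.
  · have : (fun z => f (z + (y - x))) = f := funext fun z => hf.1 _ _ (by simp [h1]) (by simp [h2])
    have h := fderiv_comp_add_right (𝕜 := ℝ) (f := f) (x := x) (y - x)
    rw [this, add_sub_cancel] at h
    rw [pd, pd, h]
  · exact (hf.2.fderiv_of_isOpen hV (m := ∞) (by simp)).clm_apply contDiffOn_const

/-- All coefficients are functions of `r` and `θ`, smooth on `V`. -/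
def IsStatic (V : Set (Fin 4 → ℝ)) (F : Formal 4) : Prop :=
  ∀ k, PowerSeries.coeff k F ∈ staticRing V

section
variable {V : Set (Fin 4 → ℝ)} {F G : Formal 4}

lemma IsStatic.phiInv (hF : IsStatic V F) : PhiInv F := fun k => staticRing.inv (hF k) (Or.inr rfl)

lemma IsStatic.smooth (hF : IsStatic V F) : Smooth V F := fun k => (hF k).2

lemma IsStatic.add (hF : IsStatic V F) (hG : IsStatic V G) : IsStatic V (F + G) := fun k => by
  rw [map_add]; exact add_mem (hF k) (hG k)

lemma IsStatic.neg (hF : IsStatic V F) : IsStatic V (-F) := fun k => by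
  rw [map_neg]; exact neg_mem (hF k)

lemma IsStatic.sub (hF : IsStatic V F) (hG : IsStatic V G) : IsStatic V (F - G) := fun k => by
  rw [map_sub]; exact sub_mem (hF k) (hG k)

lemma IsStatic.mul (hF : IsStatic V F) (hG : IsStatic V G) : IsStatic V (F * G) := fun k => by
  rw [PowerSeries.coeff_mul]; exact sum_mem fun s _ => mul_mem (hF _) (hG _)

lemma IsStatic.sum {ι : Type*} {s : Finset ι} {F : ι → Formal 4}
    (hF : ∀ i ∈ s, IsStatic V (F i)) : IsStatic V (∑ i ∈ s, F i) := fun k => by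
  rw [map_sum]; exact sum_mem fun i hi => hF i hi k

lemma IsStatic.D (hV : IsOpen V) (hF : IsStatic V F) (i : Fin 4) : IsStatic V (D i F) :=
  fun k => by
    rw [Moyal.D, PowerSeries.coeff_mk]; exact staticRing.pd_mem hV (hF k) i

lemma IsStatic.C {f : Fn 4} (hf : f ∈ staticRing V) : IsStatic V (PowerSeries.C f) := fun k => by
  rw [PowerSeries.coeff_C]; split_ifs
  · exact hf
  · exact zero_mem _

lemma ev_D_mul (hV : IsOpen V) (hF : IsStatic V F) (hG : IsStatic V G) {x : Fin 4 → ℝ}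
    (hx : x ∈ V) (i : Fin 4) :
    ev x (D i (F * G)) = ev x (D i F) * ev x G + ev x F * ev x (D i G) := by
  ext k
  have hd : ∀ s ∈ Finset.HasAntidiagonal.antidiagonal k, DifferentiableAt ℝ
      (PowerSeries.coeff s.1 F * PowerSeries.coeff s.2 G) x := fun s _ =>
    (staticRing.differentiableAt hV (hF _) hx).mul (staticRing.differentiableAt hV (hG _) hx)
  rw [coeff_ev_D, PowerSeries.coeff_mul, pd_sum _ hd, map_add, PowerSeries.coeff_mul,
    PowerSeries.coeff_mul, ← Finset.sum_add_distrib]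
  refine Finset.sum_congr rfl fun s _ => ?_
  rw [pd_mul (staticRing.differentiableAt hV (hF _) hx) (staticRing.differentiableAt hV (hG _) hx), coeff_ev_D,
    coeff_ev_D, coeff_ev, coeff_ev]

lemma ev_D_add (hV : IsOpen V) (hF : IsStatic V F) (hG : IsStatic V G) {x : Fin 4 → ℝ}
    (hx : x ∈ V) (i : Fin 4) :
    ev x (D i (F + G)) = ev x (D i F) + ev x (D i G) := by
  ext k
  rw [coeff_ev_D, map_add, map_add, pd_add (staticRing.differentiableAt hV (hF _) hx)
    (staticRing.differentiableAt hV (hG _) hx), coeff_ev_D, coeff_ev_D]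

lemma ev_D_sum (hV : IsOpen V) {ι : Type*} {s : Finset ι} {F : ι → Formal 4}
    (hF : ∀ i ∈ s, IsStatic V (F i)) {x : Fin 4 → ℝ} (hx : x ∈ V) (i : Fin 4) :
    ev x (D i (∑ a ∈ s, F a)) = ∑ a ∈ s, ev x (D i (F a)) := by
  ext k
  rw [coeff_ev_D, map_sum, map_sum, pd_sum _ fun a ha => staticRing.differentiableAt hV (hF a ha k) hx]
  exact Finset.sum_congr rfl fun a _ => (coeff_ev_D _ _ _ _).symm

end

lemma rad_contDiff (n : ℕ) : ContDiff ℝ ∞ (rad n) := by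
  match n with
  | 0 => exact contDiff_id
  | 1 => exact contDiff_const
  | n + 2 => exact contDiff_const

lemma amp_contDiff (n m : Fin 4 → ℕ) : ContDiff ℝ ∞ (amp n m) := by
  have h1 := rad_contDiff (n 1)
  have h2 := rad_contDiff (m 1)
  unfold amp
  fun_prop

lemma static_sph (V : Set (Fin 4 → ℝ)) (n m : Fin 4 → ℕ) : IsStatic V (sph n m) := by
  have hr := amp_contDiff n m
  have hA : sphA n m ∈ staticRing V := by
    refine ⟨fun x y h1 h2 => by rw [sphA_apply, sphA_apply, h1, h2], ContDiff.contDiffOn ?_⟩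
    rw [funext (sphA_apply n m)]
    unfold sn cn
    fun_prop
  have hB : sphB n m ∈ staticRing V := by
    refine ⟨fun x y h1 h2 => by simp only [sphB, sep, h1, h2], ContDiff.contDiffOn ?_⟩
    unfold sphB sep cn
    fun_prop
  have hC : sphC n m ∈ staticRing V := by
    refine ⟨fun x y h1 h2 => by simp only [sphC, sep, h1, h2], ContDiff.contDiffOn ?_⟩
    unfold sphC sep sn
    fun_prop
  intro k
  rw [coeff_sph]
  have hs : ∀ (c : ℝ) {f : Fn 4}, f ∈ staticRing V → c • f ∈ staticRing V := fun c f hf =>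
    ⟨fun x y h1 h2 => by rw [Pi.smul_apply, Pi.smul_apply, hf.1 x y h1 h2], hf.2.const_smul c⟩
  exact add_mem (add_mem (hs _ hA) (hs _ hB)) (hs _ hC)

lemma isOpen_region {h h1 h2 : ℝ → ℝ} (hh : Lapse h h1 h2) : IsOpen (region h) := by
  have h0 : IsOpen {x : Fin 4 → ℝ | 0 < x 1} := isOpen_lt continuous_const (continuous_apply 1)
  have hc : ContinuousOn (fun x : Fin 4 → ℝ => h (x 1)) {x | 0 < x 1} :=
    hh.smooth.continuousOn.comp (continuous_apply 1).continuousOn fun x hx => hx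
  have h2 : IsOpen ({x : Fin 4 → ℝ | 0 < x 1} ∩ {x | 0 < h (x 1)}) :=
    hc.isOpen_inter_preimage h0 isOpen_Ioi
  have h3 : IsOpen {x : Fin 4 → ℝ | Real.sin (x 2) ≠ 0} :=
    isOpen_ne_fun (Real.continuous_sin.comp (continuous_apply 2)) continuous_const
  convert h2.inter h3 using 1
  ext x
  simp [region, and_assoc]

lemma radial_static {h : ℝ → ℝ} {f : ℝ → ℝ} {S : Set ℝ} (hf : ContDiffOn ℝ ∞ f S)
    (hS : ∀ x ∈ region h, x 1 ∈ S) : (fun x : Fin 4 → ℝ => f (x 1)) ∈ staticRing (region h) :=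
  ⟨fun x y h1 _ => by simp only [h1], hf.comp (contDiff_apply ℝ ℝ (1 : Fin 4)).contDiffOn hS⟩

/-! ### The connection with lower indices -/

/-- The first derivative of `lapsePart`. -/
noncomputable def lapsePart1 (h h1 : ℝ → ℝ) (i j : Fin 4) (r : ℝ) : ℝ :=
  if i = j then ![-h1 r, -h1 r / h r ^ 2, 0, 0] i else 0

/-- The second derivative of `lapsePart`. -/
noncomputable def lapsePart2 (h h1 h2 : ℝ → ℝ) (i j : Fin 4) (r : ℝ) : ℝ :=
  if i = j then ![-h2 r, -h2 r / h r ^ 2 + 2 * h1 r ^ 2 / h r ^ 3, 0, 0] i else 0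

/-- The Christoffel symbols of the first kind of a metric with radial derivatives `d`. -/
noncomputable def christoffel (d : Fin 4 → Fin 4 → ℝ) (i j l : Fin 4) : ℝ :=
  ((if i = 1 then d j l else 0) + (if j = 1 then d l i else 0) - (if l = 1 then d j i else 0)) / 2

lemma lapsePart_of_ne (h : ℝ → ℝ) {i j : Fin 4} (hij : i ≠ j) (r : ℝ) : lapsePart h i j r = 0 :=
  if_neg hij

lemma lapsePart1_of_ne (h h1 : ℝ → ℝ) {i j : Fin 4} (hij : i ≠ j) (r : ℝ) :
    lapsePart1 h h1 i j r = 0 :=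
  if_neg hij

lemma hasDerivAt_lapsePart {h h1 h2 : ℝ → ℝ} (hh : Lapse h h1 h2) {r : ℝ} (hr : 0 < r)
    (hp : 0 < h r) (i j : Fin 4) : HasDerivAt (lapsePart h i j) (lapsePart1 h h1 i j r) r := by
  have hd := hh.deriv_one r hr
  by_cases hij : i = j
  · subst hij
    fin_cases i
    exacts [hd.neg, (hd.inv hp.ne').sub_const 1, hasDerivAt_const r 0, hasDerivAt_const r 0]
  · simp only [funext (lapsePart_of_ne h hij), lapsePart1_of_ne h h1 hij, hasDerivAt_const]

lemma hasDerivAt_lapsePart1 {h h1 h2 : ℝ → ℝ} (hh : Lapse h h1 h2) {r : ℝ} (hr : 0 < r)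
    (hp : 0 < h r) (i j : Fin 4) :
    HasDerivAt (lapsePart1 h h1 i j) (lapsePart2 h h1 h2 i j r) r := by
  have hd := hh.deriv_one r hr
  have hd2 := hh.deriv_two r hr
  by_cases hij : i = j
  · subst hij
    have h11 : HasDerivAt (fun r => -h1 r / h r ^ 2)
        (-h2 r / h r ^ 2 + 2 * h1 r ^ 2 / h r ^ 3) r := by
      refine (hd2.fun_neg.fun_div (hd.fun_pow 2) (pow_ne_zero 2 hp.ne')).congr_deriv ?_
      have := hp.ne'
      field_simp
      ring
    fin_cases i
    exacts [hd2.neg, h11, hasDerivAt_const r 0, hasDerivAt_const r 0]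
  · rw [lapsePart2, if_neg hij, funext (lapsePart1_of_ne h h1 hij)]
    exact hasDerivAt_const r 0

lemma hasDerivAt_christoffel {h h1 h2 : ℝ → ℝ} (hh : Lapse h h1 h2) {r : ℝ} (hr : 0 < r)
    (hp : 0 < h r) (i j l : Fin 4) :
    HasDerivAt (fun r => christoffel (fun a b => lapsePart1 h h1 a b r) i j l)
      (christoffel (fun a b => lapsePart2 h h1 h2 a b r) i j l) r := by
  have hi : ∀ (p : Prop) [Decidable p] (a b : Fin 4),
      HasDerivAt (fun r => if p then lapsePart1 h h1 a b r else 0)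
        (if p then lapsePart2 h h1 h2 a b r else 0) r := fun p _ a b => by
    split_ifs
    · exact hasDerivAt_lapsePart1 hh hr hp a b
    · exact hasDerivAt_const _ _
  exact (((hi _ _ _).add (hi _ _ _)).sub (hi _ _ _)).div_const 2

/-- The metric. -/
noncomputable def staticMetric (h : ℝ → ℝ) (i j : Fin 4) : Formal 4 :=
  PowerSeries.C (fun x => lapsePart h i j (x 1)) + sph (e i) (e j)

/-- The connection coefficients with lower indices. -/
noncomputable def lowGamma (h h1 : ℝ → ℝ) (i j l : Fin 4) : Formal 4 :=
  PowerSeries.C (fun x => christoffel (fun a b => lapsePart1 h h1 a b (x 1)) i j l) +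
    sph (e i + e j) (e l)

lemma smooth_lapse_region {h h1 h2 : ℝ → ℝ} (hh : Lapse h h1 h2) :
    ContDiffOn ℝ ∞ h {r | 0 < r ∧ 0 < h r} ∧ ContDiffOn ℝ ∞ h1 {r | 0 < r ∧ 0 < h r} ∧
      ∀ r ∈ {r | 0 < r ∧ 0 < h r}, h r ≠ 0 :=
  ⟨hh.smooth.mono fun _ hr => hr.1, hh.smooth_one.mono fun _ hr => hr.1, fun _ hr => hr.2.ne'⟩

lemma static_metric {h h1 h2 : ℝ → ℝ} (hh : Lapse h h1 h2) (i j : Fin 4) :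
    IsStatic (region h) (staticMetric h i j) := by
  refine (IsStatic.C (radial_static (S := {r | 0 < r ∧ 0 < h r}) ?_
    fun x hx => ⟨hx.1, hx.2.1⟩)).add (static_sph _ _ _)
  obtain ⟨hs, -, h0⟩ := smooth_lapse_region hh
  by_cases hij : i = j
  · subst hij
    fin_cases i
    exacts [hs.neg, (hs.inv h0).sub contDiffOn_const, contDiffOn_const, contDiffOn_const]
  · rw [funext (lapsePart_of_ne h hij)]
    exact contDiffOn_const

lemma static_lowGamma {h h1 h2 : ℝ → ℝ} (hh : Lapse h h1 h2) (i j l : Fin 4) :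
    IsStatic (region h) (lowGamma h h1 i j l) := by
  refine (IsStatic.C (radial_static (S := {r | 0 < r ∧ 0 < h r})
    (f := fun r => christoffel (fun a b => lapsePart1 h h1 a b r) i j l) ?_
    fun x hx => ⟨hx.1, hx.2.1⟩)).add (static_sph _ _ _)
  obtain ⟨hs, hs1, h0⟩ := smooth_lapse_region hh
  have hl : ∀ a b : Fin 4, ContDiffOn ℝ ∞ (lapsePart1 h h1 a b) {r | 0 < r ∧ 0 < h r} := by
    intro a b
    by_cases hab : a = b
    · subst hab
      fin_cases a
      exacts [hs1.neg, hs1.neg.div (hs.pow 2) fun r hr => pow_ne_zero 2 (h0 r hr),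
        contDiffOn_const, contDiffOn_const]
    · rw [funext (lapsePart1_of_ne h h1 hab)]
      exact contDiffOn_const
  have hi : ∀ (p : Prop) [Decidable p] (a b : Fin 4), ContDiffOn ℝ ∞
      (fun r => if p then lapsePart1 h h1 a b r else 0) {r | 0 < r ∧ 0 < h r} := fun p _ a b => by
    split_ifs
    · exact hl a b
    · exact contDiffOn_const
  exact (((hi _ _ _).add (hi _ _ _)).sub (hi _ _ _)).div_const 2

lemma ev_D_staticMetric {h h1 h2 : ℝ → ℝ} (hh : Lapse h h1 h2) {x : Fin 4 → ℝ}
    (hx : x ∈ region h) (k i j : Fin 4) : ev x (D k (staticMetric h i j)) =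
      PowerSeries.C (if k = 1 then lapsePart1 h h1 i j (x 1) else 0) +
        (ev x (sph (e k + e i) (e j)) + ev x (sph (e i) (e k + e j))) := by
  have hC : IsStatic (region h) (PowerSeries.C (fun x => lapsePart h i j (x 1))) := by
    simpa [staticMetric] using (static_metric hh i j).sub (static_sph _ (e i) (e j))
  rw [staticMetric, ev_D_add (isOpen_region hh) hC (static_sph _ _ _) hx, D_C, ev_C,
    pd_radial (hasDerivAt_lapsePart hh hx.1 hx.2.1 i j), D_sph, map_add, add_comm (e i) (e k),
    add_comm (e j) (e k)]

lemma ev_D_lowGamma {h h1 h2 : ℝ → ℝ} (hh : Lapse h h1 h2) {x : Fin 4 → ℝ}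
    (hx : x ∈ region h) (k i j l : Fin 4) : ev x (D k (lowGamma h h1 i j l)) =
      PowerSeries.C (if k = 1 then
        christoffel (fun a b => lapsePart2 h h1 h2 a b (x 1)) i j l else 0) +
        (ev x (sph (e k + e i + e j) (e l)) + ev x (sph (e i + e j) (e k + e l))) := by
  have hC : IsStatic (region h) (PowerSeries.C
      (fun x => christoffel (fun a b => lapsePart1 h h1 a b (x 1)) i j l)) := by
    simpa [lowGamma] using (static_lowGamma hh i j l).sub (static_sph _ (e i + e j) (e l))
  rw [lowGamma, ev_D_add (isOpen_region hh) hC (static_sph _ _ _) hx, D_C, ev_C,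
    pd_radial (A := fun r => christoffel (fun a b => lapsePart1 h h1 a b r) i j l)
      (hasDerivAt_christoffel hh hx.1 hx.2.1 i j l), D_sph, map_add, add_comm (e l) (e k),
    show e i + e j + e k = e k + e i + e j by abel]

/-- For the sphere part this is `Γ_{ijl} = ∂ᵢEⱼ ∗ Eₗ`. In the half-sum of metric derivatives the
Leibniz terms cancel except `½ (∂ᵢEⱼ ∗ Eₗ + Eₗ ∗ ∂ᵢEⱼ)`, and the torsion is exactly the
antisymmetric half that is missing. The lapse part contributes its ordinary Christoffel symbol. -/
lemma lowGamma_same {h h1 h2 : ℝ → ℝ} (hh : Lapse h h1 h2) {U : Set (Fin 4 → ℝ)}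
    (hU : IsOpen U) (hUh : U ⊆ region h) {η : Fin 6 → ℝ} {F : Fin 6 → Fn 4}
    (hF : SphereLike h U η F) (i j l : Fin 4) :
    Same U (classicalGamma angular η (fun α => PowerSeries.C (F α)) i j l +
      torsion angular η (fun α => PowerSeries.C (F α)) i j l) (lowGamma h h1 i j l) := by
  rw [same_iff]
  intro x hx
  have hD : ∀ k a b, ev x (D k (metric angular η (fun α => PowerSeries.C (F α)) a b)) =
      ev x (D k (staticMetric h a b)) := fun k a b =>
    same_iff.1 (D_congr hU (metric_same hF a b) k) x hx
  rw [torsion_eq hF, classicalGamma, map_add, ev_smul, ev_smul, map_sub, map_add, map_sub, hD, hD,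
    hD, ev_D_staticMetric hh (hUh hx), ev_D_staticMetric hh (hUh hx),
    ev_D_staticMetric hh (hUh hx), lowGamma, map_add, ev_C, christoffel]
  have hc : ∀ a b c : ℝ, PowerSeries.C ((a + b - c) / 2) = (1 / 2 : ℝ) •
      (PowerSeries.C a + PowerSeries.C b - PowerSeries.C c) := fun a b c => by
    rw [← map_add, ← map_sub, PowerSeries.smul_eq_C_mul, ← map_mul]; ring_nf
  rw [hc, ← smul_add, add_comm (e j) (e i), add_comm (e l) (e i), add_comm (e l) (e j)]
  have h2 : ∀ a : PowerSeries ℝ, a = (1 / 2 : ℝ) • (a + a) := fun a => by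
    rw [← two_smul ℝ a, smul_smul]; norm_num
  conv_rhs => rw [h2 (ev x (sph (e i + e j) (e l))), ← smul_add]
  congr 1
  ring

/-! ### Values of the products of sphere functions -/

lemma sn_one (x : ℝ) : sn 1 x = Real.cos x := by rw [sn_succ, cn_zero]
lemma cn_one (x : ℝ) : cn 1 x = -Real.sin x := by rw [cn_succ, sn_zero]
lemma sn_two (x : ℝ) : sn 2 x = -Real.sin x := by rw [sn_succ, cn_one]
lemma cn_two (x : ℝ) : cn 2 x = -Real.cos x := by rw [cn_succ, sn_one]
lemma sn_three (x : ℝ) : sn 3 x = -Real.cos x := by rw [sn_succ, cn_two]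
lemma cn_three (x : ℝ) : cn 3 x = Real.sin x := by rw [cn_succ, sn_two, neg_neg]

/-- Reduces phases to values of `sn` and `cn` at `0`, which are evaluated for numeral indices. -/
lemma cos_phase (a b : ℕ) : Real.cos (phase a b) = cn a 0 * cn b 0 + sn a 0 * sn b 0 := by
  rw [phase, Real.cos_sub]; simp [cn, sn]

lemma sin_phase (a b : ℕ) : Real.sin (phase a b) = sn a 0 * cn b 0 - cn a 0 * sn b 0 := by
  rw [phase, Real.sin_sub]; simp [cn, sn]

/-- The diagonal entries of the classical metric. -/
noncomputable def classicalDiag (h : ℝ → ℝ) (x : Fin 4 → ℝ) : Fin 4 → ℝ :=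
  ![-h (x 1), (h (x 1))⁻¹, x 1 ^ 2, x 1 ^ 2 * Real.sin (x 2) ^ 2]

lemma coeff_zero_sph (n m : Fin 4 → ℕ) : PowerSeries.coeff 0 (sph n m) = sphA n m := by
  rw [coeff_sph, coeff_sinh_sq, coeff_sinh_cosh]; simp

/-- The classical limit is diagonal and nondegenerate on `region h`. This is the source of both
existence and uniqueness of the inverse. -/
lemma coeff_zero_staticMetric (h : ℝ → ℝ) (i j : Fin 4) (x : Fin 4 → ℝ) :
    PowerSeries.coeff 0 (staticMetric h i j) x =
      Matrix.diagonal (classicalDiag h x) i j := by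
  have hsc := Real.sin_sq_add_cos_sq (x 2)
  rw [staticMetric, map_add, coeff_zero_sph, Pi.add_apply, sphA_apply]
  fin_cases i <;> fin_cases j <;>
    simp [lapsePart, classicalDiag, amp, tm, rad, cos_phase, sn_zero, cn_zero, sn_one, cn_one]
  · linear_combination hsc
  · right; ring
  · right; ring
  · linear_combination x 1 ^ 2 * hsc
  · ring

/-! ### The inverse metric -/

/-- Cramer's rule over power series with static coefficients: the determinant is a unit as soon as
its constant coefficient is. Working over the static ring keeps the inverse independent of `t` and
`φ`. -/
lemma exists_static_inverse {h h1 h2 : ℝ → ℝ} (hh : Lapse h h1 h2) :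
    ∃ N : Fin 4 → Fin 4 → Formal 4, (∀ i j, IsStatic (region h) (N i j)) ∧
      ∀ x ∈ region h, (Matrix.of fun i j => ev x (staticMetric h i j)) *
        (Matrix.of fun i j => ev x (N i j)) = 1 := by
  set V := region h with hV
  set A := staticRing V
  let g : Matrix (Fin 4) (Fin 4) (PowerSeries A) := fun i j =>
    PowerSeries.mk fun k => ⟨_, static_metric hh i j k⟩
  let ι : PowerSeries A →+* Formal 4 := PowerSeries.map A.subtype
  have hg : ∀ i j, ι (g i j) = staticMetric h i j := fun i j => by
    ext1 k; simp [ι, g]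
  let d : A := PowerSeries.constantCoeff g.det
  have hd : ∀ x ∈ V, (d : Fn 4) x ≠ 0 := by
    intro x hx
    have h1 : (d : Fn 4) x = ((Pi.evalRingHom (fun _ : Fin 4 → ℝ => ℝ) x).comp
        (A.subtype.comp PowerSeries.constantCoeff)) g.det := rfl
    rw [h1, RingHom.map_det]
    have h2 : ((Pi.evalRingHom (fun _ : Fin 4 → ℝ => ℝ) x).comp
        (A.subtype.comp PowerSeries.constantCoeff)).mapMatrix g =
        Matrix.diagonal (classicalDiag h x) := by
      ext i j
      rw [← coeff_zero_staticMetric]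
      change ((PowerSeries.constantCoeff (g i j) : A) : Fn 4) x = _
      rw [← PowerSeries.coeff_zero_eq_constantCoeff_apply, PowerSeries.coeff_mk]
    rw [h2, Matrix.det_diagonal, Fin.prod_univ_four]
    obtain ⟨a, b, c⟩ := hx
    have := a.ne'
    have := b.ne'
    simp [classicalDiag, *]
  classical
  have hVs : ∀ x y : Fin 4 → ℝ, x 1 = y 1 → x 2 = y 2 → (x ∈ V ↔ y ∈ V) := fun x y h1 h2 => by
    simp [hV, region, h1, h2]
  -- The constant coefficient `d` is nonzero only on `V`, while units of `A` must be invertible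
  -- everywhere. The correction `c` vanishes on `V` and makes `d + c` equal to `1` outside; it is
  -- static because membership in `V` depends only on `r` and `θ`.
  let c : A := ⟨fun x => if x ∈ V then 0 else 1 - (d : Fn 4) x, fun x y h1 h2 => by
      simp only [hVs x y h1 h2, d.2.1 x y h1 h2],
    contDiffOn_const.congr fun x hx => if_pos hx⟩
  have hdc : ∀ x, ((d + c : A) : Fn 4) x = if x ∈ V then (d : Fn 4) x else 1 := fun x => by
    simp only [Subring.coe_add, Pi.add_apply, c]
    split_ifs <;> ring
  have hdc0 : ∀ x, ((d + c : A) : Fn 4) x ≠ 0 := fun x => by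
    rw [hdc]; split_ifs with hx
    · exact hd x hx
    · exact one_ne_zero
  let b : A := ⟨fun x => (((d + c : A) : Fn 4) x)⁻¹, fun x y h1 h2 => by
      simp only [(d + c).2.1 x y h1 h2], (d + c).2.2.inv fun x _ => hdc0 x⟩
  let u : Aˣ := ⟨d + c, b, Subtype.ext (funext fun x => mul_inv_cancel₀ (hdc0 x)),
    Subtype.ext (funext fun x => inv_mul_cancel₀ (hdc0 x))⟩
  let D' : PowerSeries A := g.det + PowerSeries.C c
  have hD' : D' * PowerSeries.invOfUnit D' u = 1 :=
    PowerSeries.mul_invOfUnit _ _ (by simp [D', u, d])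
  let N := PowerSeries.invOfUnit D' u • g.adjugate
  refine ⟨fun i j => ι (N i j), fun i j k => ?_, fun x hx => ?_⟩
  · simp only [ι, PowerSeries.coeff_map]
    exact (PowerSeries.coeff k (N i j)).2
  · let ψ : PowerSeries A →+* PowerSeries ℝ := (ev x).comp ι
    have h1 : (Matrix.of fun i j => ev x (staticMetric h i j)) = ψ.mapMatrix g := by
      ext1 i j; simp [ψ, hg]
    have h2 : (Matrix.of fun i j => ev x (ι (N i j))) = ψ.mapMatrix N := by
      ext1 i j; simp [ψ]
    -- At points of `V` the correction disappears, so the inverse of `D'` is the inverse of the true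
    -- determinant.
    have h3 : ψ (PowerSeries.C c) = 0 := by
      simp only [ψ, ι, RingHom.comp_apply, PowerSeries.map_C, ev_C]
      simp [c, hx]
    have h4 : ψ g.det * ψ (PowerSeries.invOfUnit D' u) = 1 := by
      rw [← map_one ψ, ← hD', map_mul, map_add, h3, add_zero]
    rw [h1, h2, ← map_mul]
    have h5 : g * N = (g.det * PowerSeries.invOfUnit D' u) • (1 : Matrix (Fin 4) (Fin 4) _) := by
      rw [Matrix.mul_smul, Matrix.mul_adjugate, smul_smul, mul_comm]
    rw [h5]
    ext1 i j
    simp only [RingHom.mapMatrix_apply, Matrix.map_apply, Matrix.smul_apply, smul_eq_mul, map_mul,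
      h4, one_mul]
    simp [Matrix.one_apply, apply_ite ψ]

/-- Induction on the order in `ħ`: at order `p` the difference of the coefficients of `a` and `b`
enters only undifferentiated, multiplied by the invertible classical metric. All other terms involve
lower orders, which agree. Thus an arbitrary inverse, not assumed static, is identified with the
static one. -/
lemma right_inverse_unique {n : ℕ} {U : Set (Fin n → ℝ)} (hU : IsOpen U)
    (θ : Matrix (Fin n) (Fin n) ℝ) {g a b : Fin n → Fin n → Formal n}
    (hg : ∀ x ∈ U, IsUnit (Matrix.of fun i j => PowerSeries.coeff 0 (g i j) x))
    (hab : ∀ i k, Same U (∑ j, moyal θ (g i j) (a j k)) (∑ j, moyal θ (g i j) (b j k))) :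
    ∀ j k, Same U (a j k) (b j k) := by
  suffices ∀ p j k, ∀ x ∈ U, PowerSeries.coeff p (a j k) x = PowerSeries.coeff p (b j k) x from
    fun j k p => this p j k
  intro p
  induction p using Nat.strong_induction_on with
  | _ p ih =>
    intro j k x hx
    have key : (Matrix.of fun i j => PowerSeries.coeff 0 (g i j) x).mulVec
        (fun j => PowerSeries.coeff p (a j k) x - PowerSeries.coeff p (b j k) x) = 0 := by
      funext i
      have h0 := hab i k p x hx
      simp only [map_sum, Finset.sum_apply, coeff_moyal] at h0
      rw [← sub_eq_zero, ← Finset.sum_sub_distrib] at h0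
      rw [Matrix.mulVec, dotProduct, Pi.zero_apply, ← h0]
      refine Finset.sum_congr rfl fun j _ => ?_
      simp only [← Finset.sum_sub_distrib, Matrix.of_apply]
      -- The first pair puts no power of `ħ` in the Moyal operator, the second none in `g`.
      rw [Finset.sum_eq_single (0, p), Finset.sum_eq_single (0, p)]
      · simp [mu, bidiff]; ring
      · rintro ⟨q, s⟩ hq hne
        rw [Finset.HasAntidiagonal.mem_antidiagonal] at hq
        simp only at hq
        have : s < p := by
          rcases Nat.eq_zero_or_pos q with rfl | h
          · exact absurd (by simpa using hq) (fun h => hne (by rw [h]))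
          · omega
        rw [mu_congr hU θ 0 (fun _ _ => rfl) (ih s this j k) x hx, sub_self]
      · simp
      · rintro ⟨q, s⟩ hq hne
        rw [Finset.HasAntidiagonal.mem_antidiagonal] at hq
        simp only at hq
        refine Finset.sum_eq_zero fun t ht => ?_
        rw [Finset.HasAntidiagonal.mem_antidiagonal] at ht
        simp only at ht
        have : t.2 < p := by
          rcases Nat.eq_zero_or_pos q with rfl | h
          · exact absurd (by simpa using hq) (fun h => hne (by rw [h]))
          · omega
        rw [mu_congr hU θ q (fun _ _ => rfl) (ih t.2 this j k) x hx, sub_self]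
      · simp
    have hinj := Matrix.mulVec_injective_of_isUnit (hg x hx)
    have := congrFun (hinj (key.trans (Matrix.mulVec_zero _).symm)) j
    exact sub_eq_zero.1 this

/-! ### Curvature of a metric with noncommutative connection, at a point -/

section Algebra

variable {K : Type*} [CommRing K]

/-- The curvature with lower indices in terms of the connection `Γ`, its opposite `Γ'`, the
derivatives `dΓ i j = ∂ᵢ Γ_j` and the inverse metric `N`. -/
def lowRiem (N : Matrix (Fin 4) (Fin 4) K) (Γ Γ' : Fin 4 → Matrix (Fin 4) (Fin 4) K)
    (dΓ : Fin 4 → Fin 4 → Matrix (Fin 4) (Fin 4) K) (i j : Fin 4) : Matrix (Fin 4) (Fin 4) K :=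
  dΓ i j - dΓ j i + Γ i * N * Γ' j - Γ j * N * Γ' i

/-- Substituting `∂N = -N (Γ + Γ') N` into `-Γᵢ ∂ⱼN` produces `Γᵢ N Γⱼ N + Γᵢ N Γ'ⱼ N`. The
quadratic term of the curvature cancels the first summand and leaves the second. -/
lemma lowRiem_mul {N : Matrix (Fin 4) (Fin 4) K} {Γ Γ' dN : Fin 4 → Matrix (Fin 4) (Fin 4) K}
    {dΓ : Fin 4 → Fin 4 → Matrix (Fin 4) (Fin 4) K}
    (hN : ∀ i, dN i = -(N * (Γ i + Γ' i) * N)) (i j : Fin 4) :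
    -(dΓ j i * N + Γ i * dN j) - Γ i * N * (Γ j * N) + (dΓ i j * N + Γ j * dN i) +
      Γ j * N * (Γ i * N) = lowRiem N Γ Γ' dΓ i j * N := by
  rw [lowRiem, hN, hN]
  noncomm_ring

/-- The contraction `R^i_j`. -/
def ricciAt (N : Matrix (Fin 4) (Fin 4) K) (R : Fin 4 → Fin 4 → Matrix (Fin 4) (Fin 4) K)
    (i j : Fin 4) : K := ∑ p, (N * R p j * N) i p

/-- The contraction `Θ^i_j`. -/
def thetaAt (N : Matrix (Fin 4) (Fin 4) K) (R : Fin 4 → Fin 4 → Matrix (Fin 4) (Fin 4) K)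
    (i j : Fin 4) : K := ∑ p, (N * R j p * N) p i

variable {N : Matrix (Fin 4) (Fin 4) K} {Γ Γ' : Fin 4 → Matrix (Fin 4) (Fin 4) K}
  {dΓ : Fin 4 → Fin 4 → Matrix (Fin 4) (Fin 4) K}

lemma lowRiem_swap (i j : Fin 4) : lowRiem N Γ Γ' dΓ j i = -lowRiem N Γ Γ' dΓ i j := by
  rw [lowRiem, lowRiem]; abel

/-- The substitute for skew-symmetry of the curvature in its first index pair. Conjugate
transposition exchanges the two quadratic terms, and `hd` expresses that the second derivatives
`∂ᵢ∂ⱼ g` commute. -/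
lemma lowRiem_map_bar {σ : K →+* K} (hσ : ∀ a, σ (σ a) = a) (hN : N.map σ = N.transpose)
    (hΓ : ∀ i, Γ' i = ((Γ i).map σ).transpose)
    (hd : ∀ i j, dΓ i j + ((dΓ i j).map σ).transpose = dΓ j i + ((dΓ j i).map σ).transpose)
    (i j : Fin 4) :
    (lowRiem N Γ Γ' dΓ i j).map σ = -(lowRiem N Γ Γ' dΓ i j).transpose := by
  have h1 : ∀ i, (Γ' i).map σ = (Γ i).transpose := fun i => by
    rw [hΓ]; ext a b; simp [hσ]
  have h2 : ∀ i, (Γ' i).transpose = (Γ i).map σ := fun i => by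
    rw [hΓ, Matrix.transpose_transpose]
  have h3 : (dΓ i j).map σ - (dΓ j i).map σ = -((dΓ i j).transpose - (dΓ j i).transpose) := by
    have := congrArg Matrix.transpose (hd i j)
    simp only [Matrix.transpose_add, Matrix.transpose_transpose] at this
    rw [← sub_eq_zero] at this ⊢
    rw [← this]
    abel
  rw [lowRiem, Matrix.map_sub σ (map_sub σ), Matrix.map_add σ (map_add σ),
    Matrix.map_sub σ (map_sub σ), h3, Matrix.map_mul, Matrix.map_mul, Matrix.map_mul,
    Matrix.map_mul, hN, h1, h1, Matrix.transpose_sub, Matrix.transpose_add, Matrix.transpose_sub,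
    Matrix.transpose_mul, Matrix.transpose_mul, Matrix.transpose_mul, Matrix.transpose_mul, h2, h2,
    Matrix.mul_assoc, Matrix.mul_assoc]
  abel

/-- Conjugation sends `N R_{pj} N` to `-(N R_{pj} N)ᵀ = (N R_{jp} N)ᵀ`, and this transposition is
what distinguishes the two contractions. -/
lemma thetaAt_eq {σ : K →+* K} (hN : N.map σ = N.transpose)
    {R : Fin 4 → Fin 4 → Matrix (Fin 4) (Fin 4) K}
    (hR : ∀ i j, (R i j).map σ = -(R i j).transpose) (hs : ∀ i j, R j i = -R i j) (i j : Fin 4) :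
    thetaAt N R i j = σ (ricciAt N R i j) := by
  rw [thetaAt, ricciAt, map_sum]
  refine Finset.sum_congr rfl fun p _ => ?_
  have : (N * R p j * N).map σ = (N * R j p * N).transpose := by
    rw [Matrix.map_mul, Matrix.map_mul, hN, hR, hs j p, Matrix.transpose_mul, Matrix.transpose_mul,
      Matrix.transpose_neg]
    simp [Matrix.mul_assoc]
  have h := congrFun (congrFun this i) p
  simpa using h.symm

/-- Covariance under a reflection of coordinates: each free index carries a sign, and each
contracted pair carries a square, which is `1`. -/
lemma ricciAt_sign {σ : K →+* K} {ε : Fin 4 → K} (hε : ∀ i, ε i * ε i = 1)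
    (hN : N.map σ = Matrix.diagonal ε * N * Matrix.diagonal ε)
    (hΓ : ∀ i, (Γ i).map σ = ε i • (Matrix.diagonal ε * Γ i * Matrix.diagonal ε))
    (hΓ' : ∀ i, (Γ' i).map σ = ε i • (Matrix.diagonal ε * Γ' i * Matrix.diagonal ε))
    (hd : ∀ i j, (dΓ i j).map σ =
      (ε i * ε j) • (Matrix.diagonal ε * dΓ i j * Matrix.diagonal ε)) (i j : Fin 4) :
    σ (ricciAt N (lowRiem N Γ Γ' dΓ) i j) =
      ε i * ε j * ricciAt N (lowRiem N Γ Γ' dΓ) i j := by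
  have hE : Matrix.diagonal ε * Matrix.diagonal ε = 1 := by
    rw [Matrix.diagonal_mul_diagonal, ← Matrix.diagonal_one]
    exact congrArg _ (funext hε)
  have hE' : ∀ A B : Matrix (Fin 4) (Fin 4) K,
      A * Matrix.diagonal ε * (Matrix.diagonal ε * B) = A * B := fun A B => by
    rw [Matrix.mul_assoc, ← Matrix.mul_assoc _ _ B, hE, Matrix.one_mul]
  have hR : ∀ i j, (lowRiem N Γ Γ' dΓ i j).map σ = (ε i * ε j) •
      (Matrix.diagonal ε * lowRiem N Γ Γ' dΓ i j * Matrix.diagonal ε) := by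
    intro i j
    have h3 : ∀ i j, (Γ i * N * Γ' j).map σ =
        (ε i * ε j) • (Matrix.diagonal ε * (Γ i * N * Γ' j) * Matrix.diagonal ε) := fun i j => by
      rw [Matrix.map_mul, Matrix.map_mul, hΓ, hΓ', hN, Matrix.smul_mul, Matrix.smul_mul,
        Matrix.mul_smul, smul_smul]
      congr 1
      calc _ = Matrix.diagonal ε * Γ i * (Matrix.diagonal ε * Matrix.diagonal ε) * N *
            (Matrix.diagonal ε * Matrix.diagonal ε) * Γ' j * Matrix.diagonal ε := by
            simp only [Matrix.mul_assoc]
        _ = _ := by rw [hE]; simp only [Matrix.mul_one, Matrix.mul_assoc]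
    rw [lowRiem, Matrix.map_sub σ (map_sub σ), Matrix.map_add σ (map_add σ),
      Matrix.map_sub σ (map_sub σ), h3, h3, hd, hd, mul_comm (ε j) (ε i), ← smul_sub, ← smul_add,
      ← smul_sub]
    congr 1
    noncomm_ring
  rw [ricciAt, map_sum, Finset.mul_sum]
  refine Finset.sum_congr rfl fun p _ => ?_
  have h4 : (N * lowRiem N Γ Γ' dΓ p j * N).map σ = (ε p * ε j) •
      (Matrix.diagonal ε * (N * lowRiem N Γ Γ' dΓ p j * N) * Matrix.diagonal ε) := by
    rw [Matrix.map_mul, Matrix.map_mul, hN, hR, Matrix.mul_smul, Matrix.smul_mul]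
    congr 1
    calc _ = Matrix.diagonal ε * N * (Matrix.diagonal ε * Matrix.diagonal ε) *
          lowRiem N Γ Γ' dΓ p j * (Matrix.diagonal ε * Matrix.diagonal ε) * N *
            Matrix.diagonal ε := by simp only [Matrix.mul_assoc]
      _ = _ := by rw [hE]; simp only [Matrix.mul_one, Matrix.mul_assoc]
  have h5 := congrFun (congrFun h4 i) p
  simp only [Matrix.map_apply, Matrix.smul_apply, Matrix.mul_diagonal, Matrix.diagonal_mul,
    smul_eq_mul] at h5
  rw [h5]
  linear_combination ε i * ε j * (N * lowRiem N Γ Γ' dΓ p j * N) i p * hε p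

/-- Both sides are inverse to `Gᵀ`. -/
lemma inverse_map_bar {σ : K →+* K} {G : Matrix (Fin 4) (Fin 4) K} (hGN : G * N = 1)
    (hG : G.map σ = G.transpose) : N.map σ = N.transpose := by
  have h1 : N.map σ * G.transpose = 1 := by
    rw [← hG, ← Matrix.map_mul, mul_eq_one_comm.1 hGN]; simp
  have h2 : G.transpose * N.transpose = 1 := by
    rw [← Matrix.transpose_mul, mul_eq_one_comm.1 hGN, Matrix.transpose_one]
  exact left_inv_eq_right_inv h1 h2

lemma inverse_map_sign {σ : K →+* K} {ε : Fin 4 → K} (hε : ∀ i, ε i * ε i = 1)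
    {G : Matrix (Fin 4) (Fin 4) K} (hGN : G * N = 1)
    (hG : G.map σ = Matrix.diagonal ε * G * Matrix.diagonal ε) :
    N.map σ = Matrix.diagonal ε * N * Matrix.diagonal ε := by
  have hE : Matrix.diagonal ε * Matrix.diagonal ε = 1 := by
    rw [Matrix.diagonal_mul_diagonal, ← Matrix.diagonal_one]
    exact congrArg _ (funext hε)
  have h1 : N.map σ * G.map σ = 1 := by
    rw [← Matrix.map_mul, mul_eq_one_comm.1 hGN]; simp
  have h2 : G.map σ * (Matrix.diagonal ε * N * Matrix.diagonal ε) = 1 := by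
    rw [hG]
    calc _ = Matrix.diagonal ε * (G * (Matrix.diagonal ε * Matrix.diagonal ε) * N) *
          Matrix.diagonal ε := by simp only [Matrix.mul_assoc]
      _ = _ := by rw [hE, Matrix.mul_one, hGN, Matrix.mul_one, hE]
  exact left_inv_eq_right_inv h1 h2

end Algebra

/-! ### Reduction of the curvatures to commutative expressions -/

/-- The connection computed with the ordinary product. -/
noncomputable def staticGamma (h h1 : ℝ → ℝ) (N : Fin 4 → Fin 4 → Formal 4) (i j k : Fin 4) :
    Formal 4 := ∑ l, lowGamma h h1 i j l * N l k

/-- The Riemann curvature computed with the ordinary product. -/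
noncomputable def staticRiemann (h h1 : ℝ → ℝ) (N : Fin 4 → Fin 4 → Formal 4)
    (l k i j : Fin 4) : Formal 4 :=
  - D j (staticGamma h h1 N i k l)
    - ∑ p, staticGamma h h1 N i k p * staticGamma h h1 N j p l
    + D i (staticGamma h h1 N j k l)
    + ∑ p, staticGamma h h1 N j k p * staticGamma h h1 N i p l

section
variable {h h1 h2 : ℝ → ℝ} {N : Fin 4 → Fin 4 → Formal 4}

lemma static_gamma (hh : Lapse h h1 h2) (hN : ∀ i j, IsStatic (region h) (N i j))
    (i j k : Fin 4) : IsStatic (region h) (staticGamma h h1 N i j k) :=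
  IsStatic.sum fun _ _ => (static_lowGamma hh _ _ _).mul (hN _ _)

lemma static_riemann (hh : Lapse h h1 h2) (hN : ∀ i j, IsStatic (region h) (N i j))
    (l k i j : Fin 4) : IsStatic (region h) (staticRiemann h h1 N l k i j) := by
  have hG := static_gamma hh hN
  have hV := isOpen_region hh
  exact ((((hG _ _ _).D hV _).neg.sub (IsStatic.sum fun _ _ => (hG _ _ _).mul (hG _ _ _))).add
    ((hG _ _ _).D hV _)).add (IsStatic.sum fun _ _ => (hG _ _ _).mul (hG _ _ _))

/-- The factors need to be static only up to equality over `U`: first replace them, then drop the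
Moyal corrections. -/
lemma Same.moyal_mul {U V : Set (Fin 4 → ℝ)} (hU : IsOpen U) {F F' G G' : Formal 4}
    (hF : Same U F F') (hG : Same U G G') (hF' : IsStatic V F') (hG' : IsStatic V G') :
    Same U (moyal angular F G) (F' * G') :=
  moyal_eq_mul hF'.phiInv hG'.phiInv ▸ moyal_congr hU angular hF hG

lemma Same.add {n : ℕ} {U : Set (Fin n → ℝ)} {F F' G G' : Formal n} (hF : Same U F F')
    (hG : Same U G G') : Same U (F + G) (F' + G') := by
  rw [same_iff] at *
  intro x hx
  rw [map_add, map_add, hF x hx, hG x hx]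

lemma Same.neg {n : ℕ} {U : Set (Fin n → ℝ)} {F F' : Formal n} (hF : Same U F F') :
    Same U (-F) (-F') := by
  rw [same_iff] at *
  intro x hx
  rw [map_neg, map_neg, hF x hx]

lemma Same.sub {n : ℕ} {U : Set (Fin n → ℝ)} {F F' G G' : Formal n} (hF : Same U F F')
    (hG : Same U G G') : Same U (F - G) (F' - G') := by
  rw [sub_eq_add_neg, sub_eq_add_neg]
  exact hF.add hG.neg

variable {U : Set (Fin 4 → ℝ)} {η : Fin 6 → ℝ} {F : Fin 6 → Fn 4}

lemma isInverse_static (hh : Lapse h h1 h2) (hU : IsOpen U) (hUh : U ⊆ region h)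
    (hF : SphereLike h U η F) (hN : ∀ i j, IsStatic (region h) (N i j))
    (hGN : ∀ x ∈ region h, (Matrix.of fun i j => ev x (staticMetric h i j)) *
      (Matrix.of fun i j => ev x (N i j)) = 1) :
    IsInverse angular U (metric angular η fun α => PowerSeries.C (F α)) N := by
  have hm := metric_same hF
  refine ⟨fun i j k => ((hN i j).smooth k).mono hUh, fun i k => ?_, fun i k => ?_⟩
  · refine (Same.sum fun j _ => Same.moyal_mul hU (hm i j) (fun _ _ _ => rfl) (static_metric hh i j)
      (hN j k)).trans (same_iff.2 fun x hx => ?_)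
    have := congrFun (congrFun (hGN x (hUh hx)) i) k
    rw [ev_delta, map_sum]
    simpa [Matrix.mul_apply, Matrix.one_apply, staticMetric] using this
  · refine (Same.sum fun j _ => Same.moyal_mul hU (fun _ _ _ => rfl) (hm j k) (hN i j)
      (static_metric hh j k)).trans (same_iff.2 fun x hx => ?_)
    -- The other side is automatic for square matrices over the commutative ring `ℝ⟦ħ⟧`.
    have hNG := mul_eq_one_comm.1 (hGN x (hUh hx))
    have := congrFun (congrFun hNG i) k
    rw [ev_delta, map_sum]
    simpa [Matrix.mul_apply, Matrix.one_apply, staticMetric] using this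

lemma inverse_same (hh : Lapse h h1 h2) (hU : IsOpen U) (hUh : U ⊆ region h)
    (hF : SphereLike h U η F) (hN : ∀ i j, IsStatic (region h) (N i j))
    (hGN : ∀ x ∈ region h, (Matrix.of fun i j => ev x (staticMetric h i j)) *
      (Matrix.of fun i j => ev x (N i j)) = 1) {gi : Fin 4 → Fin 4 → Formal 4}
    (hgi : IsInverse angular U (metric angular η fun α => PowerSeries.C (F α)) gi) :
    ∀ i j, Same U (gi i j) (N i j) := by
  have hN' := isInverse_static hh hU hUh hF hN hGN
  refine right_inverse_unique hU angular (fun x hx => ?_)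
    fun i k => (hgi.2.1 i k).trans (hN'.2.1 i k).symm
  have h0 : (Matrix.of fun i j => PowerSeries.coeff 0
      (metric angular η (fun α => PowerSeries.C (F α)) i j) x) =
      Matrix.diagonal (classicalDiag h x) := by
    ext i j
    rw [Matrix.of_apply, metric_same hF i j 0 x hx]
    exact coeff_zero_staticMetric h i j x
  obtain ⟨a, b, c⟩ := hUh hx
  have := a.ne'
  have := b.ne'
  rw [h0, Matrix.isUnit_diagonal, Pi.isUnit_iff]
  intro i
  fin_cases i <;> simp [classicalDiag, *]

variable {gi : Fin 4 → Fin 4 → Formal 4}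

lemma riemann_same (hh : Lapse h h1 h2) (hU : IsOpen U) (hUh : U ⊆ region h)
    (hF : SphereLike h U η F) (hN : ∀ i j, IsStatic (region h) (N i j))
    (hgi : ∀ i j, Same U (gi i j) (N i j)) (l k i j : Fin 4) :
    Same U (riemann angular η (fun α => PowerSeries.C (F α)) gi l k i j)
      (staticRiemann h h1 N l k i j) := by
  have hg : ∀ i j k, Same U (gamma angular η (fun α => PowerSeries.C (F α)) gi i j k)
      (staticGamma h h1 N i j k) := fun i j k =>
    Same.sum fun l _ => Same.moyal_mul hU (lowGamma_same hh hU hUh hF i j l) (hgi l k)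
      (static_lowGamma hh i j l) (hN l k)
  have hs := static_gamma hh hN
  exact (((D_congr hU (hg _ _ _) _).neg.sub (Same.sum fun p _ => Same.moyal_mul hU (hg _ _ _)
    (hg _ _ _) (hs _ _ _) (hs _ _ _))).add (D_congr hU (hg _ _ _) _)).add
    (Same.sum fun p _ => Same.moyal_mul hU (hg _ _ _) (hg _ _ _) (hs _ _ _) (hs _ _ _))

/-- The inverse metric at a point. -/
noncomputable def invAt (N : Fin 4 → Fin 4 → Formal 4) (x : Fin 4 → ℝ) :
    Matrix (Fin 4) (Fin 4) (PowerSeries ℝ) := Matrix.of fun i j => ev x (N i j)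

/-- The connection with lower indices at a point. -/
noncomputable def gammaAt (h h1 : ℝ → ℝ) (x : Fin 4 → ℝ) (i : Fin 4) :
    Matrix (Fin 4) (Fin 4) (PowerSeries ℝ) := Matrix.of fun j l => ev x (lowGamma h h1 i j l)

/-- The opposite connection with lower indices at a point. -/
noncomputable def gammaOpAt (h h1 : ℝ → ℝ) (x : Fin 4 → ℝ) (i : Fin 4) :
    Matrix (Fin 4) (Fin 4) (PowerSeries ℝ) :=
  ((gammaAt h h1 x i).map PowerSeries.evalNegHom).transpose

/-- The derivatives of the connection with lower indices at a point. -/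
noncomputable def dgammaAt (h h1 : ℝ → ℝ) (x : Fin 4 → ℝ) (k i : Fin 4) :
    Matrix (Fin 4) (Fin 4) (PowerSeries ℝ) :=
  Matrix.of fun j l => ev x (D k (lowGamma h h1 i j l))

/-- The curvature with lower indices at a point. -/
noncomputable def riemAt (h h1 : ℝ → ℝ) (N : Fin 4 → Fin 4 → Formal 4) (x : Fin 4 → ℝ)
    (i j : Fin 4) : Matrix (Fin 4) (Fin 4) (PowerSeries ℝ) :=
  lowRiem (invAt N x) (gammaAt h h1 x) (gammaOpAt h h1 x) (dgammaAt h h1 x) i j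

/-! ### Reversal of the parameter, compatibility with the metric, and the curvatures at a point -/

lemma evalNegHom_C (a : ℝ) :
    PowerSeries.evalNegHom (PowerSeries.C a) = PowerSeries.C a := by
  ext k
  rw [PowerSeries.evalNegHom, PowerSeries.coeff_rescale, PowerSeries.coeff_C]
  split_ifs with hk
  · simp [hk]
  · simp

lemma evalNegHom_evalNegHom (a : PowerSeries ℝ) :
    PowerSeries.evalNegHom (PowerSeries.evalNegHom a) = a := by
  ext k
  rw [PowerSeries.evalNegHom, PowerSeries.coeff_rescale, PowerSeries.coeff_rescale, ← mul_assoc,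
    ← mul_pow]
  simp

lemma coeff_evalNegHom (a : PowerSeries ℝ) (k : ℕ) :
    PowerSeries.coeff k (PowerSeries.evalNegHom a) = (-1) ^ k * PowerSeries.coeff k a := by
  rw [PowerSeries.evalNegHom, PowerSeries.coeff_rescale]

lemma amp_comm (n m : Fin 4 → ℕ) : amp n m = amp m n := by
  funext r; simp only [amp]; ring

/-- Reversing `ħ` exchanges the factors of a Moyal product. In the closed form the phase changes
sign, so only the sine term, which occupies the odd orders, changes sign. -/
lemma bar_sph (x : Fin 4 → ℝ) (n m : Fin 4 → ℕ) :
    PowerSeries.evalNegHom (ev x (sph n m)) = ev x (sph m n) := by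
  ext k
  have hp : phase (m 3) (n 3) = -phase (n 3) (m 3) := by simp only [phase]; ring
  have hA : sphA m n x = sphA n m x := by
    simp only [sphA, Pi.add_apply, Pi.mul_apply]; ring
  have hB : sphB m n x = sphB n m x := by
    simp only [sphB, sep, amp_comm m n, add_comm (m 2), hp, Real.cos_neg]
  have hC : sphC m n x = -sphC n m x := by
    simp only [sphC, sep, amp_comm m n, add_comm (m 2), hp, Real.sin_neg, mul_neg]
  rw [coeff_evalNegHom, coeff_ev, coeff_ev, coeff_sph, coeff_sph, coeff_sinh_sq, coeff_sinh_cosh]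
  simp only [Pi.add_apply, Pi.smul_apply, smul_eq_mul, hA, hB, hC]
  rcases Nat.even_or_odd k with hk | hk
  · simp [hk, hk.neg_one_pow]
  · have : k ≠ 0 := by rintro rfl; simp at hk
    simp [hk.neg_one_pow, Nat.not_even_iff_odd.2 hk, this]

lemma lapsePart1_symm (i j : Fin 4) (r : ℝ) : lapsePart1 h h1 i j r = lapsePart1 h h1 j i r := by
  by_cases hij : i = j
  · rw [hij]
  · rw [lapsePart1_of_ne _ _ hij, lapsePart1_of_ne _ _ (Ne.symm hij)]

lemma lapsePart2_of_ne (h h1 h2 : ℝ → ℝ) {i j : Fin 4} (hij : i ≠ j) (r : ℝ) :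
    lapsePart2 h h1 h2 i j r = 0 :=
  if_neg hij

lemma lapsePart2_symm (i j : Fin 4) (r : ℝ) :
    lapsePart2 h h1 h2 i j r = lapsePart2 h h1 h2 j i r := by
  by_cases hij : i = j
  · rw [hij]
  · rw [lapsePart2_of_ne _ _ _ hij, lapsePart2_of_ne _ _ _ (Ne.symm hij)]

lemma christoffel_add {d : Fin 4 → Fin 4 → ℝ} (hd : ∀ i j, d i j = d j i) (k i j : Fin 4) :
    christoffel d k i j + christoffel d k j i = if k = 1 then d i j else 0 := by
  simp only [christoffel, hd j i, hd j k]
  split_ifs <;> ring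

/-- Compatibility with the metric: `∂ₖ(Eᵢ ∗ Eⱼ) = ∂ₖEᵢ ∗ Eⱼ + Eᵢ ∗ ∂ₖEⱼ`, whose second summand is
the opposite connection by `bar_sph`. -/
lemma ev_D_metric_eq (hh : Lapse h h1 h2) {x : Fin 4 → ℝ} (hx : x ∈ region h) (k : Fin 4) :
    (Matrix.of fun i j => ev x (D k (staticMetric h i j))) =
      gammaAt h h1 x k + gammaOpAt h h1 x k := by
  ext1 i j
  rw [Matrix.of_apply, ev_D_staticMetric hh hx, Matrix.add_apply, gammaOpAt,
    Matrix.transpose_apply, Matrix.map_apply, gammaAt, Matrix.of_apply, Matrix.of_apply,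
    lowGamma, lowGamma, map_add, map_add, map_add, ev_C, ev_C, evalNegHom_C, bar_sph,
    ← christoffel_add (fun a b => lapsePart1_symm a b (x 1)) k i j, map_add]
  ring

/-- Both sides are second derivatives of the metric. Expanded by the Leibniz rule, they are visibly
symmetric in `k` and `i`. -/
lemma dgammaAt_symm (hh : Lapse h h1 h2) {x : Fin 4 → ℝ} (hx : x ∈ region h) (k i : Fin 4) :
    dgammaAt h h1 x k i + ((dgammaAt h h1 x k i).map PowerSeries.evalNegHom).transpose =
      dgammaAt h h1 x i k + ((dgammaAt h h1 x i k).map PowerSeries.evalNegHom).transpose := by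
  have key : ∀ k i : Fin 4, dgammaAt h h1 x k i +
      ((dgammaAt h h1 x k i).map PowerSeries.evalNegHom).transpose = Matrix.of fun j l =>
      PowerSeries.C (if k = 1 then if i = 1 then lapsePart2 h h1 h2 j l (x 1) else 0 else 0) +
      (ev x (sph (e k + e i + e j) (e l)) + ev x (sph (e i + e j) (e k + e l)) +
        ev x (sph (e k + e j) (e i + e l)) + ev x (sph (e j) (e k + e i + e l))) := by
    intro k i
    ext1 j l
    rw [Matrix.add_apply, Matrix.transpose_apply, Matrix.map_apply, dgammaAt, Matrix.of_apply,
      Matrix.of_apply, Matrix.of_apply, ev_D_lowGamma hh hx, ev_D_lowGamma hh hx, map_add, map_add,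
      evalNegHom_C, bar_sph, bar_sph, add_add_add_comm, ← map_add]
    have : ((if k = 1 then christoffel (fun a b => lapsePart2 h h1 h2 a b (x 1)) i j l else 0) +
        if k = 1 then christoffel (fun a b => lapsePart2 h h1 h2 a b (x 1)) i l j else 0) =
        if k = 1 then if i = 1 then lapsePart2 h h1 h2 j l (x 1) else 0 else 0 := by
      split_ifs with h1 h2
      · rw [christoffel_add (fun a b => lapsePart2_symm a b (x 1)), if_pos h2]
      · rw [christoffel_add (fun a b => lapsePart2_symm a b (x 1)), if_neg h2]
      · rw [add_zero]
    rw [this]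
    ring
  rw [key, key]
  ext1 j l
  rw [Matrix.of_apply, Matrix.of_apply, add_comm (e k) (e i)]
  congr 1
  · split_ifs <;> rfl
  · ring

lemma D_delta {n : ℕ} (k i j : Fin n) : D k (delta i j) = 0 := by
  have h0 : ∀ c : ℝ, pd k (fun _ : Fin n → ℝ => c) = 0 := fun c => Inv.pd_eq_zero fun _ _ => rfl
  unfold delta
  split_ifs
  · rw [← map_one PowerSeries.C, D_C]
    exact (congrArg PowerSeries.C (h0 1)).trans (map_zero _)
  · rw [← map_zero PowerSeries.C, D_C]
    exact (congrArg PowerSeries.C (h0 0))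

/-- Differentiate `g N = 1` on `region h`, multiply by `N` from the left and insert `∂g = Γ + Γ'`.
-/
lemma ev_D_inverse (hh : Lapse h h1 h2) (hN : ∀ i j, IsStatic (region h) (N i j))
    (hGN : ∀ x ∈ region h, (Matrix.of fun i j => ev x (staticMetric h i j)) * invAt N x = 1)
    {x : Fin 4 → ℝ} (hx : x ∈ region h) (k : Fin 4) :
    (Matrix.of fun i j => ev x (D k (N i j))) =
      -(invAt N x * (gammaAt h h1 x k + gammaOpAt h h1 x k) * invAt N x) := by
  have hV := isOpen_region hh
  have hz : (Matrix.of fun i j => ev x (D k (staticMetric h i j))) * invAt N x +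
      (Matrix.of fun i j => ev x (staticMetric h i j)) *
        (Matrix.of fun i j => ev x (D k (N i j))) = 0 := by
    ext1 i j
    have hs : Same (region h) (∑ a, staticMetric h i a * N a j) (delta i j) :=
      same_iff.2 fun y hy => by
        have := congrFun (congrFun (hGN y hy) i) j
        rw [ev_delta, map_sum]
        simpa [Matrix.mul_apply, Matrix.one_apply, invAt] using this
    have h0 := same_iff.1 (D_congr hV hs k) x hx
    rw [D_delta, map_zero, ev_D_sum hV (fun a _ => (static_metric hh i a).mul (hN a j)) hx] at h0
    rw [Matrix.zero_apply, ← h0, Matrix.add_apply, Matrix.mul_apply, Matrix.mul_apply,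
      ← Finset.sum_add_distrib]
    exact Finset.sum_congr rfl fun a _ => (ev_D_mul hV (static_metric hh i a) (hN a j) hx k).symm
  rw [← ev_D_metric_eq hh hx]
  have h3 := congrArg (fun M => invAt N x * M) (eq_neg_of_add_eq_zero_right hz)
  simp only [← Matrix.mul_assoc, mul_eq_one_comm.1 (hGN x hx), Matrix.one_mul] at h3
  rw [h3, Matrix.mul_neg, Matrix.mul_assoc]

lemma ev_staticRiemann (hh : Lapse h h1 h2) (hN : ∀ i j, IsStatic (region h) (N i j))
    (hGN : ∀ x ∈ region h, (Matrix.of fun i j => ev x (staticMetric h i j)) * invAt N x = 1)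
    {x : Fin 4 → ℝ} (hx : x ∈ region h) (l k i j : Fin 4) :
    ev x (staticRiemann h h1 N l k i j) = (riemAt h h1 N x i j * invAt N x) k l := by
  have hV := isOpen_region hh
  have hG : ∀ i, (Matrix.of fun j k => ev x (staticGamma h h1 N i j k)) =
      gammaAt h h1 x i * invAt N x := fun i => by
    ext1 j k
    simp [staticGamma, Matrix.mul_apply, gammaAt, invAt]
  have hdG : ∀ a i, (Matrix.of fun j k => ev x (D a (staticGamma h h1 N i j k))) =
      dgammaAt h h1 x a i * invAt N x +
        gammaAt h h1 x i * (Matrix.of fun i j => ev x (D a (N i j))) := fun a i => by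
    ext1 j k
    rw [Matrix.of_apply, staticGamma,
      ev_D_sum hV (fun l _ => (static_lowGamma hh i j l).mul (hN l k)) hx, Matrix.add_apply,
      Matrix.mul_apply, Matrix.mul_apply, ← Finset.sum_add_distrib]
    exact Finset.sum_congr rfl fun l _ => ev_D_mul hV (static_lowGamma hh i j l) (hN l k) hx a
  have h3 := lowRiem_mul (dΓ := dgammaAt h h1 x) (ev_D_inverse hh hN hGN hx) i j
  rw [riemAt, ← h3, ← hdG, ← hdG, ← hG, ← hG]
  simp [staticRiemann, Matrix.mul_apply]

lemma ricciUp_eq (hh : Lapse h h1 h2) (hU : IsOpen U) (hUh : U ⊆ region h)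
    (hF : SphereLike h U η F) (hN : ∀ i j, IsStatic (region h) (N i j))
    (hGN : ∀ x ∈ region h, (Matrix.of fun i j => ev x (staticMetric h i j)) * invAt N x = 1)
    (hgi : ∀ i j, Same U (gi i j) (N i j)) {x : Fin 4 → ℝ} (hx : x ∈ U) (i j : Fin 4) :
    ev x (ricciUp angular η (fun α => PowerSeries.C (F α)) gi i j) =
      ricciAt (invAt N x) (riemAt h h1 N x) i j := by
  have hr : ∀ i j, Same U (ricci angular η (fun α => PowerSeries.C (F α)) gi i j)
      (∑ p, staticRiemann h h1 N p i p j) := fun i j =>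
    Same.sum fun p _ => riemann_same hh hU hUh hF hN hgi p i p j
  have h0 : Same U (ricciUp angular η (fun α => PowerSeries.C (F α)) gi i j)
      (∑ k, N i k * ∑ p, staticRiemann h h1 N p k p j) :=
    Same.sum fun k _ => Same.moyal_mul hU (hgi i k) (hr k j) (hN i k)
      (IsStatic.sum fun p _ => static_riemann hh hN p k p j)
  rw [same_iff.1 h0 x hx]
  simp only [map_sum, map_mul, ev_staticRiemann hh hN hGN (hUh hx), ricciAt, Matrix.mul_assoc,
    Finset.mul_sum]
  rw [Finset.sum_comm]
  refine Finset.sum_congr rfl fun p _ => ?_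
  rw [Matrix.mul_apply]
  rfl

lemma theta_eq (hh : Lapse h h1 h2) (hU : IsOpen U) (hUh : U ⊆ region h)
    (hF : SphereLike h U η F) (hN : ∀ i j, IsStatic (region h) (N i j))
    (hGN : ∀ x ∈ region h, (Matrix.of fun i j => ev x (staticMetric h i j)) * invAt N x = 1)
    (hgi : ∀ i j, Same U (gi i j) (N i j)) {x : Fin 4 → ℝ} (hx : x ∈ U) (i j : Fin 4) :
    ev x (theta angular η (fun α => PowerSeries.C (F α)) gi i j) =
      thetaAt (invAt N x) (riemAt h h1 N x) i j := by
  have h0 : Same U (theta angular η (fun α => PowerSeries.C (F α)) gi i j)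
      (∑ p, ∑ k, N p k * staticRiemann h h1 N i k j p) :=
    Same.sum fun p _ => Same.sum fun k _ => Same.moyal_mul hU (hgi p k)
      (riemann_same hh hU hUh hF hN hgi i k j p) (hN p k) (static_riemann hh hN i k j p)
  rw [same_iff.1 h0 x hx]
  simp only [map_sum, map_mul, ev_staticRiemann hh hN hGN (hUh hx), thetaAt, Matrix.mul_assoc]
  refine Finset.sum_congr rfl fun p _ => ?_
  rw [Matrix.mul_apply]
  rfl

lemma scalar_eq (hh : Lapse h h1 h2) (hU : IsOpen U) (hUh : U ⊆ region h)
    (hF : SphereLike h U η F) (hN : ∀ i j, IsStatic (region h) (N i j))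
    (hGN : ∀ x ∈ region h, (Matrix.of fun i j => ev x (staticMetric h i j)) * invAt N x = 1)
    (hgi : ∀ i j, Same U (gi i j) (N i j)) {x : Fin 4 → ℝ} (hx : x ∈ U) :
    ev x (scalar angular η (fun α => PowerSeries.C (F α)) gi) =
      ∑ j, ricciAt (invAt N x) (riemAt h h1 N x) j j := by
  rw [scalar, Finset.sum_comm, map_sum]
  refine Finset.sum_congr rfl fun j _ => ?_
  rw [← ricciUp_eq hh hU hUh hF hN hGN hgi hx]
  rfl

end

/-! ### Symmetries of the curvature -/

lemma sn_cn_zero (a : ℕ) : (Even a → sn a 0 = 0) ∧ (Odd a → cn a 0 = 0) := by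
  induction a with
  | zero => simp [sn_zero]
  | succ a ih =>
    rw [sn_succ, cn_succ, Nat.even_add_one, Nat.odd_add_one, Nat.not_even_iff_odd,
      Nat.not_odd_iff_even, neg_eq_zero]
    exact ⟨ih.2, ih.1⟩

lemma cos_phase_of_odd {a b : ℕ} (h : Odd (a + b)) : Real.cos (phase a b) = 0 := by
  rw [cos_phase]
  rcases Nat.even_or_odd a with ha | ha
  · have hb : Odd b := (Nat.odd_add'.1 h).2 ha
    rw [(sn_cn_zero a).1 ha, (sn_cn_zero b).2 hb]; ring
  · have hb : Even b := (Nat.odd_add.1 h).1 ha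
    rw [(sn_cn_zero b).1 hb, (sn_cn_zero a).2 ha]; ring

lemma sin_phase_of_even {a b : ℕ} (h : Even (a + b)) : Real.sin (phase a b) = 0 := by
  rw [sin_phase]
  rcases Nat.even_or_odd a with ha | ha
  · rw [(sn_cn_zero a).1 ha, (sn_cn_zero b).1 ((Nat.even_add.1 h).1 ha)]; ring
  · have hb : Odd b := by
      rw [← Nat.not_even_iff_odd] at ha ⊢
      exact fun hb => ha ((Nat.even_add.1 h).2 hb)
    rw [(sn_cn_zero b).2 hb, (sn_cn_zero a).2 ha]; ring

/-- A Moyal product changes sign of `ħ` under `φ ↦ -φ`, and each `φ`-derivative contributes one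
sign. Concretely, the even orders contain the cosine of the phase or the factor `tm`, which vanish
when the number of `φ`-derivatives is odd; the odd orders contain the sine, which vanishes when it
is even. -/
lemma bar_sph_sign (x : Fin 4 → ℝ) (n m : Fin 4 → ℕ) :
    PowerSeries.evalNegHom (ev x (sph n m)) = (-1) ^ (n 3 + m 3) * ev x (sph n m) := by
  have hpow : ((-1 : PowerSeries ℝ) ^ (n 3 + m 3)) = PowerSeries.C ((-1) ^ (n 3 + m 3)) := by
    simp
  ext k
  rw [hpow, PowerSeries.coeff_C_mul, coeff_evalNegHom, coeff_ev, coeff_sph, coeff_sinh_sq,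
    coeff_sinh_cosh]
  simp only [Pi.add_apply, Pi.smul_apply, smul_eq_mul, sphA_apply, sphB, sphC, sep]
  rcases Nat.even_or_odd (n 3 + m 3) with h | h
  · rw [sin_phase_of_even h, h.neg_one_pow]
    rcases Nat.even_or_odd k with hk | hk
    · simp [hk.neg_one_pow]
    · have : k ≠ 0 := by rintro rfl; simp at hk
      simp [Nat.not_even_iff_odd.2 hk, this]
  · have ht : tm (n 3) * tm (m 3) = 0 := by
      rcases hn : n 3 with _ | a
      · rcases hm : m 3 with _ | b
        · simp [hn, hm] at h
        · simp [tm]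
      · simp [tm]
    rw [cos_phase_of_odd h, h.neg_one_pow, ht]
    rcases Nat.even_or_odd k with hk | hk
    · simp [hk]
    · simp [hk.neg_one_pow]

/-- The sphere does not depend on `t`, so any `t`-derivative makes the product zero. -/
lemma time_sph_sign (x : Fin 4 → ℝ) (n m : Fin 4 → ℕ) :
    ev x (sph n m) = (-1) ^ (n 0 + m 0) * ev x (sph n m) := by
  by_cases h : n 0 + m 0 = 0
  · rw [h, pow_zero, one_mul]
  · have ha : amp n m (x 1) = 0 := by
      rcases hn : n 0 with _ | a
      · rcases hm : m 0 with _ | b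
        · simp [hn, hm] at h
        · simp [amp, hm, tm]
      · simp [amp, hn, tm]
    have : ev x (sph n m) = 0 := by
      ext k
      have hA : sphA n m x = 0 := by rw [sphA_apply, ha, zero_mul]
      rw [coeff_ev, coeff_sph, Pi.add_apply, Pi.add_apply, Pi.smul_apply, hA]
      simp [sphB, sphC, sep, ha]
    rw [this, mul_zero]

/-- The sign that reverses the coordinate `a`. -/
noncomputable def reflect (a i : Fin 4) : PowerSeries ℝ := if i = a then -1 else 1

lemma reflect_sq (a i : Fin 4) : reflect a i * reflect a i = 1 := by
  unfold reflect; split_ifs <;> ring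

lemma neg_one_pow_e (a i : Fin 4) : (-1 : PowerSeries ℝ) ^ (e i a) = reflect a i := by
  unfold reflect e
  by_cases h : i = a
  · subst h; simp
  · simp [h]

/-- For a diagonal metric depending on `r` alone, a nonzero symbol has one index `1` and two equal
indices, so its signs multiply to `1`; `a ≠ 1` keeps the radial index free of a sign. -/
lemma reflect_christoffel {d : Fin 4 → Fin 4 → ℝ} (hd : ∀ i j, i ≠ j → d i j = 0) {a : Fin 4}
    (ha : a ≠ 1) (i j l : Fin 4) :
    PowerSeries.C (christoffel d i j l) =
      reflect a i * reflect a j * reflect a l * PowerSeries.C (christoffel d i j l) := by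
  have h1 : reflect a 1 = 1 := if_neg ha.symm
  have key : ∀ i j l : Fin 4, PowerSeries.C (if i = 1 then d j l else 0) =
      reflect a i * reflect a j * reflect a l * PowerSeries.C (if i = 1 then d j l else 0) := by
    intro i j l
    by_cases hi : i = 1
    · by_cases hj : j = l
      · rw [hi, hj, h1, one_mul, reflect_sq, one_mul]
      · rw [if_pos hi, hd _ _ hj, map_zero, mul_zero]
    · rw [if_neg hi, map_zero, mul_zero]
  have h2 : PowerSeries.C (christoffel d i j l) = PowerSeries.C (1 / 2 : ℝ) *
      (PowerSeries.C (if i = 1 then d j l else 0) + PowerSeries.C (if j = 1 then d l i else 0) -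
        PowerSeries.C (if l = 1 then d j i else 0)) := by
    rw [← map_add, ← map_sub, ← map_mul, christoffel]; ring_nf
  rw [h2]
  linear_combination PowerSeries.C (1 / 2 : ℝ) * (key i j l + key j l i - key l j i)

section
variable {h h1 h2 : ℝ → ℝ} {N : Fin 4 → Fin 4 → Formal 4}

/-- Covers both reflections: `σ` is reversal of `ħ` for the angle `φ` and the identity for `t`. The
metric, the connection and its derivatives all transform by the signs of their indices, so
`ricciAt_sign` applies. -/
lemma ricciAt_reflect (hh : Lapse h h1 h2) {x : Fin 4 → ℝ} (hx : x ∈ region h)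
    (hGN : (Matrix.of fun i j => ev x (staticMetric h i j)) * invAt N x = 1)
    {σ : PowerSeries ℝ →+* PowerSeries ℝ} {a : Fin 4} (ha : a ≠ 1)
    (hC : ∀ c : ℝ, σ (PowerSeries.C c) = PowerSeries.C c)
    (hs : ∀ n m, σ (ev x (sph n m)) = (-1) ^ (n a + m a) * ev x (sph n m)) (i j : Fin 4) :
    σ (ricciAt (invAt N x) (riemAt h h1 N x) i j) =
      reflect a i * reflect a j * ricciAt (invAt N x) (riemAt h h1 N x) i j := by
  have hε := reflect_sq a
  have hadd : ∀ n m : Fin 4 → ℕ, (n + m) a = n a + m a := fun _ _ => rfl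
  have hchr : ∀ i j l, PowerSeries.C (christoffel (fun a b => lapsePart1 h h1 a b (x 1)) i j l) =
      reflect a i * reflect a j * reflect a l *
        PowerSeries.C (christoffel (fun a b => lapsePart1 h h1 a b (x 1)) i j l) :=
    reflect_christoffel (fun i j hij => lapsePart1_of_ne h h1 hij _) ha
  have hN : (invAt N x).map σ =
      Matrix.diagonal (reflect a) * invAt N x * Matrix.diagonal (reflect a) := by
    refine inverse_map_sign hε hGN ?_
    ext1 i j
    rw [Matrix.map_apply, Matrix.mul_diagonal, Matrix.diagonal_mul, Matrix.of_apply, staticMetric,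
      map_add, map_add, ev_C, hC, hs, pow_add, neg_one_pow_e, neg_one_pow_e]
    by_cases hij : i = j
    · rw [hij]; linear_combination -PowerSeries.C (lapsePart h j j (x 1)) * hε j
    · rw [lapsePart_of_ne h hij, map_zero]; ring
  refine ricciAt_sign hε hN (fun i => ?_) (fun i => ?_) (fun k i => ?_) i j
  · ext1 j l
    rw [Matrix.smul_apply, Matrix.map_apply, Matrix.mul_diagonal, Matrix.diagonal_mul, gammaAt,
      Matrix.of_apply, lowGamma, map_add, map_add, ev_C, hC, hs, pow_add, hadd, pow_add,
      neg_one_pow_e, neg_one_pow_e, neg_one_pow_e, smul_eq_mul]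
    linear_combination hchr i j l
  · ext1 j l
    rw [Matrix.smul_apply, Matrix.map_apply, Matrix.mul_diagonal, Matrix.diagonal_mul, gammaOpAt,
      Matrix.transpose_apply, Matrix.map_apply, gammaAt, Matrix.of_apply, lowGamma, map_add,
      map_add, ev_C, evalNegHom_C, bar_sph, map_add, hC, hs, pow_add, hadd, pow_add,
      neg_one_pow_e, neg_one_pow_e, neg_one_pow_e, smul_eq_mul]
    linear_combination hchr i l j
  · ext1 j l
    have hchr2 : reflect a k * PowerSeries.C (if k = 1 then
          christoffel (fun a b => lapsePart2 h h1 h2 a b (x 1)) i j l else 0) *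
        (reflect a i * reflect a j * reflect a l) =
        PowerSeries.C (if k = 1 then
          christoffel (fun a b => lapsePart2 h h1 h2 a b (x 1)) i j l else 0) := by
      split_ifs with hk
      · have hk1 : reflect a k = 1 := by rw [hk]; exact if_neg ha.symm
        rw [hk1, one_mul, mul_comm, ← reflect_christoffel
          (fun i j hij => lapsePart2_of_ne h h1 h2 hij _) ha]
      · rw [map_zero, mul_zero, zero_mul]
    rw [Matrix.smul_apply, Matrix.map_apply, Matrix.mul_diagonal, Matrix.diagonal_mul, dgammaAt,
      Matrix.of_apply, ev_D_lowGamma hh hx, map_add, map_add, hC, hs, hs]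
    simp only [pow_add, hadd, neg_one_pow_e, smul_eq_mul]
    linear_combination -hchr2

lemma ricciAt_phi (hh : Lapse h h1 h2) {x : Fin 4 → ℝ} (hx : x ∈ region h)
    (hGN : (Matrix.of fun i j => ev x (staticMetric h i j)) * invAt N x = 1) (i j : Fin 4) :
    PowerSeries.evalNegHom (ricciAt (invAt N x) (riemAt h h1 N x) i j) =
      reflect 3 i * reflect 3 j * ricciAt (invAt N x) (riemAt h h1 N x) i j :=
  ricciAt_reflect hh hx hGN (by decide) evalNegHom_C (bar_sph_sign x) i j

lemma ricciAt_time (hh : Lapse h h1 h2) {x : Fin 4 → ℝ} (hx : x ∈ region h)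
    (hGN : (Matrix.of fun i j => ev x (staticMetric h i j)) * invAt N x = 1) (i j : Fin 4) :
    ricciAt (invAt N x) (riemAt h h1 N x) i j =
      reflect 0 i * reflect 0 j * ricciAt (invAt N x) (riemAt h h1 N x) i j :=
  ricciAt_reflect (σ := RingHom.id _) hh hx hGN (by decide) (fun _ => rfl) (time_sph_sign x) i j

lemma thetaAt_bar (hh : Lapse h h1 h2) {x : Fin 4 → ℝ} (hx : x ∈ region h)
    (hGN : (Matrix.of fun i j => ev x (staticMetric h i j)) * invAt N x = 1) (i j : Fin 4) :
    thetaAt (invAt N x) (riemAt h h1 N x) i j =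
      PowerSeries.evalNegHom (ricciAt (invAt N x) (riemAt h h1 N x) i j) := by
  have hN : (invAt N x).map PowerSeries.evalNegHom = (invAt N x).transpose := by
    refine inverse_map_bar hGN ?_
    ext1 i j
    rw [Matrix.map_apply, Matrix.transpose_apply, Matrix.of_apply, Matrix.of_apply, staticMetric,
      staticMetric, map_add, map_add, map_add, ev_C, ev_C, evalNegHom_C, bar_sph]
    by_cases hij : i = j
    · rw [hij]
    · rw [lapsePart_of_ne h hij, lapsePart_of_ne h (Ne.symm hij)]
  exact thetaAt_eq hN (lowRiem_map_bar evalNegHom_evalNegHom hN (fun _ => rfl)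
    (dgammaAt_symm hh hx)) (fun i j => lowRiem_swap i j) i j

end

/-! ### Truncated power series -/

/-- Power series modulo the third power of the parameter. -/
@[ext] structure Jet where
  /-- the constant coefficient -/
  c0 : ℝ
  /-- the linear coefficient -/
  c1 : ℝ
  /-- the quadratic coefficient -/
  c2 : ℝ

namespace Jet

instance : Zero Jet := ⟨⟨0, 0, 0⟩⟩
instance : One Jet := ⟨⟨1, 0, 0⟩⟩
instance : Add Jet := ⟨fun a b => ⟨a.c0 + b.c0, a.c1 + b.c1, a.c2 + b.c2⟩⟩
instance : Neg Jet := ⟨fun a => ⟨-a.c0, -a.c1, -a.c2⟩⟩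
instance : Sub Jet := ⟨fun a b => ⟨a.c0 - b.c0, a.c1 - b.c1, a.c2 - b.c2⟩⟩
instance : Mul Jet := ⟨fun a b => ⟨a.c0 * b.c0, a.c0 * b.c1 + a.c1 * b.c0,
  a.c0 * b.c2 + a.c1 * b.c1 + a.c2 * b.c0⟩⟩

lemma zero_def : (0 : Jet) = ⟨0, 0, 0⟩ := rfl
lemma one_def : (1 : Jet) = ⟨1, 0, 0⟩ := rfl
lemma add_def (a b : Jet) : a + b = ⟨a.c0 + b.c0, a.c1 + b.c1, a.c2 + b.c2⟩ := rfl
lemma neg_def (a : Jet) : -a = ⟨-a.c0, -a.c1, -a.c2⟩ := rfl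
lemma sub_def (a b : Jet) : a - b = ⟨a.c0 - b.c0, a.c1 - b.c1, a.c2 - b.c2⟩ := rfl
lemma mul_def (a b : Jet) : a * b = ⟨a.c0 * b.c0, a.c0 * b.c1 + a.c1 * b.c0,
  a.c0 * b.c2 + a.c1 * b.c1 + a.c2 * b.c0⟩ := rfl

/-- Explicit triples of reals turn each identity modulo `ħ³` into three identities between rational
functions. -/
instance : CommRing Jet where
  add_assoc a b c := by ext <;> simp only [add_def] <;> ring
  zero_add a := by ext <;> simp [add_def, zero_def]
  add_zero a := by ext <;> simp [add_def, zero_def]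
  add_comm a b := by ext <;> simp only [add_def] <;> ring
  neg_add_cancel a := by ext <;> simp [add_def, neg_def, zero_def]
  sub_eq_add_neg a b := by ext <;> simp only [add_def, neg_def, sub_def] <;> ring
  mul_assoc a b c := by ext <;> simp only [mul_def] <;> ring
  one_mul a := by ext <;> simp [mul_def, one_def]
  mul_one a := by ext <;> simp [mul_def, one_def]
  zero_mul a := by ext <;> simp [mul_def, zero_def]
  mul_zero a := by ext <;> simp [mul_def, zero_def]
  left_distrib a b c := by ext <;> simp only [mul_def, add_def] <;> ring
  right_distrib a b c := by ext <;> simp only [mul_def, add_def] <;> ring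
  mul_comm a b := by ext <;> simp only [mul_def] <;> ring
  nsmul := nsmulRec
  zsmul := zsmulRec

@[simp] lemma zero_c0 : (0 : Jet).c0 = 0 := rfl
@[simp] lemma zero_c1 : (0 : Jet).c1 = 0 := rfl
@[simp] lemma zero_c2 : (0 : Jet).c2 = 0 := rfl
@[simp] lemma one_c0 : (1 : Jet).c0 = 1 := rfl
@[simp] lemma one_c1 : (1 : Jet).c1 = 0 := rfl
@[simp] lemma one_c2 : (1 : Jet).c2 = 0 := rfl
@[simp] lemma add_c0 (a b : Jet) : (a + b).c0 = a.c0 + b.c0 := rfl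
@[simp] lemma add_c1 (a b : Jet) : (a + b).c1 = a.c1 + b.c1 := rfl
@[simp] lemma add_c2 (a b : Jet) : (a + b).c2 = a.c2 + b.c2 := rfl
@[simp] lemma sub_c0 (a b : Jet) : (a - b).c0 = a.c0 - b.c0 := rfl
@[simp] lemma sub_c1 (a b : Jet) : (a - b).c1 = a.c1 - b.c1 := rfl
@[simp] lemma sub_c2 (a b : Jet) : (a - b).c2 = a.c2 - b.c2 := rfl
@[simp] lemma neg_c0 (a : Jet) : (-a).c0 = -a.c0 := rfl
@[simp] lemma neg_c1 (a : Jet) : (-a).c1 = -a.c1 := rfl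
@[simp] lemma neg_c2 (a : Jet) : (-a).c2 = -a.c2 := rfl
@[simp] lemma mul_c0 (a b : Jet) : (a * b).c0 = a.c0 * b.c0 := rfl
@[simp] lemma mul_c1 (a b : Jet) : (a * b).c1 = a.c0 * b.c1 + a.c1 * b.c0 := rfl
@[simp] lemma mul_c2 (a b : Jet) : (a * b).c2 = a.c0 * b.c2 + a.c1 * b.c1 + a.c2 * b.c0 := rfl

/-- The reversal of the sign of the parameter. -/
def bar (a : Jet) : Jet := ⟨a.c0, -a.c1, a.c2⟩

lemma bar_zero : bar 0 = 0 := by simp [bar, zero_def]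
lemma bar_mk (a b c : ℝ) : bar ⟨a, b, c⟩ = ⟨a, -b, c⟩ := rfl

end Jet

/-- Truncation of a power series. -/
noncomputable def jet : PowerSeries ℝ →+* Jet where
  toFun a := ⟨PowerSeries.coeff 0 a, PowerSeries.coeff 1 a, PowerSeries.coeff 2 a⟩
  map_one' := by simp [Jet.one_def, PowerSeries.coeff_one]
  map_zero' := by simp [Jet.zero_def]
  map_add' a b := by simp [Jet.add_def]
  map_mul' a b := by
    ext <;> simp [PowerSeries.coeff_mul, Jet.mul_def, Finset.Nat.antidiagonal_succ] <;> ring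

/-! ### The tensors modulo the third power of the parameter

Here `k = cot θ` and `v = sin² θ`; `p` and `q` are the derivatives of the lapse. -/

/-- The metric. -/
noncomputable def jetMetric (r h k v : ℝ) : Matrix (Fin 4) (Fin 4) Jet :=
  !![⟨-h, 0, 0⟩, 0, 0, 0;
      0, ⟨1 / h, 0, -1 + 2 * v⟩, ⟨0, 0, 2 * k * r * v⟩, ⟨0, -2 * k * r * v, 0⟩;
      0, ⟨0, 0, 2 * k * r * v⟩, ⟨r ^ 2, 0, r ^ 2 - 2 * r ^ 2 * v⟩, ⟨0, -r ^ 2 + 2 * r ^ 2 * v, 0⟩;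
      0, ⟨0, 2 * k * r * v, 0⟩, ⟨0, r ^ 2 - 2 * r ^ 2 * v, 0⟩, ⟨r ^ 2 * v, 0, -r ^ 2 + 2 * r ^ 2
          * v⟩]

/-- The inverse metric. -/
noncomputable def jetInv (r h k v : ℝ) : Matrix (Fin 4) (Fin 4) Jet :=
  !![⟨-1 / h, 0, 0⟩, 0, 0, 0;
      0, ⟨h, 0, -3 * h ^ 2 + 2 * h ^ 2 * v⟩, ⟨0, 0, -2 * k * h / r + 2 * k * h * v / r⟩, ⟨0, 2 *
          k * h / r, 0⟩;
      0, ⟨0, 0, -2 * k * h / r + 2 * k * h * v / r⟩, ⟨1 / r ^ 2, 0, -1 / (r ^ 2 * v) + 3 / r ^ 2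
          - 2 * v / r ^ 2⟩, ⟨0, 1 / (r ^ 2 * v) - 2 / r ^ 2, 0⟩;
      0, ⟨0, -2 * k * h / r, 0⟩, ⟨0, -1 / (r ^ 2 * v) + 2 / r ^ 2, 0⟩, ⟨1 / (r ^ 2 * v), 0, 2 /
          (r ^ 2 * v) - 4 / r ^ 2 - 4 * h / (r ^ 2 * v) + 4 * h / r ^ 2⟩]

/-- The connection with lower indices. -/
noncomputable def jetGamma (r h p k v : ℝ) : Fin 4 → Matrix (Fin 4) (Fin 4) Jet :=
  ![
    !![0, ⟨p / 2, 0, 0⟩, 0, 0;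
      ⟨-p / 2, 0, 0⟩, 0, 0, 0;
      0, 0, 0, 0;
      0, 0, 0, 0],
    !![⟨-p / 2, 0, 0⟩, 0, 0, 0;
      0, ⟨-p / (2 * h ^ 2), 0, 0⟩, 0, 0;
      0, ⟨0, 0, 2 * k * v⟩, ⟨r, 0, r - 2 * r * v⟩, ⟨0, -r + 2 * r * v, 0⟩;
      0, ⟨0, 2 * k * v, 0⟩, ⟨0, r - 2 * r * v, 0⟩, ⟨r * v, 0, -r + 2 * r * v⟩],
    !![0, 0, 0, 0;
      0, ⟨0, 0, 2 * k * v⟩, ⟨r, 0, r - 2 * r * v⟩, ⟨0, -r + 2 * r * v, 0⟩;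
      0, ⟨-r, 0, r - 2 * r * v⟩, ⟨0, 0, -2 * k * r ^ 2 * v⟩, ⟨0, 2 * k * r ^ 2 * v, 0⟩;
      0, ⟨0, r - 2 * r * v, 0⟩, ⟨0, -2 * k * r ^ 2 * v, 0⟩, ⟨k * r ^ 2 * v, 0, 2 * k * r ^ 2 *
          v⟩],
    !![0, 0, 0, 0;
      0, ⟨0, 2 * k * v, 0⟩, ⟨0, r - 2 * r * v, 0⟩, ⟨r * v, 0, -r + 2 * r * v⟩;
      0, ⟨0, r - 2 * r * v, 0⟩, ⟨0, -2 * k * r ^ 2 * v, 0⟩, ⟨k * r ^ 2 * v, 0, 2 * k * r ^ 2 * v⟩;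
      0, ⟨-r * v, 0, r - 2 * r * v⟩, ⟨-k * r ^ 2 * v, 0, -2 * k * r ^ 2 * v⟩, ⟨0, 2 * k * r ^ 2 *
          v, 0⟩]]

/-- The antisymmetric derivatives `∂ᵢ Γ_j - ∂_j Γᵢ` for `i < j`. -/
noncomputable def jetCurl (r q k v : ℝ) : Fin 4 → Fin 4 → Matrix (Fin 4) (Fin 4) Jet
  | 0, 1 => !![0, ⟨-q / 2, 0, 0⟩, 0, 0;
      ⟨q / 2, 0, 0⟩, 0, 0, 0;
      0, 0, 0, 0;
      0, 0, 0, 0]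
  | 1, 2 => !![0, 0, 0, 0;
      0, 0, ⟨1, 0, 1 - 2 * v⟩, ⟨0, -1 + 2 * v, 0⟩;
      0, ⟨-1, 0, -1 + 2 * v⟩, 0, 0;
      0, ⟨0, -1 + 2 * v, 0⟩, 0, 0]
  | 1, 3 => !![0, 0, 0, 0;
      0, 0, ⟨0, 1 - 2 * v, 0⟩, ⟨v, 0, -1 + 2 * v⟩;
      0, ⟨0, 1 - 2 * v, 0⟩, ⟨0, -4 * k * r * v, 0⟩, ⟨2 * k * r * v, 0, 4 * k * r * v⟩;
      0, ⟨-v, 0, 1 - 2 * v⟩, ⟨-2 * k * r * v, 0, -4 * k * r * v⟩, ⟨0, 4 * k * r * v, 0⟩]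
  | 2, 3 => !![0, 0, 0, 0;
      0, ⟨0, 2 - 4 * v, 0⟩, ⟨0, -4 * k * r * v, 0⟩, ⟨2 * k * r * v, 0, 4 * k * r * v⟩;
      0, ⟨0, -4 * k * r * v, 0⟩, ⟨0, -2 * r ^ 2 + 4 * r ^ 2 * v, 0⟩, ⟨r ^ 2 - 2 * r ^ 2 * v, 0, 2
          * r ^ 2 - 4 * r ^ 2 * v⟩;
      0, ⟨-2 * k * r * v, 0, -4 * k * r * v⟩, ⟨-r ^ 2 + 2 * r ^ 2 * v, 0, -2 * r ^ 2 + 4 * r ^ 2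
          * v⟩, ⟨0, 2 * r ^ 2 - 4 * r ^ 2 * v, 0⟩]
  | _, _ => 0

/-- The curvature with lower indices, for `i < j`. -/
noncomputable def jetRiem (r h p q v : ℝ) : Fin 4 → Fin 4 → Matrix (Fin 4) (Fin 4) Jet
  | 0, 1 => !![0, ⟨-q / 2, 0, 3 * p ^ 2 / 4 - p ^ 2 * v / 2⟩, 0, 0;
      ⟨q / 2, 0, -3 * p ^ 2 / 4 + p ^ 2 * v / 2⟩, 0, 0, 0;
      0, 0, 0, 0;
      0, 0, 0, 0]
  | 0, 2 => !![0, 0, ⟨-r * h * p / 2, 0, -3 * r * h * p / 2 + r * h * p * v + 3 * r * h ^ 2 * p /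
          2 - r * h ^ 2 * p * v⟩, ⟨0, r * h * p / 2, 0⟩;
      0, 0, 0, 0;
      ⟨r * h * p / 2, 0, 3 * r * h * p / 2 - r * h * p * v - 3 * r * h ^ 2 * p / 2 + r * h ^ 2 *
          p * v⟩, 0, 0, 0;
      ⟨0, r * h * p / 2, 0⟩, 0, 0, 0]
  | 0, 3 => !![0, 0, ⟨0, r * h * p / 2, 0⟩, ⟨-r * h * p * v / 2, 0, -r * h * p / 2 - r * h * p *
          v + r * h * p * v ^ 2 + 3 * r * h ^ 2 * p * v / 2 - r * h ^ 2 * p * v ^ 2⟩;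
      0, 0, 0, 0;
      ⟨0, r * h * p / 2, 0⟩, 0, 0, 0;
      ⟨r * h * p * v / 2, 0, r * h * p / 2 + r * h * p * v - r * h * p * v ^ 2 - 3 * r * h ^ 2 *
          p * v / 2 + r * h ^ 2 * p * v ^ 2⟩, 0, 0, 0]
  | 1, 2 => !![0, 0, 0, 0;
      0, 0, ⟨r * p / (2 * h), 0, 3 * r * p / (2 * h) - r * p * v / h - 3 * r * p / 2 + r * p *
          v⟩, ⟨0, -r * p / (2 * h), 0⟩;
      0, ⟨-r * p / (2 * h), 0, -3 * r * p / (2 * h) + r * p * v / h + 3 * r * p / 2 - r * p * v⟩,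
          0, 0;
      0, ⟨0, -r * p / (2 * h), 0⟩, 0, 0]
  | 1, 3 => !![0, 0, 0, 0;
      0, 0, ⟨0, -r * p / (2 * h), 0⟩, ⟨r * p * v / (2 * h), 0, r * p / (2 * h) + r * p * v / h -
          r * p * v ^ 2 / h - 3 * r * p * v / 2 + r * p * v ^ 2⟩;
      0, ⟨0, -r * p / (2 * h), 0⟩, 0, 0;
      0, ⟨-r * p * v / (2 * h), 0, -r * p / (2 * h) - r * p * v / h + r * p * v ^ 2 / h + 3 * r *
          p * v / 2 - r * p * v ^ 2⟩, 0, 0]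
  | 2, 3 => !![0, 0, 0, 0;
      0, 0, 0, 0;
      0, 0, ⟨0, 2 * r ^ 2 - 2 * r ^ 2 * h, 0⟩, ⟨-r ^ 2 * v + r ^ 2 * h * v, 0, -2 * r ^ 2 - 2 * r
          ^ 2 * v + 2 * r ^ 2 * v ^ 2 + 2 * r ^ 2 * h + 5 * r ^ 2 * h * v - 4 * r ^ 2 * h * v ^ 2
          - 3 * r ^ 2 * h ^ 2 * v + 2 * r ^ 2 * h ^ 2 * v ^ 2⟩;
      0, 0, ⟨r ^ 2 * v - r ^ 2 * h * v, 0, 2 * r ^ 2 + 2 * r ^ 2 * v - 2 * r ^ 2 * v ^ 2 - 2 * r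
          ^ 2 * h - 5 * r ^ 2 * h * v + 4 * r ^ 2 * h * v ^ 2 + 3 * r ^ 2 * h ^ 2 * v - 2 * r ^ 2
          * h ^ 2 * v ^ 2⟩, ⟨0, -2 * r ^ 2 * v + 2 * r ^ 2 * h * v, 0⟩]
  | _, _ => 0

/-- The Ricci curvature with lower indices. -/
noncomputable def jetRicci (r h p q k v : ℝ) : Matrix (Fin 4) (Fin 4) Jet :=
  !![⟨h * p / r + h * q / 2, 0, 5 * h * p / r - 5 * h * p * v / r - 5 * h ^ 2 * p / r + 4 * h ^ 2 *
          p * v / r - 3 * h * p ^ 2 / 4 + h * p ^ 2 * v / 2 - 3 * h ^ 2 * q / 2 + h ^ 2 * q * v⟩,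
          0, 0, 0;
      0, ⟨-p / (r * h) - q / (2 * h), 0, -5 * p / (r * h) + 5 * p * v / (r * h) + 5 * p / r - 4 *
          p * v / r + 3 * p ^ 2 / (4 * h) - p ^ 2 * v / (2 * h)⟩, ⟨0, 0, k * p * v⟩, ⟨0, -k * p *
          v, 0⟩;
      0, ⟨0, 0, k * p * v⟩, ⟨1 - h - r * p, 0, 8 - 6 * v - 15 * h + 12 * h * v + 7 * h ^ 2 - 6 *
          h ^ 2 * v - 3 * r * p + 2 * r * p * v + 9 * r * h * p / 2 - 3 * r * h * p * v⟩, ⟨0, 3 -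
          2 * v - 3 * h + 2 * h * v - r * p, 0⟩;
      0, ⟨0, k * p * v, 0⟩, ⟨0, 1 + 2 * v - h - 2 * h * v - r * p, 0⟩, ⟨v - h * v - r * p * v, 0,
          3 + v - 4 * v ^ 2 - 3 * h - 4 * h * v + 6 * h * v ^ 2 + 3 * h ^ 2 * v - 2 * h ^ 2 * v ^
          2 - r * p - 2 * r * p * v + 2 * r * p * v ^ 2 + 9 * r * h * p * v / 2 - 3 * r * h * p *
          v ^ 2⟩]

/-- The Ricci curvature `R^i_j`. -/
noncomputable def jetRicciUp (r h p q k v : ℝ) : Matrix (Fin 4) (Fin 4) Jet :=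
  !![⟨-p / r - q / 2, 0, -5 * p / r + 5 * p * v / r + 5 * h * p / r - 4 * h * p * v / r + 3 * p ^ 2
          / 4 - p ^ 2 * v / 2 + 3 * h * q / 2 - h * q * v⟩, 0, 0, 0;
      0, ⟨-p / r - q / 2, 0, -5 * p / r + 5 * p * v / r + 10 * h * p / r - 8 * h * p * v / r + 3
          * p ^ 2 / 4 - p ^ 2 * v / 2 + 3 * h * q / 2 - h * q * v⟩, ⟨0, 0, 6 * k * h * v / r - 6
          * k * h ^ 2 * v / r - k * h * p * v⟩, ⟨0, 2 * k * h * v / r - 2 * k * h ^ 2 * v / r - 3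
          * k * h * p * v, 0⟩;
      0, ⟨0, 0, 3 * k * p / r ^ 2 - 3 * k * p * v / r ^ 2 + k * q / r - k * q * v / r⟩, ⟨1 / r ^
          2 - h / r ^ 2 - p / r, 0, 11 / r ^ 2 - 12 * v / r ^ 2 - 18 * h / r ^ 2 + 18 * h * v / r
          ^ 2 + 7 * h ^ 2 / r ^ 2 - 6 * h ^ 2 * v / r ^ 2 - 4 * p / r + 4 * p * v / r + 9 * h * p
          / (2 * r) - 3 * h * p * v / r⟩, ⟨0, 4 / r ^ 2 - 4 * v / r ^ 2 - 4 * h / r ^ 2 + 4 * h *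
          v / r ^ 2 - 2 * p / r + 2 * p * v / r, 0⟩;
      0, ⟨0, 3 * k * p / r ^ 2 + k * q / r, 0⟩, ⟨0, 4 / r ^ 2 - 4 * h / r ^ 2 - 2 * p / r, 0⟩, ⟨1
          / r ^ 2 - h / r ^ 2 - p / r, 0, 11 / r ^ 2 - 12 * v / r ^ 2 - 18 * h / r ^ 2 + 18 * h *
          v / r ^ 2 + 7 * h ^ 2 / r ^ 2 - 6 * h ^ 2 * v / r ^ 2 - 6 * p / r + 6 * p * v / r + 21
          * h * p / (2 * r) - 9 * h * p * v / r⟩]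

/-- The relation `sin² θ = 1 / (1 + cot² θ)` is the only one between the trigonometric variables;
after substitution the claim is a rational identity in `r`, `h` and `k`. -/
lemma jetMetric_mul_jetInv {r h k v : ℝ} (hr : r ≠ 0) (hh : h ≠ 0) (hv : v = (1 + k ^ 2)⁻¹) :
    jetMetric r h k v * jetInv r h k v = 1 := by
  subst hv
  have hk : 1 + k ^ 2 ≠ 0 := by positivity
  ext1 i j
  fin_cases i <;> fin_cases j <;>
    simp [jetMetric, jetInv, Matrix.mul_apply, Fin.sum_univ_four] <;>
    apply Jet.ext <;> simp <;> field_simp <;> ring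

/-- The opposite connection with lower indices. -/
noncomputable def jetGammaOp (r h p k v : ℝ) (i : Fin 4) : Matrix (Fin 4) (Fin 4) Jet :=
  Matrix.of fun a b => Jet.bar (jetGamma r h p k v i b a)

/-- The curvature computed from the truncated connection. -/
noncomputable def jetLowRiem (r h p q k v : ℝ) (i j : Fin 4) : Matrix (Fin 4) (Fin 4) Jet :=
  jetCurl r q k v i j + jetGamma r h p k v i * jetInv r h k v * jetGammaOp r h p k v j -
    jetGamma r h p k v j * jetInv r h k v * jetGammaOp r h p k v i

-- The values of `h`, `h'` and `h''` are treated as independent variables, so one computation serves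
-- every lapse.
set_option maxHeartbeats 8000000 in
lemma jetLowRiem_eq {r h k v : ℝ} (p q : ℝ) (hr : r ≠ 0) (hh : h ≠ 0) (hv : v = (1 + k ^ 2)⁻¹)
    {i j : Fin 4} (hij : i < j) : jetLowRiem r h p q k v i j = jetRiem r h p q v i j := by
  subst hv
  have hk : 1 + k ^ 2 ≠ 0 := by positivity
  ext1 a b
  simp only [jetLowRiem, Matrix.add_apply, Matrix.sub_apply, Matrix.mul_apply, Fin.sum_univ_four]
  fin_cases i <;> fin_cases j <;> first | exact absurd hij (by decide) | skip
  all_goals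
    fin_cases a <;> fin_cases b <;>
    simp [Jet.ext_iff, jetCurl, jetGamma, jetInv, jetGammaOp, jetRiem, Jet.bar_zero, Jet.bar_mk]
  all_goals (try constructorm* _ ∧ _) <;> field_simp <;>
    first | ring1 | (left; ring1)

-- `jetRiem` is zero unless its first index is smaller than its second, so the difference is its
-- skew-symmetric extension.
set_option maxHeartbeats 4000000 in
lemma jetRicci_eq {r h k v : ℝ} (p q : ℝ) (hr : r ≠ 0) (hh : h ≠ 0) (hv : v = (1 + k ^ 2)⁻¹)
    (i j : Fin 4) :
    ∑ a, ((jetRiem r h p q v a j - jetRiem r h p q v j a) * jetInv r h k v) i a =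
      jetRicci r h p q k v i j := by
  subst hv
  have hk : 1 + k ^ 2 ≠ 0 := by positivity
  simp only [Matrix.sub_apply, Matrix.mul_apply, Fin.sum_univ_four]
  fin_cases i <;> fin_cases j <;> simp [jetRiem, jetInv, jetRicci]
  all_goals
    apply Jet.ext <;>
    simp only [Jet.add_c0, Jet.add_c1, Jet.add_c2, Jet.sub_c0, Jet.sub_c1, Jet.sub_c2,
      Jet.neg_c0, Jet.neg_c1, Jet.neg_c2, Jet.mul_c0, Jet.mul_c1, Jet.mul_c2, Jet.zero_c0,
      Jet.zero_c1, Jet.zero_c2] <;>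
    field_simp <;> ring

set_option maxHeartbeats 4000000 in
lemma jetRicciUp_eq {r h k v : ℝ} (p q : ℝ) (hr : r ≠ 0) (hh : h ≠ 0) (hv : v = (1 + k ^ 2)⁻¹) :
    jetInv r h k v * jetRicci r h p q k v = jetRicciUp r h p q k v := by
  subst hv
  have hk : 1 + k ^ 2 ≠ 0 := by positivity
  ext1 i j
  simp only [Matrix.mul_apply, Fin.sum_univ_four]
  fin_cases i <;> fin_cases j <;> simp [jetInv, jetRicci, jetRicciUp]
  all_goals
    apply Jet.ext <;>
    simp only [Jet.add_c0, Jet.add_c1, Jet.add_c2, Jet.sub_c0, Jet.sub_c1, Jet.sub_c2,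
      Jet.neg_c0, Jet.neg_c1, Jet.neg_c2, Jet.mul_c0, Jet.mul_c1, Jet.mul_c2, Jet.zero_c0,
      Jet.zero_c1, Jet.zero_c2] <;>
    field_simp <;> ring

/-- `R^i_j` modulo the third power of the parameter from the truncated geometry. -/
lemma ricciAt_jet {r h k v : ℝ} (p q : ℝ) (hr : r ≠ 0) (hh : h ≠ 0) (hv : v = (1 + k ^ 2)⁻¹)
    {R : Fin 4 → Fin 4 → Matrix (Fin 4) (Fin 4) Jet} (hs : ∀ i j, R j i = -R i j)
    (hR : ∀ i j, i < j → R i j = jetRiem r h p q v i j) (i j : Fin 4) :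
    ricciAt (jetInv r h k v) R i j = jetRicciUp r h p q k v i j := by
  have h0 : ∀ i j : Fin 4, j ≤ i → jetRiem r h p q v i j = 0 := by
    intro i j hij
    fin_cases i <;> fin_cases j <;> first | exact absurd hij (by decide) | rfl
  -- Skew-symmetry gives `R i i = -R i i`, and the coefficients are real.
  have hd : ∀ i, R i i = 0 := fun i => by
    ext a b
    all_goals
      have := congrArg (fun M : Matrix _ _ Jet => M a b) (hs i i)
      have h1 := congrArg Jet.c0 this
      have h2 := congrArg Jet.c1 this
      have h3 := congrArg Jet.c2 this
      simp only [Matrix.neg_apply, Jet.neg_c0, Jet.neg_c1, Jet.neg_c2] at h1 h2 h3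
      simp only [Matrix.zero_apply, Jet.zero_c0, Jet.zero_c1, Jet.zero_c2]
      linarith
  have key : ∀ i j, R i j = jetRiem r h p q v i j - jetRiem r h p q v j i := by
    intro i j
    rcases lt_trichotomy i j with hij | rfl | hij
    · rw [h0 j i hij.le, sub_zero, hR i j hij]
    · rw [sub_self, hd]
    · rw [h0 i j hij.le, zero_sub, hs j i, hR j i hij]
  rw [← jetRicciUp_eq p q hr hh hv, Matrix.mul_apply, ricciAt]
  simp only [← jetRicci_eq p q hr hh hv, Finset.mul_sum, ← key]
  rw [Finset.sum_comm]
  refine Finset.sum_congr rfl fun a _ => ?_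
  rw [Matrix.mul_assoc, Matrix.mul_apply]

/-! ### The truncated geometry at a point -/

/-- Uses `sinh² ħ = ħ² + O(ħ⁴)` and `sinh ħ cosh ħ = ħ + O(ħ³)`. -/
lemma jet_sph (x : Fin 4 → ℝ) (n m : Fin 4 → ℕ) :
    jet (ev x (sph n m)) = ⟨sphA n m x, sphC n m x, -sphB n m x⟩ := by
  have h1 : ¬ Even 1 := by decide
  have h2 : Even 2 := by decide
  apply Jet.ext <;> simp only [jet, RingHom.coe_mk, MonoidHom.coe_mk, OneHom.coe_mk, coeff_ev,
      coeff_sph, coeff_sinh_sq, coeff_sinh_cosh, h1, h2] <;>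
    norm_num

lemma jet_C (a : ℝ) : jet (PowerSeries.C a) = ⟨a, 0, 0⟩ := by
  apply Jet.ext <;> simp [jet]

lemma jet_evalNegHom (a : PowerSeries ℝ) : jet (PowerSeries.evalNegHom a) = (jet a).bar := by
  apply Jet.ext <;> simp only [jet, RingHom.coe_mk, MonoidHom.coe_mk, OneHom.coe_mk, Jet.bar,
    coeff_evalNegHom] <;> norm_num

/-- `k` and `v` are the cotangent of `t` and the square of its sine. -/
structure Colatitude (t k v : ℝ) : Prop where
  ss : Real.sin t * Real.sin t = v
  cc : Real.cos t * Real.cos t = 1 - v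
  sc : Real.sin t * Real.cos t = k * v
  cs : Real.cos t * Real.sin t = k * v
  sin_two : Real.sin (2 * t) = 2 * k * v
  cos_two : Real.cos (2 * t) = 1 - 2 * v
  sq : v = (1 + k ^ 2)⁻¹
  cot : Real.cot t = k

lemma colatitude {t : ℝ} (ht : Real.sin t ≠ 0) :
    Colatitude t (Real.cos t / Real.sin t) (Real.sin t ^ 2) := by
  have h := Real.sin_sq_add_cos_sq t
  refine ⟨?_, ?_, ?_, ?_, ?_, ?_, ?_, Real.cot_eq_cos_div_sin t⟩
  · ring
  · linarith
  · field_simp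
  · field_simp
  · rw [Real.sin_two_mul]; field_simp
  · rw [Real.cos_two_mul]; linarith
  · have : (0 : ℝ) < 1 + (Real.cos t / Real.sin t) ^ 2 := by positivity
    refine eq_inv_of_mul_eq_one_left ?_
    field_simp
    exact h

lemma jet_metric {h : ℝ → ℝ} {x : Fin 4 → ℝ} {k v : ℝ} (hc : Colatitude (x 2) k v) :
    (Matrix.of fun i j => ev x (staticMetric h i j)).map jet = jetMetric (x 1) (h (x 1)) k v := by
  obtain ⟨a1, a2, a3, a4, a5, a6, -⟩ := hc
  ext1 i j
  rw [Matrix.map_apply, Matrix.of_apply, staticMetric, map_add, map_add, ev_C, jet_C, jet_sph]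
  fin_cases i <;> fin_cases j <;>
    simp [Jet.ext_iff, sphA_apply, sphB, sphC, sep, amp, tm, rad, cos_phase, sin_phase,
      lapsePart, jetMetric, sn_zero, cn_zero, sn_one, cn_one, sn_two, cn_two, a1, a2, a3, a4, a5, a6] <;>
    (try constructorm* _ ∧ _) <;> first | ring1 | (left; ring1)

set_option maxHeartbeats 2000000 in
lemma jet_gamma {h h1 : ℝ → ℝ} {x : Fin 4 → ℝ} {k v : ℝ} (hc : Colatitude (x 2) k v)
    (i : Fin 4) :
    (gammaAt h h1 x i).map jet = jetGamma (x 1) (h (x 1)) (h1 (x 1)) k v i := by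
  obtain ⟨a1, a2, a3, a4, a5, a6, -⟩ := hc
  ext1 j l
  rw [Matrix.map_apply, gammaAt, Matrix.of_apply, lowGamma, map_add, map_add, ev_C, jet_C,
    jet_sph]
  fin_cases i <;> fin_cases j <;> fin_cases l <;>
    simp [Jet.ext_iff, sphA_apply, sphB, sphC, sep, amp, tm, rad, cos_phase, sin_phase,
      lapsePart1, christoffel, jetGamma, sn_zero, cn_zero, sn_one, cn_one, sn_two, cn_two, sn_three, cn_three,
      a1, a2, a3, a4, a5, a6] <;>
    (try constructorm* _ ∧ _) <;> ring

lemma jet_gammaOp {h h1 : ℝ → ℝ} {x : Fin 4 → ℝ} {k v : ℝ} (hc : Colatitude (x 2) k v)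
    (i : Fin 4) :
    (gammaOpAt h h1 x i).map jet = jetGammaOp (x 1) (h (x 1)) (h1 (x 1)) k v i := by
  ext1 a b
  rw [jetGammaOp, Matrix.of_apply, ← jet_gamma hc]
  exact jet_evalNegHom _

set_option maxHeartbeats 4000000 in
lemma jet_curl {h h1 h2 : ℝ → ℝ} (hh : Lapse h h1 h2) {x : Fin 4 → ℝ} (hx : x ∈ region h)
    {k v : ℝ} (hc : Colatitude (x 2) k v) {i j : Fin 4} (hij : i < j) :
    (dgammaAt h h1 x i j - dgammaAt h h1 x j i).map jet = jetCurl (x 1) (h2 (x 1)) k v i j := by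
  obtain ⟨a1, a2, a3, a4, a5, a6, -⟩ := hc
  ext1 a b
  rw [Matrix.map_apply, Matrix.sub_apply, dgammaAt, dgammaAt, Matrix.of_apply, Matrix.of_apply,
    ev_D_lowGamma hh hx, ev_D_lowGamma hh hx]
  simp only [map_add, map_sub, jet_C, jet_sph]
  fin_cases i <;> fin_cases j <;> first | exact absurd hij (by decide) | skip
  all_goals
    fin_cases a <;> fin_cases b <;>
    simp [Jet.ext_iff, sphA_apply, sphB, sphC, sep, amp, tm, rad, cos_phase, sin_phase,
      lapsePart2, christoffel, jetCurl, sn_zero, cn_zero, sn_one, cn_one, sn_two, cn_two, sn_three, cn_three,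
      a1, a2, a3, a4, a5, a6] <;>
    (try constructorm* _ ∧ _) <;> ring

section
variable {h h1 h2 : ℝ → ℝ} {N : Fin 4 → Fin 4 → Formal 4} {x : Fin 4 → ℝ} {k v : ℝ}

/-- The inverse power series is never computed: its truncation inverts the truncated metric, and
inverses are unique. -/
lemma jet_inv (hx : x ∈ region h)
    (hGN : (Matrix.of fun i j => ev x (staticMetric h i j)) * invAt N x = 1)
    (hc : Colatitude (x 2) k v) : (invAt N x).map jet = jetInv (x 1) (h (x 1)) k v := by
  have h1 := congrArg (fun M : Matrix _ _ _ => M.map jet) hGN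
  simp only [Matrix.map_mul, jet_metric hc, Matrix.map_one _ (map_zero jet) (map_one jet)] at h1
  exact left_inv_eq_right_inv (mul_eq_one_comm.1 h1)
    (jetMetric_mul_jetInv hx.1.ne' hx.2.1.ne' hc.sq)

lemma jet_ricciAt (hh : Lapse h h1 h2) (hx : x ∈ region h)
    (hGN : (Matrix.of fun i j => ev x (staticMetric h i j)) * invAt N x = 1)
    (hc : Colatitude (x 2) k v) (i j : Fin 4) :
    jet (ricciAt (invAt N x) (riemAt h h1 N x) i j) =
      jetRicciUp (x 1) (h (x 1)) (h1 (x 1)) (h2 (x 1)) k v i j := by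
  have hN := jet_inv hx hGN hc
  have hr := hx.1.ne'
  have hp := hx.2.1.ne'
  have hR : ∀ i j, i < j → (riemAt h h1 N x i j).map jet =
      jetRiem (x 1) (h (x 1)) (h1 (x 1)) (h2 (x 1)) v i j := fun i j hij => by
    rw [← jetLowRiem_eq _ _ hr hp hc.sq hij, jetLowRiem, ← jet_curl hh hx hc hij, riemAt, lowRiem,
      ← jet_gamma hc, ← jet_gamma hc, ← jet_gammaOp hc, ← jet_gammaOp hc, ← hN]
    simp only [← Matrix.map_mul]
    ext1 a b
    simp only [Matrix.map_apply, Matrix.add_apply, Matrix.sub_apply, map_add, map_sub]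
  rw [← ricciAt_jet (h1 (x 1)) (h2 (x 1)) hr hp hc.sq
    (R := fun i j => (riemAt h h1 N x i j).map jet) (fun i j => ?_) hR, ricciAt, ricciAt, map_sum]
  · refine Finset.sum_congr rfl fun p _ => ?_
    rw [← hN, ← Matrix.map_mul, ← Matrix.map_mul, Matrix.map_apply]
  · ext1 a b
    simp only [riemAt]
    rw [lowRiem_swap, Matrix.map_apply, Matrix.neg_apply, map_neg]
    rfl

end

/-! ### The metric in closed form -/

lemma coeff_scale (S : PowerSeries ℝ) (f : Fn 4) (k : ℕ) :
    PowerSeries.coeff k (scale S f) = PowerSeries.coeff k S • f :=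
  PowerSeries.coeff_mk _ _

lemma staticMetric_eq (h : ℝ → ℝ) (i j : Fin 4) : staticMetric h i j = deformedMetric h i j := by
  ext1 k
  funext x
  have hc : Real.cos (x 2) * Real.cos (x 2) = 1 - Real.sin (x 2) ^ 2 := by
    linarith [Real.sin_sq_add_cos_sq (x 2)]
  have hc2 : Real.cos (x 2) ^ 2 = 1 - Real.sin (x 2) ^ 2 := by
    linarith [Real.sin_sq_add_cos_sq (x 2)]
  have h2 : Real.cos (2 * x 2) = 1 - 2 * Real.sin (x 2) ^ 2 := by
    rw [Real.cos_two_mul, hc2]; ring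
  rw [staticMetric, map_add, coeff_sph, deformedMetric]
  -- The closed forms agree for arbitrary series in place of the two hyperbolic products, so only
  -- trigonometry in `θ` remains.
  generalize sinhSeries * sinhSeries = S
  generalize sinhSeries * coshSeries = T
  simp only [PowerSeries.coeff_C]
  fin_cases i <;> fin_cases j <;>
    simp only [Fin.zero_eta, Fin.mk_one, Fin.reduceFinMk, Matrix.cons_val, map_add, map_sub,
      map_neg, map_zero, PowerSeries.coeff_C, coeff_scale] <;>
    generalize PowerSeries.coeff k S = s <;> generalize PowerSeries.coeff k T = t <;>
    by_cases hk : k = 0 <;>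
    simp [hk, sphA_apply, sphB, sphC, sep, amp, tm, rad, cos_phase, sin_phase, lapsePart,
      sn_zero, cn_zero, sn_one, cn_one, sn_two, cn_two, hc, hc2, h2, Real.sin_two_mul] <;>
    first | done | ring1 | (ring_nf; simp)

/-! ### Expansions from coefficients at points -/

instance (i j : Fin 4) : Decidable (OnePhi i j) := inferInstanceAs (Decidable (Xor _ _))

/-- The structure of the coefficients of `R^i_j` at a point, with classical value `c δ^i_j` and
leading corrections `ρ`. -/
structure RicciCoeff (c : ℝ) (ρ : Fin 4 → Fin 4 → ℝ) (A : Fin 4 → Fin 4 → PowerSeries ℝ) :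
    Prop where
  time : ∀ i j, OneTime i j → A i j = 0
  even : ∀ i j, OnePhi i j → ∀ k, Even k → PowerSeries.coeff k (A i j) = 0
  odd : ∀ i j, ¬ OnePhi i j → ∀ k, Odd k → PowerSeries.coeff k (A i j) = 0
  zero : ∀ i j, ¬ OnePhi i j → PowerSeries.coeff 0 (A i j) = if i = j then c else 0
  one : ∀ i j, OnePhi i j → PowerSeries.coeff 1 (A i j) = ρ i j
  two : ∀ i j, ¬ OnePhi i j → PowerSeries.coeff 2 (A i j) = ρ i j

lemma not_onePhi_self (i : Fin 4) : ¬ OnePhi i i := by simp [OnePhi, Xor]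

lemma not_oneTime_self (i : Fin 4) : ¬ OneTime i i := by simp [OneTime, Xor]

/-- Vanishing in all orders of the wrong parity comes from the two reflections; the leading
coefficients are read off the truncation. -/
lemma ricciCoeff {h h1 h2 : ℝ → ℝ} (hh : Lapse h h1 h2) {x : Fin 4 → ℝ} (hx : x ∈ region h)
    {N : Fin 4 → Fin 4 → Formal 4}
    (hGN : (Matrix.of fun i j => ev x (staticMetric h i j)) * invAt N x = 1) {k v c : ℝ}
    (hc : Colatitude (x 2) k v) {ρ : Fin 4 → Fin 4 → ℝ}
    (hρ : ∀ i j, jetRicciUp (x 1) (h (x 1)) (h1 (x 1)) (h2 (x 1)) k v i j =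
      if OnePhi i j then ⟨0, ρ i j, 0⟩ else ⟨if i = j then c else 0, 0, ρ i j⟩) :
    RicciCoeff c ρ (ricciAt (invAt N x) (riemAt h h1 N x)) := by
  have hj := fun i j => (jet_ricciAt hh hx hGN hc i j).trans (hρ i j)
  have hphi := fun i j k => congrArg (PowerSeries.coeff k) (ricciAt_phi hh hx hGN i j)
  have hs : ∀ i j : Fin 4, reflect 3 i * reflect 3 j =
      PowerSeries.C (if OnePhi i j then (-1 : ℝ) else 1) := fun i j => by
    fin_cases i <;> fin_cases j <;> simp [reflect, OnePhi, Xor]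
  simp only [hs, coeff_evalNegHom, PowerSeries.coeff_C_mul] at hphi
  refine ⟨fun i j hij => ?_, fun i j hij k hk => ?_, fun i j hij k hk => ?_, fun i j hij => ?_,
    fun i j hij => ?_, fun i j hij => ?_⟩
  · have h1 := ricciAt_time hh hx hGN i j
    have h0 : reflect 0 i * reflect 0 j = -1 := by
      rcases hij with ⟨hi, hj⟩ | ⟨hi, hj⟩ <;> simp [reflect, hi, hj]
    rw [h0, neg_one_mul] at h1
    ext k
    have := congrArg (PowerSeries.coeff k) h1
    rw [map_neg] at this
    rw [map_zero]
    linarith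
  · have := hphi i j k
    rw [if_pos hij, hk.neg_one_pow] at this
    linarith
  · have := hphi i j k
    rw [if_neg hij, hk.neg_one_pow] at this
    linarith
  · have := congrArg Jet.c0 (hj i j)
    rwa [if_neg hij] at this
  · have := congrArg Jet.c1 (hj i j)
    rwa [if_pos hij] at this
  · have := congrArg Jet.c2 (hj i j)
    rwa [if_neg hij] at this

lemma same_zero_of_coeff {n : ℕ} {U : Set (Fin n → ℝ)} {F : Formal n}
    (hF : ∀ k, ∀ x ∈ U, PowerSeries.coeff k F x = 0) : Same U F 0 := fun k x hx => by
  rw [hF k x hx, map_zero, Pi.zero_apply]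

/-- The expansions of the curvatures from the coefficients at all points. -/
lemma expansions {U : Set (Fin 4 → ℝ)} {R T : Fin 4 → Fin 4 → Formal 4} {S : Formal 4}
    {A : (Fin 4 → ℝ) → Fin 4 → Fin 4 → PowerSeries ℝ} {c d : ℝ} {ρ τ : Fin 4 → Fin 4 → Fn 4}
    (hd : d = 2 * c) (hR : ∀ x ∈ U, ∀ i j, ev x (R i j) = A x i j)
    (hT : ∀ x ∈ U, ∀ i j, ev x (T i j) = PowerSeries.evalNegHom (A x i j))
    (hS : ∀ x ∈ U, ev x S = ∑ i, A x i i)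
    (hA : ∀ x ∈ U, RicciCoeff c (fun i j => ρ i j x) (A x))
    (hτ : ∀ x ∈ U, ∀ i j, 2 * τ i j x = if OnePhi i j then 0 else
      2 * ρ i j x - if i = j then ∑ a, ρ a a x else 0) :
    (∀ i j, SameMod 2 U (R i j + T i j - (if i = j then S else 0) + d • delta i j) 0) ∧
    (∀ i j, ∀ x ∈ U,
      PowerSeries.coeff 0 (R i j) x = PowerSeries.coeff 0 (T i j) x ∧
      PowerSeries.coeff 1 (R i j) x = - PowerSeries.coeff 1 (T i j) x ∧
      PowerSeries.coeff 2 (R i j) x = PowerSeries.coeff 2 (T i j) x) ∧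
    HasExpansion U c ρ R T ∧
    (∀ i j, SameMod 4 U (R i j + T i j - (if i = j then S else 0) + d • delta i j)
      ((2 : ℝ) • PowerSeries.monomial 2 (τ i j))) ∧
    (∀ i j, OneTime i j ∨ OnePhi i j →
      Same U (R i j + T i j - (if i = j then S else 0) + d • delta i j) 0) := by
  have cR : ∀ x ∈ U, ∀ i j k, PowerSeries.coeff k (R i j) x = PowerSeries.coeff k (A x i j) :=
    fun x hx i j k => by rw [← hR x hx, coeff_ev]
  have cT : ∀ x ∈ U, ∀ i j k, PowerSeries.coeff k (T i j) x =
      (-1) ^ k * PowerSeries.coeff k (A x i j) :=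
    fun x hx i j k => by rw [← coeff_evalNegHom, ← hT x hx, coeff_ev]
  have cS : ∀ x ∈ U, ∀ k, PowerSeries.coeff k S x = ∑ a, PowerSeries.coeff k (A x a a) :=
    fun x hx k => by rw [← map_sum, ← hS x hx, coeff_ev]
  have cδ : ∀ (i j : Fin 4) (k : ℕ) (x : Fin 4 → ℝ), PowerSeries.coeff k (delta i j : Formal 4) x =
      if i = j ∧ k = 0 then 1 else 0 := fun i j k x => by
    by_cases hij : i = j
    · by_cases hk : k = 0 <;> simp [delta, hij, hk, PowerSeries.coeff_one]
    · simp [delta, hij]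
  have total : ∀ x ∈ U, ∀ i j k, PowerSeries.coeff k
      (R i j + T i j - (if i = j then S else 0) + d • delta i j) x =
      PowerSeries.coeff k (A x i j) + (-1) ^ k * PowerSeries.coeff k (A x i j) -
        (if i = j then ∑ a, PowerSeries.coeff k (A x a a) else 0) +
        d * if i = j ∧ k = 0 then 1 else 0 := fun x hx i j k => by
    rw [map_add, map_sub, map_add, Pi.add_apply, Pi.sub_apply, Pi.add_apply, cR x hx, cT x hx,
      PowerSeries.coeff_smul, Pi.smul_apply, cδ, smul_eq_mul]
    split_ifs <;> simp [cS x hx]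
  -- Such components are off the diagonal, so the scalar and `delta` terms are absent. With one time
  -- index both curvatures vanish; with one index `φ` the series is odd, and `Θ`, being its sign
  -- reversal, cancels it.
  have exact_zero : ∀ i j, OneTime i j ∨ OnePhi i j →
      Same U (R i j + T i j - (if i = j then S else 0) + d • delta i j) 0 := by
    refine fun i j hij => same_zero_of_coeff fun k x hx => ?_
    have hne : i ≠ j := by
      rintro rfl
      exact hij.elim (not_oneTime_self i) (not_onePhi_self i)
    have hk : PowerSeries.coeff k (A x i j) + (-1) ^ k * PowerSeries.coeff k (A x i j) = 0 := by
      rcases hij with hij | hij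
      · rw [(hA x hx).time i j hij, map_zero, mul_zero, add_zero]
      · rcases Nat.even_or_odd k with hk | hk
        · rw [(hA x hx).even i j hij k hk, mul_zero, add_zero]
        · rw [hk.neg_one_pow]; ring
    rw [total x hx, hk]
    simp [hne]
  have mod4 : ∀ i j, SameMod 4 U (R i j + T i j - (if i = j then S else 0) + d • delta i j)
      ((2 : ℝ) • PowerSeries.monomial 2 (τ i j)) := by
    intro i j k hk x hx
    have hm : PowerSeries.coeff k ((2 : ℝ) • PowerSeries.monomial 2 (τ i j) : Formal 4) x =
        if k = 2 then 2 * τ i j x else 0 := by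
      rw [PowerSeries.coeff_smul, PowerSeries.coeff_monomial]
      split_ifs <;> simp
    rw [hm, hτ x hx]
    by_cases hij : OnePhi i j
    · rw [exact_zero i j (Or.inr hij) k x hx, if_pos hij]
      simp
    · rw [total x hx, if_neg hij]
      have odd : ∀ a b, ¬ OnePhi a b → ∀ k, Odd k → PowerSeries.coeff k (A x a b) = 0 :=
        (hA x hx).odd
      interval_cases k
      -- Order zero on the diagonal: `c + c - 4c + d = 0`, the trace being taken in dimension four.
      -- This fixes `d = 2c`.
      · simp only [(hA x hx).zero i j hij, (hA x hx).zero _ _ (not_onePhi_self _), hd]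
        by_cases h : i = j
        · simp [h]; ring
        · simp [h]
      · simp only [odd i j hij 1 (by decide), odd _ _ (not_onePhi_self _) 1 (by decide)]
        simp
      · simp only [(hA x hx).two i j hij, (hA x hx).two _ _ (not_onePhi_self _)]
        simp
        ring
      · simp only [odd i j hij 3 (by decide), odd _ _ (not_onePhi_self _) 3 (by decide)]
        simp
  refine ⟨fun i j k hk x hx => ?_, fun i j x hx => ?_, ⟨?_, ?_, ?_⟩, mod4, exact_zero⟩
  · rw [mod4 i j k (by omega) x hx, PowerSeries.coeff_smul, PowerSeries.coeff_monomial,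
      if_neg (by omega)]
    simp
  -- These relations need no parity: `Θ` has the coefficients of `R` multiplied by `(-1) ^ k`.
  · rw [cR x hx, cR x hx, cR x hx, cT x hx, cT x hx, cT x hx]
    refine ⟨?_, ?_, ?_⟩ <;> ring
  · refine fun i j hij => ⟨same_zero_of_coeff fun k x hx => ?_,
      same_zero_of_coeff fun k x hx => ?_⟩
    · rw [cR x hx, (hA x hx).time i j hij, map_zero]
    · rw [cT x hx, (hA x hx).time i j hij, map_zero, mul_zero]
  · refine fun i j hij => ⟨fun k x hx => ?_, fun k hk x hx => ?_⟩
    · rw [cR x hx, map_neg, Pi.neg_apply, cT x hx]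
      rcases Nat.even_or_odd k with hk | hk
      · rw [(hA x hx).even i j hij k hk]; ring
      · rw [hk.neg_one_pow]; ring
    · rw [cR x hx, PowerSeries.coeff_monomial]
      interval_cases k
      · rw [(hA x hx).even i j hij 0 (by decide)]; simp
      · rw [(hA x hx).one i j hij]; simp
      · rw [(hA x hx).even i j hij 2 (by decide)]; simp
  · refine fun i j hij => ⟨fun k x hx => ?_, fun k hk x hx => ?_⟩
    · rw [cR x hx, cT x hx]
      rcases Nat.even_or_odd k with hk | hk
      · rw [hk.neg_one_pow, one_mul]
      · rw [(hA x hx).odd i j hij k hk, mul_zero]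
    · rw [cR x hx, map_add, Pi.add_apply, PowerSeries.coeff_smul, Pi.smul_apply, cδ,
        PowerSeries.coeff_monomial]
      interval_cases k
      · rw [(hA x hx).zero i j hij]; simp
      · rw [(hA x hx).odd i j hij 1 (by decide)]; simp
      · rw [(hA x hx).two i j hij]; simp
      · rw [(hA x hx).odd i j hij 3 (by decide)]; simp

/-! ### The two spacetimes -/

/-- The lapse `1 - a r² - 2m / r`. -/
noncomputable def lapseFn (m a r : ℝ) : ℝ := 1 - a * r ^ 2 - 2 * m / r

/-- The derivative of `lapseFn`. -/
noncomputable def lapseFn1 (m a r : ℝ) : ℝ := 2 * m / r ^ 2 - 2 * a * r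

/-- The second derivative of `lapseFn`. -/
noncomputable def lapseFn2 (m a r : ℝ) : ℝ := -2 * a - 4 * m / r ^ 3

lemma lapse_lapseFn (m a : ℝ) : Lapse (lapseFn m a) (lapseFn1 m a) (lapseFn2 m a) := by
  refine ⟨fun r hr => ?_, fun r hr => ?_, ?_, ?_⟩
  · have h0 := hr.ne'
    refine ((((hasDerivAt_const r (1 : ℝ)).fun_sub (((hasDerivAt_id' r).fun_pow 2).const_mul a)).fun_sub
      ((hasDerivAt_const r (2 * m)).fun_div (hasDerivAt_id' r) h0))).congr_deriv ?_
    rw [lapseFn1]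
    field_simp
    ring
  · have h0 := hr.ne'
    refine (((hasDerivAt_const r (2 * m)).fun_div ((hasDerivAt_id' r).fun_pow 2)
      (pow_ne_zero 2 h0)).fun_sub ((hasDerivAt_id' r).const_mul (2 * a))).congr_deriv ?_
    rw [lapseFn2]
    field_simp
    ring
  · exact ((contDiff_const.sub (contDiff_const.mul (contDiff_id.pow 2))).contDiffOn).sub
      (contDiffOn_const.div contDiffOn_id fun r hr => (Set.mem_Ioi.1 hr).ne')
  · exact (contDiffOn_const.div (contDiff_id.pow 2).contDiffOn
      fun r hr => pow_ne_zero 2 (Set.mem_Ioi.1 hr).ne').sub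
      (contDiff_const.mul contDiff_id).contDiffOn

/-- Both spacetimes belong to the family `lapseFn m a`, with `a = 0` here and `a = 1 / l ^ 2` below.
-/
lemma schwarzschildLapse_eq (m : ℝ) : schwarzschildLapse m = lapseFn m 0 := by
  funext r; rw [schwarzschildLapse, lapseFn]; ring

lemma deSitterLapse_eq (m l : ℝ) : deSitterLapse m l = lapseFn m (1 / l ^ 2) := by
  funext r; rw [deSitterLapse, lapseFn]; ring

-- The redundant `if i = j then 0 else 0` matches the general form of the expansion with classical
-- value `c = 0`.
set_option maxHeartbeats 4000000 in
lemma schwarzschild_jet (m : ℝ) {x : Fin 4 → ℝ} (hr : x 1 ≠ 0) {k v : ℝ}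
    (hc : Colatitude (x 2) k v) (i j : Fin 4) :
    jetRicciUp (x 1) (lapseFn m 0 (x 1)) (lapseFn1 m 0 (x 1)) (lapseFn2 m 0 (x 1)) k v i j =
      if OnePhi i j then ⟨0, schwarzschildRicci m i j x, 0⟩ else
        ⟨if i = j then 0 else 0, 0, schwarzschildRicci m i j x⟩ := by
  have cc : Real.cos (x 2) ^ 2 = 1 - v := by rw [sq, hc.cc]
  fin_cases i <;> fin_cases j <;>
    simp [Jet.ext_iff, jetRicciUp, lapseFn, lapseFn1, lapseFn2, OnePhi, Xor, schwarzschildRicci, cc,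
      hc.cot, hc.sin_two, hc.cos_two] <;>
    (try constructorm* _ ∧ _) <;> field_simp <;> ring

set_option maxHeartbeats 4000000 in
lemma deSitter_jet (m : ℝ) {l : ℝ} (hl : l ≠ 0) {x : Fin 4 → ℝ} (hr : x 1 ≠ 0) {k v : ℝ}
    (hc : Colatitude (x 2) k v) (i j : Fin 4) :
    jetRicciUp (x 1) (lapseFn m (1 / l ^ 2) (x 1)) (lapseFn1 m (1 / l ^ 2) (x 1))
      (lapseFn2 m (1 / l ^ 2) (x 1)) k v i j =
      if OnePhi i j then ⟨0, deSitterRicci m l i j x, 0⟩ else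
        ⟨if i = j then 3 / l ^ 2 else 0, 0, deSitterRicci m l i j x⟩ := by
  have cc : Real.cos (x 2) ^ 2 = 1 - v := by rw [sq, hc.cc]
  fin_cases i <;> fin_cases j <;>
    simp [Jet.ext_iff, jetRicciUp, lapseFn, lapseFn1, lapseFn2, OnePhi, Xor, deSitterRicci, cc,
      hc.cot, hc.sin_two, hc.cos_two] <;>
    (try constructorm* _ ∧ _) <;> field_simp <;> ring

/-- Since `R` and `Θ` agree at order `ħ²` away from the components with one index `φ`, `2 τ` is `2
ρ` minus the trace of `ρ` on the diagonal. -/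
lemma schwarzschild_trace (m : ℝ) {x : Fin 4 → ℝ} (hr : x 1 ≠ 0) (i j : Fin 4) :
    2 * schwarzschildT m i j x = if OnePhi i j then 0 else
      2 * schwarzschildRicci m i j x - if i = j then ∑ a, schwarzschildRicci m a a x else 0 := by
  rw [Fin.sum_univ_four]
  fin_cases i <;> fin_cases j <;>
    simp [OnePhi, Xor, schwarzschildRicci, schwarzschildT] <;> field_simp <;> ring

lemma deSitter_trace (m : ℝ) {l : ℝ} (hl : l ≠ 0) {x : Fin 4 → ℝ} (hr : x 1 ≠ 0) (i j : Fin 4) :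
    2 * deSitterT m l i j x = if OnePhi i j then 0 else
      2 * deSitterRicci m l i j x - if i = j then ∑ a, deSitterRicci m l a a x else 0 := by
  rw [Fin.sum_univ_four]
  fin_cases i <;> fin_cases j <;>
    simp [OnePhi, Xor, deSitterRicci, deSitterT] <;> field_simp <;> ring

section
variable {h h1 h2 q : ℝ → ℝ} {U : Set (Fin 4 → ℝ)}

/-- Both embeddings are compared with one expression that contains neither `f` nor the choice of
signs. -/
lemma embeddings_agree (hh : Lapse h h1 h2) (hq : ∀ r, 0 < r → q r = h1 r ^ 2 / 4)
    (hU : IsOpen U) (hUh : U ⊆ region h) (η η' : Fin 6 → ℝ) (X X' : Fin 6 → Formal 4)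
    (hX : IsEmbedding h q U η X) (hX' : IsEmbedding h q U η' X') :
    (∀ i j, Same U (metric angular η X i j) (metric angular η' X' i j)) ∧
    (∀ i j k, Same U (torsion angular η X i j k) (torsion angular η' X' i j k)) := by
  obtain ⟨F, hF, rfl⟩ := exists_sphereLike hh hq hU hUh hX
  obtain ⟨F', hF', rfl⟩ := exists_sphereLike hh hq hU hUh hX'
  refine ⟨fun i j => (metric_same hF i j).trans (metric_same hF' i j).symm, fun i j k => ?_⟩
  rw [torsion_eq hF, torsion_eq hF']
  exact fun _ _ _ => rfl

lemma curvature_expansions (hh : Lapse h h1 h2) (hq : ∀ r, 0 < r → q r = h1 r ^ 2 / 4)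
    (hU : IsOpen U) (hUh : U ⊆ region h) {c d : ℝ} {ρ τ : Fin 4 → Fin 4 → Fn 4} (hd : d = 2 * c)
    (hρ : ∀ x ∈ U, ∀ k v, Colatitude (x 2) k v → ∀ i j,
      jetRicciUp (x 1) (h (x 1)) (h1 (x 1)) (h2 (x 1)) k v i j =
        if OnePhi i j then ⟨0, ρ i j x, 0⟩ else ⟨if i = j then c else 0, 0, ρ i j x⟩)
    (hτ : ∀ x ∈ U, ∀ i j, 2 * τ i j x = if OnePhi i j then 0 else
      2 * ρ i j x - if i = j then ∑ a, ρ a a x else 0)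
    (η : Fin 6 → ℝ) (X : Fin 6 → Formal 4) (hX : IsEmbedding h q U η X) :
    (∀ i j, Same U (metric angular η X i j) (deformedMetric h i j)) ∧
    (∃ gi, IsInverse angular U (metric angular η X) gi) ∧
    ∀ gi, IsInverse angular U (metric angular η X) gi →
      let R := ricciUp angular η X gi
      let T := theta angular η X gi
      let S := scalar angular η X gi
      (∀ i j, SameMod 2 U (R i j + T i j - (if i = j then S else 0) + d • delta i j) 0) ∧
      (∀ i j, ∀ x ∈ U,
        PowerSeries.coeff 0 (R i j) x = PowerSeries.coeff 0 (T i j) x ∧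
        PowerSeries.coeff 1 (R i j) x = - PowerSeries.coeff 1 (T i j) x ∧
        PowerSeries.coeff 2 (R i j) x = PowerSeries.coeff 2 (T i j) x) ∧
      HasExpansion U c ρ R T ∧
      (∀ i j, SameMod 4 U (R i j + T i j - (if i = j then S else 0) + d • delta i j)
        ((2 : ℝ) • PowerSeries.monomial 2 (τ i j))) ∧
      (∀ i j, OneTime i j ∨ OnePhi i j →
        Same U (R i j + T i j - (if i = j then S else 0) + d • delta i j) 0) := by
  obtain ⟨F, hF, rfl⟩ := exists_sphereLike hh hq hU hUh hX
  obtain ⟨N, hN, hGN⟩ := exists_static_inverse hh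
  refine ⟨fun i j => ?_, ⟨N, isInverse_static hh hU hUh hF hN hGN⟩, fun gi hgi => ?_⟩
  · rw [← staticMetric_eq]
    exact metric_same hF i j
  · have hs := inverse_same hh hU hUh hF hN hGN hgi
    exact expansions hd (fun x hx => ricciUp_eq hh hU hUh hF hN hGN hs hx)
      (fun x hx i j => (theta_eq hh hU hUh hF hN hGN hs hx i j).trans
        (thetaAt_bar hh (hUh hx) (hGN x (hUh hx)) i j))
      (fun x hx => scalar_eq hh hU hUh hF hN hGN hs hx)
      (fun x hx => ricciCoeff hh (hUh hx) (hGN x (hUh hx)) (colatitude (hUh hx).2.2)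
        (hρ x hx _ _ (colatitude (hUh hx).2.2))) hτ

end

end Moyal

theorem mainTheorem11 :
    -- the Schwarzschild spacetime
    (∀ (m : ℝ) (U : Set (Fin 4 → ℝ)), IsOpen U →
      (∀ x ∈ U, 0 < x 1 ∧ 0 < schwarzschildLapse m (x 1) ∧ Real.sin (x 2) ≠ 0) →
      (∀ (η : Fin 6 → ℝ) (X : Fin 6 → Formal 4),
        IsEmbedding (schwarzschildLapse m) (fun r => m ^ 2 / r ^ 4) U η X →
        (∀ i j, Same U (metric angular η X i j) (deformedMetric (schwarzschildLapse m) i j)) ∧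
        (∃ gi, IsInverse angular U (metric angular η X) gi) ∧
        ∀ gi, IsInverse angular U (metric angular η X) gi →
          let R := ricciUp angular η X gi
          let Θ := theta angular η X gi
          let S := scalar angular η X gi
          (∀ i j, SameMod 2 U (R i j + Θ i j - (if i = j then S else 0)) 0) ∧
          (∀ i j, ∀ x ∈ U,
            PowerSeries.coeff 0 (R i j) x = PowerSeries.coeff 0 (Θ i j) x ∧
            PowerSeries.coeff 1 (R i j) x = - PowerSeries.coeff 1 (Θ i j) x ∧
            PowerSeries.coeff 2 (R i j) x = PowerSeries.coeff 2 (Θ i j) x) ∧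
          HasExpansion U 0 (schwarzschildRicci m) R Θ ∧
          (∀ i j, SameMod 4 U (R i j + Θ i j - (if i = j then S else 0))
            ((2 : ℝ) • PowerSeries.monomial 2 (schwarzschildT m i j))) ∧
          (∀ i j, OneTime i j ∨ OnePhi i j →
            Same U (R i j + Θ i j - (if i = j then S else 0)) 0)) ∧
      (∀ (η η' : Fin 6 → ℝ) (X X' : Fin 6 → Formal 4),
        IsEmbedding (schwarzschildLapse m) (fun r => m ^ 2 / r ^ 4) U η X →
        IsEmbedding (schwarzschildLapse m) (fun r => m ^ 2 / r ^ 4) U η' X' →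
        (∀ i j, Same U (metric angular η X i j) (metric angular η' X' i j)) ∧
        (∀ i j k, Same U (torsion angular η X i j k) (torsion angular η' X' i j k)))) ∧
    -- the Schwarzschild–de Sitter spacetime
    (∀ (m l : ℝ) (U : Set (Fin 4 → ℝ)), l ≠ 0 → IsOpen U →
      (∀ x ∈ U, 0 < x 1 ∧ 0 < deSitterLapse m l (x 1) ∧ Real.sin (x 2) ≠ 0) →
      (∀ (η : Fin 6 → ℝ) (X : Fin 6 → Formal 4),
        IsEmbedding (deSitterLapse m l) (fun r => (m / r ^ 2 - r / l ^ 2) ^ 2) U η X →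
        (∀ i j, Same U (metric angular η X i j) (deformedMetric (deSitterLapse m l) i j)) ∧
        (∃ gi, IsInverse angular U (metric angular η X) gi) ∧
        ∀ gi, IsInverse angular U (metric angular η X) gi →
          let R := ricciUp angular η X gi
          let Θ := theta angular η X gi
          let S := scalar angular η X gi
          (∀ i j, SameMod 2 U
            (R i j + Θ i j - (if i = j then S else 0) + (6 / l ^ 2) • delta i j) 0) ∧
          (∀ i j, ∀ x ∈ U,
            PowerSeries.coeff 0 (R i j) x = PowerSeries.coeff 0 (Θ i j) x ∧
            PowerSeries.coeff 1 (R i j) x = - PowerSeries.coeff 1 (Θ i j) x ∧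
            PowerSeries.coeff 2 (R i j) x = PowerSeries.coeff 2 (Θ i j) x) ∧
          HasExpansion U (3 / l ^ 2) (deSitterRicci m l) R Θ ∧
          (∀ i j, SameMod 4 U
            (R i j + Θ i j - (if i = j then S else 0) + (6 / l ^ 2) • delta i j)
            ((2 : ℝ) • PowerSeries.monomial 2 (deSitterT m l i j))) ∧
          (∀ i j, OneTime i j ∨ OnePhi i j → Same U
            (R i j + Θ i j - (if i = j then S else 0) + (6 / l ^ 2) • delta i j) 0)) ∧
      (∀ (η η' : Fin 6 → ℝ) (X X' : Fin 6 → Formal 4),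
        IsEmbedding (deSitterLapse m l) (fun r => (m / r ^ 2 - r / l ^ 2) ^ 2) U η X →
        IsEmbedding (deSitterLapse m l) (fun r => (m / r ^ 2 - r / l ^ 2) ^ 2) U η' X' →
        (∀ i j, Same U (metric angular η X i j) (metric angular η' X' i j)) ∧
        (∀ i j k, Same U (torsion angular η X i j k) (torsion angular η' X' i j k)))) := by
  refine ⟨fun m U hU hUh => ?_, fun m l U hl hU hUh => ?_⟩
  · rw [schwarzschildLapse_eq] at *
    have hh := lapse_lapseFn m 0
    -- The prescribed `q` is exactly `h'² / 4`.
    have hq : ∀ r, 0 < r → m ^ 2 / r ^ 4 = lapseFn1 m 0 r ^ 2 / 4 := fun r hr => by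
      rw [lapseFn1]; field_simp; ring
    -- Here `Λ = 0`, so the cosmological term of the general statement is removed.
    have h0 : ∀ (F : Formal 4) (i j : Fin 4), F + (0 : ℝ) • delta i j = F := fun F i j => by
      rw [zero_smul, add_zero]
    have key := curvature_expansions hh hq hU hUh (mul_zero 2).symm
      (fun x hx k v hc i j => schwarzschild_jet m (hUh x hx).1.ne' hc i j)
      (fun x hx i j => schwarzschild_trace m (hUh x hx).1.ne' i j)
    simp only [h0] at key
    exact ⟨key, embeddings_agree hh hq hU hUh⟩
  · rw [deSitterLapse_eq] at *
    have hh := lapse_lapseFn m (1 / l ^ 2)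
    have hq : ∀ r, 0 < r → (m / r ^ 2 - r / l ^ 2) ^ 2 = lapseFn1 m (1 / l ^ 2) r ^ 2 / 4 :=
      fun r hr => by rw [lapseFn1]; ring
    exact ⟨curvature_expansions hh hq hU hUh (by ring)
      (fun x hx k v hc i j => deSitter_jet m hl (hUh x hx).1.ne' hc i j)
      (fun x hx i j => deSitter_trace m hl (hUh x hx).1.ne' i j),
      embeddings_agree hh hq hU hUh⟩
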